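/- **Setting.** For $n\ge 1$ and $\theta_0\in\mathbb R^n$ one observes $X=(X_1,\dots,X_n)$ with independent $X_i\sim\mathcal N(\theta_{0,i},1)$. Let $\phi$ be the standard normal density. For $w\in[0,1]$ let $\Pi_{w,\gamma}=((1-w)\delta_0+w\,\mathcal G)^{\otimes n}$, where $\mathcal G$ has density $\gamma$ on $\mathbb R$, and let $\Pi_{w,\gamma}[\,\cdot\,|\,X]$ be the posterior distribution of $\theta$ under this prior. Put $g(x)=\int\gamma(x-u)\phi(u)\,du$, $\beta=g/\phi-1$ and $L(w)=\sum_{i=1}^n\log\phi(X_i)+\sum_{i=1}^n\log(1+w\beta(X_i))$ (the log marginal likelihood), and let $\hat w$ be the (almost surely unique) maximiser of $L$ over $[1/n,1]$. For $t\in(0,1)$ let $$z_i^t(X)=\inf\{z\in\mathbb R:\ \Pi_{\hat w,\gamma}[\theta_i\le z\,|\,X]\ge t\},$$ and for $t\in(0,1/2)$ let $\varphi^m$ be the multiple testing procedure that rejects $H_{0,i}:\theta_{0,i}=0$ (that is, $\varphi^m_i=1$, and $\varphi^m_i=0$ otherwise) if and only if $0\notin[z_i^t(X),z_i^{1-t}(X)]$.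 For a procedure $\varphi$ let $$\mathrm{FDR}(\theta_0,\varphi)=\mathbb E_{\theta_0}\left[\frac{\sum_{i=1}^n \mathbf 1\{\theta_{0,i}=0\}\,\varphi_i(X)}{1\vee\sum_{i=1}^n\varphi_i(X)}\right],$$ and let $\ell_0[s]$ be the set of $\theta\in\mathbb R^n$ with at most $s$ nonzero coordinates. **Theorem.** Let $\gamma$ be a positive, unimodal, symmetric probability density on $\mathbb R$ and let $\kappa\in[1,2]$ be such that, for some $\Lambda$, $|\log\gamma(x)-\log\gamma(y)|\le\Lambda|x-y|$ for all $x,y\in\mathbb R$; $\gamma(y)^{-1}\int_y^\infty\gamma(u)\,du\asymp y^{\kappa-1}$ as $y\to\infty$; and $y\mapsto y^2\gamma(y)$ is bounded. Let $\upsilon\in(0,1)$. Then there is a constant $C=C(\gamma,\upsilon)$ such that for every $t\in(0,1/2)$ there is an integer $N_0=N_0(\gamma,\upsilon,t)$ such that, for all $n\ge N_0$ and all integers $0\le s_n\le n^\upsilon$, $$\sup_{\theta_0\in\ell_0[s_n]}\mathrm{FDR}(\theta_0,\varphi^m)\ \le\ C\,\frac{\log\log n}{(\log n)^{\kappa/2}}.$$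 -/

import Mathlib

open MeasureTheory ProbabilityTheory Filter Set Asymptotics

namespace SpikeSlab

noncomputable section

/-- A function on the line is unimodal: nondecreasing up to some mode, nonincreasing after it. -/
def Unimodal (γ : ℝ → ℝ) : Prop :=
  ∃ m : ℝ, MonotoneOn γ (Iic m) ∧ AntitoneOn γ (Ici m)

/-- The assumptions on the slab density `γ`, with tail index `κ`. -/
structure SlabAssumptions (γ : ℝ → ℝ) (κ : ℝ) : Prop where
  pos : ∀ x, 0 < γ x
  integrable : Integrable γ
  integral_eq_one : ∫ x, γ x = 1
  symmetric : ∀ x, γ (-x) = γ x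
  unimodal : Unimodal γ
  log_lipschitz : ∃ Λ : ℝ, ∀ x y, |Real.log (γ x) - Real.log (γ y)| ≤ Λ * |x - y|
  kappa_mem : κ ∈ Icc (1 : ℝ) 2
  tail : (fun y : ℝ => (γ y)⁻¹ * ∫ u in Ioi y, γ u) =Θ[atTop] (fun y : ℝ => y ^ (κ - 1))
  sq_mul_bounded : ∃ B : ℝ, ∀ y, y ^ 2 * γ y ≤ B

/-- The standard normal density. -/
def phi (x : ℝ) : ℝ := gaussianPDFReal 0 1 x

/-- The convolution of the slab density with the standard normal density. -/
def slabConv (γ : ℝ → ℝ) (x : ℝ) : ℝ := ∫ u, γ (x - u) * phi u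

/-- The function `β = g / φ - 1`. -/
def beta (γ : ℝ → ℝ) (x : ℝ) : ℝ := slabConv γ x / phi x - 1

/-- The log marginal likelihood of the weight `w` at the observation `x`. -/
def logMarginal (γ : ℝ → ℝ) {n : ℕ} (x : Fin n → ℝ) (w : ℝ) : ℝ :=
  ∑ i, Real.log (phi (x i)) + ∑ i, Real.log (1 + w * beta γ (x i))

/-- `w` is a marginal maximum likelihood weight at `x`: it maximises the log marginal likelihood
over `[1/n, 1]`. -/
def IsMMLE (γ : ℝ → ℝ) {n : ℕ} (x : Fin n → ℝ) (w : ℝ) : Prop :=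
  w ∈ Icc (1 / (n : ℝ)) 1 ∧ IsMaxOn (logMarginal γ x) (Icc (1 / (n : ℝ)) 1) w

/-- The one-dimensional spike and slab distribution `(1 - w) δ₀ + w γ(u) du`. -/
def coordPrior (γ : ℝ → ℝ) (w : ℝ) : Measure ℝ :=
  ENNReal.ofReal (1 - w) • Measure.dirac 0 +
    ENNReal.ofReal w • (volume : Measure ℝ).withDensity (fun u => ENNReal.ofReal (γ u))

/-- The spike and slab prior on `ℝⁿ`. -/
def prior (γ : ℝ → ℝ) (w : ℝ) (n : ℕ) : Measure (Fin n → ℝ) :=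
  Measure.pi (fun _ => coordPrior γ w)

/-- The density at `x` of `n` independent observations `X i ∼ N(θ i, 1)`. -/
def likelihood {n : ℕ} (x θ : Fin n → ℝ) : ENNReal :=
  ∏ i, gaussianPDF (θ i) 1 (x i)

/-- The posterior distribution of `θ` given `X = x`, by Bayes' formula. -/
def posterior (γ : ℝ → ℝ) (w : ℝ) {n : ℕ} (x : Fin n → ℝ) : Measure (Fin n → ℝ) :=
  (∫⁻ θ, likelihood x θ ∂(prior γ w n))⁻¹ • (prior γ w n).withDensity (likelihood x)

/-- The marginal posterior distribution of the `i`-th coordinate. -/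
def coordPosterior (γ : ℝ → ℝ) (w : ℝ) {n : ℕ} (x : Fin n → ℝ) (i : Fin n) : Measure ℝ :=
  (posterior γ w x).map (fun θ => θ i)

/-- The quantile at level `t` of a distribution on the line. -/
def quantile (μ : Measure ℝ) (t : ℝ) : ℝ := sInf {z : ℝ | t ≤ μ.real (Iic z)}

/-- The MCI procedure at level `t` with estimated weight `what`: it rejects (value `1`) the `i`-th
null when `0` is outside the interval between the quantiles at levels `t` and `1 - t` of the
marginal empirical Bayes posterior. -/
def mci (γ : ℝ → ℝ) (t : ℝ) {n : ℕ} (what : (Fin n → ℝ) → ℝ) (x : Fin n → ℝ) (i : Fin n) : ℝ :=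
  if (0 : ℝ) ∉ Icc (quantile (coordPosterior γ (what x) x i) t)
      (quantile (coordPosterior γ (what x) x i) (1 - t)) then 1 else 0

/-- The law of the observation in the Gaussian sequence model with mean `θ`. -/
def dataLaw {n : ℕ} (θ : Fin n → ℝ) : Measure (Fin n → ℝ) :=
  Measure.pi (fun i => gaussianReal (θ i) 1)

/-- The false discovery proportion of the decisions `d`, with value `1` for a rejection, when the
true mean is `θ`. -/
def fdp {n : ℕ} (θ d : Fin n → ℝ) : ℝ :=
  (∑ i, if θ i = 0 then d i else 0) / max 1 (∑ i, d i)

/-- The false discovery rate at `θ` of the multiple testing procedure `ψ`. -/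
def fdr {n : ℕ} (θ : Fin n → ℝ) (ψ : (Fin n → ℝ) → Fin n → ℝ) : ℝ :=
  ∫ x, fdp θ (ψ x) ∂(dataLaw θ)

/-- The vectors with at most `s` nonzero coordinates. -/
def sparseVectors (n s : ℕ) : Set (Fin n → ℝ) := {θ | {i | θ i ≠ 0}.ncard ≤ s}

end

end SpikeSlab

namespace SpikeSlab

/-! ### The standard normal density and its tails -/

/-! The proof compares false and true rejections at the random weight through the score of the
marginal likelihood. The log marginal likelihood is concave in the weight, so if the maximiser lies
to the right of a weight `w ≥ 1/n`, the total score at `w` is nonnegative (`sum_score_nonneg`).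
Under the null the rescaled score `wβ/(1+wβ)` has mean `-q(w)`, where `q` is `nullScore`, and its
second moment is at most `2 q(w)`. Hence the null coordinates contribute about `-n q(w)`, and a
nonnegative total forces the signals to compensate.

Two estimates turn this into a ratio. Under the null, the probability of a likelihood ratio large
enough for rejection is at most a constant times `t (log(1/w))^(-κ/2) q(w)`
(`exists_null_rejection_le`): at the threshold `r` the normal tail is about `φ(r)/r`, with `φ(r)`
proportional to `t w g(r)`, while `q(w)` is at least of order `w ∫_r^∞ g`, hence of order `w r^(κ-1)
g(r)`. Under an alternative, the mean of `min(1, w g/φ)`, which dominates the score, is at most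
`C/t` times the probability that `w g/φ ≥ 2/t`, up to a remainder of order `w^(1-η)`
(`exists_cappedLR_le`). Likelihood ratios that large are always rejected. As `q(w)` is at least of
order `w^(1+η)` (`exists_nullScore_ge`), the remainder, summed over at most `n^υ` signals, is
negligible against `n q(w)`. So a nonnegative score yields, with high probability, at least a
multiple of `t n q(w)` true rejections (`few_signals_concentration`). The factors `t` cancel in the
ratio of false to true rejections, which is why the final constant does not depend on `t`.

Since the weight is random, it is located on a dyadic grid `w₀/2^k` with `w₀` a small negative power
of `n` (`fdp_le_grid`, `fdr_le_of_dyadic`). In each cell the upper endpoint controls the nulls and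
the lower endpoint the signals; `q` changes by a factor between 2 and 8 from one endpoint to the
other. The grid stops once `n q` is of order `log log n / t`; below that point the expected number
of false rejections is already small enough. Fluctuations of the null counts are summed over cells:
about `4 log log n` cells pay the ratio `(log n)^(-κ/2)` each, the others form a geometric series.
This produces the factor `log log n`.

The estimated weight is an arbitrary almost-everywhere maximiser, so its measurability has to be
derived. Strict concavity identifies its superlevel sets, up to null sets, with explicit score
events (`aemeasurable_mmle`). -/

lemma phi_eq (x : ℝ) : phi x = (√(2 * Real.pi))⁻¹ * Real.exp (-(x ^ 2) / 2) := by
  simp [phi, gaussianPDFReal]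

lemma phi_pos (x : ℝ) : 0 < phi x := gaussianPDFReal_pos _ _ _ one_ne_zero

lemma continuous_phi : Continuous phi := by
  have : phi = fun x => (√(2 * Real.pi))⁻¹ * Real.exp (-(x ^ 2) / 2) := funext phi_eq
  rw [this]; fun_prop

lemma integrable_phi : Integrable phi := integrable_gaussianPDFReal 0 1

lemma integral_phi : ∫ x, phi x = 1 := integral_gaussianPDFReal_eq_one 0 one_ne_zero

lemma phi_add (x d : ℝ) : phi (x + d) = phi x * Real.exp (-(d * x) - d ^ 2 / 2) := by
  rw [phi_eq, phi_eq, mul_assoc, ← Real.exp_add]; ring_nf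

lemma phi_le_phi_zero (x : ℝ) : phi x ≤ phi 0 := by
  rw [phi_eq, phi_eq]
  have := sq_nonneg x
  apply mul_le_mul_of_nonneg_left _ (by positivity)
  apply Real.exp_le_exp.2
  nlinarith

lemma phi_zero_le_one : phi 0 ≤ 1 := by
  rw [phi_eq]
  have : 1 ≤ √(2 * Real.pi) := by
    rw [Real.one_le_sqrt]; nlinarith [Real.pi_gt_three]
  simpa using inv_le_one_of_one_le₀ this

lemma phi_le_exp (x : ℝ) : phi x ≤ Real.exp (-(x ^ 2) / 2) := by
  have h := phi_zero_le_one
  rw [phi_eq] at h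
  rw [phi_eq]
  simp only [ne_eq, OfNat.ofNat_ne_zero, not_false_eq_true, zero_pow, neg_zero, zero_div,
    Real.exp_zero, mul_one] at h
  exact mul_le_of_le_one_left (Real.exp_pos _).le h

lemma phi_le_phi_of_abs_le {x y : ℝ} (h : |x| ≤ |y|) : phi y ≤ phi x := by
  rw [phi_eq, phi_eq]
  have := sq_le_sq.2 h
  gcongr

/-- The upper tail of the standard normal distribution. -/
noncomputable def upperTail (x : ℝ) : ℝ := ∫ u in Ioi x, phi u

lemma upperTail_add (x d : ℝ) : upperTail (x + d) = ∫ u in Ioi x, phi (u + d) := by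
  unfold upperTail
  rw [← (measurePreserving_add_right volume d).setIntegral_preimage_emb
    (measurableEmbedding_addRight d)]
  congr 2
  ext u; simp

lemma integrable_phi_add (d : ℝ) : Integrable (fun u => phi (u + d)) :=
  integrable_phi.comp_add_right d

lemma upperTail_antitone : Antitone upperTail := fun _ _ h =>
  setIntegral_mono_set integrable_phi.integrableOn (ae_of_all _ fun u => (phi_pos u).le)
    (Ioi_subset_Ioi h).eventuallyLE

lemma upperTail_le_one (x : ℝ) : upperTail x ≤ 1 := by
  rw [← integral_phi]
  exact setIntegral_le_integral integrable_phi (ae_of_all _ fun u => (phi_pos u).le)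

lemma upperTail_nonneg (x : ℝ) : 0 ≤ upperTail x :=
  integral_nonneg fun u => (phi_pos u).le

lemma upperTail_le_exp {x : ℝ} (hx : 0 ≤ x) : upperTail x ≤ Real.exp (-(x ^ 2) / 2) := by
  have h0 : upperTail x = ∫ u in Ioi 0, phi (u + x) := by rw [← upperTail_add, zero_add]
  rw [h0]
  calc ∫ u in Ioi 0, phi (u + x) ≤ ∫ u in Ioi 0, Real.exp (-(x ^ 2) / 2) * phi u := by
        refine setIntegral_mono_on (integrable_phi_add x).integrableOn
          (integrable_phi.const_mul _).integrableOn measurableSet_Ioi fun u hu => ?_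
        rw [phi_add, mul_comm]
        have hu' : 0 < u := hu
        have := phi_pos u
        gcongr
        nlinarith
    _ = Real.exp (-(x ^ 2) / 2) * upperTail 0 := by rw [integral_const_mul]; rfl
    _ ≤ _ := mul_le_of_le_one_right (Real.exp_pos _).le (upperTail_le_one 0)

lemma upperTail_le_div {x : ℝ} (hx : 0 < x) : upperTail x ≤ phi x / x := by
  have h0 : upperTail x = ∫ u in Ioi 0, phi (u + x) := by rw [← upperTail_add, zero_add]
  rw [h0]
  have hi : IntegrableOn (fun u : ℝ => phi x * Real.exp (-x * u)) (Ioi 0) :=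
    (exp_neg_integrableOn_Ioi 0 hx).const_mul _
  calc ∫ u in Ioi 0, phi (u + x) ≤ ∫ u in Ioi 0, phi x * Real.exp (-x * u) := by
        refine setIntegral_mono_on (integrable_phi_add x).integrableOn hi
          measurableSet_Ioi fun u hu => ?_
        rw [add_comm u x, phi_add]
        have := phi_pos x
        gcongr
        nlinarith [sq_nonneg u]
    _ = phi x / x := by
        rw [integral_const_mul, integral_exp_mul_Ioi (by linarith)]
        simp [div_eq_mul_inv]

lemma upperTail_sub_eq {x y : ℝ} (h : x ≤ y) :
    upperTail x - upperTail y = ∫ u in Ioc x y, phi u := by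
  unfold upperTail
  rw [← Ioc_union_Ioi_eq_Ioi h, setIntegral_union (by
    rw [disjoint_left]; intro a ha hb; exact not_lt.2 ha.2 hb) measurableSet_Ioi
    integrable_phi.integrableOn integrable_phi.integrableOn]
  ring

/-- Only the window of length `1/(1+x)` to the right of `x` is kept; over it the density drops by a
factor of at most `exp(3/2)`. -/
lemma phi_div_le_upperTail {x : ℝ} (hx : 0 ≤ x) :
    Real.exp (-(3 / 2)) * (phi x / (1 + x)) ≤ upperTail x := by
  have h1 : 0 < 1 + x := by linarith
  have hd : 0 < 1 / (1 + x) := by positivity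
  have hd1 : 1 / (1 + x) ≤ 1 := by rw [div_le_one h1]; linarith
  have h2 := upperTail_sub_eq (x := x) (y := x + 1 / (1 + x)) (by linarith)
  have h3 := upperTail_nonneg (x + 1 / (1 + x))
  have h4 : ∫ u in Ioc x (x + 1 / (1 + x)), Real.exp (-(3 / 2)) * phi x ≤
      ∫ u in Ioc x (x + 1 / (1 + x)), phi u := by
    refine setIntegral_mono_on (integrableOn_const (by simp)) integrable_phi.integrableOn
      measurableSet_Ioc fun u hu => ?_
    obtain ⟨d, rfl⟩ : ∃ d, u = x + d := ⟨u - x, by ring⟩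
    have hd0 : 0 < d := by linarith [hu.1]
    have hd2 : d ≤ 1 / (1 + x) := by linarith [hu.2]
    rw [phi_add, mul_comm]
    have := phi_pos x
    gcongr
    have : d * (1 + x) ≤ 1 := by rwa [le_div_iff₀ h1] at hd2
    nlinarith
  rw [setIntegral_const] at h4
  simp only [measureReal_def, Real.volume_Ioc, add_sub_cancel_left, smul_eq_mul] at h4
  rw [ENNReal.toReal_ofReal hd.le] at h4
  have : 1 / (1 + x) * (Real.exp (-(3 / 2)) * phi x) =
    Real.exp (-(3 / 2)) * (phi x / (1 + x)) := by ring
  linarith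

lemma upperTail_add_one_le {x : ℝ} (hx : 0 ≤ x) :
    upperTail (x + 1) ≤ Real.exp (-(1 / 2)) * upperTail x := by
  rw [upperTail_add]
  unfold upperTail
  rw [← integral_const_mul]
  refine setIntegral_mono_on (integrable_phi_add 1).integrableOn
    (integrable_phi.const_mul _).integrableOn measurableSet_Ioi fun u hu => ?_
  rw [phi_add, mul_comm]
  have hu' : x < u := hu
  have := phi_pos u
  gcongr
  linarith

/-- A fixed fraction of the tail mass beyond `x` sits in `(x, max x 0 + 1]`, and on this window a
shift by `d` costs at most the displayed exponential. The lemma serves to raise a rejection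
threshold slightly in `upperTail_le_prob`. -/
lemma upperTail_add_ge (x : ℝ) {d : ℝ} (hd : 0 ≤ d) :
    (1 - Real.exp (-(1 / 2))) * Real.exp (-(d * (max x 0 + 1)) - d ^ 2 / 2) * upperTail x ≤
      upperTail (x + d) := by
  set m := max x 0 with hm
  have hxm : x ≤ m := le_max_left _ _
  have hm0 : 0 ≤ m := le_max_right _ _
  have h1 : upperTail (m + 1) ≤ Real.exp (-(1 / 2)) * upperTail x :=
    (upperTail_add_one_le hm0).trans (by gcongr; exact upperTail_antitone hxm)
  have h2 := upperTail_sub_eq (x := x) (y := m + 1) (by linarith)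
  rw [upperTail_add]
  calc (1 - Real.exp (-(1 / 2))) * Real.exp (-(d * (m + 1)) - d ^ 2 / 2) * upperTail x
      = Real.exp (-(d * (m + 1)) - d ^ 2 / 2) * ((1 - Real.exp (-(1 / 2))) * upperTail x) := by
        ring
    _ ≤ Real.exp (-(d * (m + 1)) - d ^ 2 / 2) * ∫ u in Ioc x (m + 1), phi u := by
        gcongr; linarith
    _ = ∫ u in Ioc x (m + 1), Real.exp (-(d * (m + 1)) - d ^ 2 / 2) * phi u := by
        rw [integral_const_mul]
    _ ≤ ∫ u in Ioc x (m + 1), phi (u + d) := by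
        refine setIntegral_mono_on (integrable_phi.const_mul _).integrableOn
          (integrable_phi_add d).integrableOn measurableSet_Ioc fun u hu => ?_
        rw [phi_add, mul_comm]
        have := phi_pos u
        have := hu.2
        gcongr
    _ ≤ ∫ u in Ioi x, phi (u + d) :=
        setIntegral_mono_set (integrable_phi_add d).integrableOn
          (ae_of_all _ fun u => (phi_pos _).le) (Ioc_subset_Ioi_self).eventuallyLE

/-! ### The slab density and its Gaussian convolution -/

variable {γ : ℝ → ℝ} {κ Λ : ℝ}

lemma SlabAssumptions.exists_exp_lipschitz (h : SlabAssumptions γ κ) :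
    ∃ Λ : ℝ, 1 ≤ Λ ∧ ∀ x y, γ x ≤ Real.exp (Λ * |x - y|) * γ y := by
  obtain ⟨Λ, hΛ⟩ := h.log_lipschitz
  refine ⟨max Λ 1, le_max_right _ _, fun x y => ?_⟩
  have h1 : Real.log (γ x) ≤ max Λ 1 * |x - y| + Real.log (γ y) := by
    have h2 := (abs_le.1 (hΛ x y)).2
    have h3 : Λ * |x - y| ≤ max Λ 1 * |x - y| := by gcongr; exact le_max_left _ _
    linarith
  calc γ x = Real.exp (Real.log (γ x)) := (Real.exp_log (h.pos x)).symm
    _ ≤ Real.exp (max Λ 1 * |x - y| + Real.log (γ y)) := Real.exp_le_exp.2 h1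
    _ = _ := by rw [Real.exp_add, Real.exp_log (h.pos y)]

lemma continuous_of_exp_lipschitz {f : ℝ → ℝ} (hpos : ∀ x, 0 < f x)
    (hΛ : ∀ x y, f x ≤ Real.exp (Λ * |x - y|) * f y) : Continuous f := by
  have : Continuous fun x => Real.log (f x) := by
    refine (LipschitzWith.of_le_add_mul (Real.toNNReal Λ) fun x y => ?_).continuous
    have h1 := Real.log_le_log (hpos x) (hΛ x y)
    rw [Real.log_mul (Real.exp_pos _).ne' (hpos y).ne', Real.log_exp] at h1
    have h2 : Λ * |x - y| ≤ Real.toNNReal Λ * |x - y| := by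
      gcongr; exact Real.le_coe_toNNReal Λ
    rw [Real.dist_eq]; linarith
  have h2 : f = fun x => Real.exp (Real.log (f x)) := funext fun x => (Real.exp_log (hpos x)).symm
  rw [h2]; exact Real.continuous_exp.comp this

lemma SlabAssumptions.continuous (h : SlabAssumptions γ κ) : Continuous γ := by
  obtain ⟨Λ, -, hΛ⟩ := h.exists_exp_lipschitz
  exact continuous_of_exp_lipschitz h.pos hΛ

lemma SlabAssumptions.integrable_mul_phi (h : SlabAssumptions γ κ) (x : ℝ) :
    Integrable fun u => γ (x - u) * phi u := by
  refine (h.integrable.comp_sub_left x).mul_bdd (c := 1) continuous_phi.aestronglyMeasurable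
    (ae_of_all _ fun u => ?_)
  rw [Real.norm_of_nonneg (phi_pos u).le]
  exact (phi_le_phi_zero u).trans phi_zero_le_one

lemma slabConv_eq (γ : ℝ → ℝ) (x : ℝ) :
    slabConv γ x = ∫ u, γ u * phi (x - u) := by
  unfold slabConv
  rw [← integral_sub_left_eq_self (fun u => γ u * phi (x - u)) volume x]
  simp

lemma SlabAssumptions.integrable_mul_phi' (h : SlabAssumptions γ κ) (x : ℝ) :
    Integrable fun u => γ u * phi (x - u) := by
  simpa using (h.integrable_mul_phi x).comp_sub_left x

lemma SlabAssumptions.slabConv_pos (h : SlabAssumptions γ κ) (x : ℝ) : 0 < slabConv γ x := by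
  unfold slabConv
  rw [integral_pos_iff_support_of_nonneg (fun u => (mul_pos (h.pos _) (phi_pos u)).le)
    (h.integrable_mul_phi x)]
  have : Function.support (fun u => γ (x - u) * phi u) = univ := by
    ext u; simpa using ⟨(h.pos _).ne', (phi_pos u).ne'⟩
  simp [this]

lemma SlabAssumptions.slabConv_le (h : SlabAssumptions γ κ) (x : ℝ) : slabConv γ x ≤ phi 0 := by
  rw [slabConv_eq]
  calc ∫ u, γ u * phi (x - u) ≤ ∫ u, γ u * phi 0 :=
        integral_mono (h.integrable_mul_phi' x) (h.integrable.mul_const _) fun u =>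
          mul_le_mul_of_nonneg_left (phi_le_phi_zero _) (h.pos u).le
    _ = phi 0 := by rw [integral_mul_const, h.integral_eq_one, one_mul]

lemma SlabAssumptions.slabConv_lipschitz (h : SlabAssumptions γ κ)
    (hΛ : ∀ x y, γ x ≤ Real.exp (Λ * |x - y|) * γ y) (x y : ℝ) :
    slabConv γ x ≤ Real.exp (Λ * |x - y|) * slabConv γ y := by
  unfold slabConv
  rw [← integral_const_mul]
  refine integral_mono (h.integrable_mul_phi x) ((h.integrable_mul_phi y).const_mul _) fun u => ?_
  have := hΛ (x - u) (y - u)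
  rw [sub_sub_sub_cancel_right] at this
  calc γ (x - u) * phi u ≤ (Real.exp (Λ * |x - y|) * γ (y - u)) * phi u :=
        mul_le_mul_of_nonneg_right this (phi_pos u).le
    _ = _ := by ring

lemma SlabAssumptions.continuous_slabConv (h : SlabAssumptions γ κ) :
    Continuous (slabConv γ) := by
  obtain ⟨Λ, -, hΛ⟩ := h.exists_exp_lipschitz
  exact continuous_of_exp_lipschitz h.slabConv_pos (h.slabConv_lipschitz hΛ)

lemma slabConv_eq_convolution :
    slabConv γ = convolution phi γ (ContinuousLinearMap.mul ℝ ℝ) volume := by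
  ext x
  simp only [slabConv, convolution, ContinuousLinearMap.mul_apply']
  congr 1; ext u; ring

lemma SlabAssumptions.integrable_slabConv (h : SlabAssumptions γ κ) :
    Integrable (slabConv γ) := by
  rw [slabConv_eq_convolution]
  exact integrable_phi.integrable_convolution _ h.integrable

lemma SlabAssumptions.integral_slabConv (h : SlabAssumptions γ κ) :
    ∫ x, slabConv γ x = 1 := by
  rw [slabConv_eq_convolution, integral_convolution _ integrable_phi h.integrable]
  simp [integral_phi, h.integral_eq_one]

/-- The likelihood ratio `g / φ` between the slab and the spike marginal. -/
noncomputable def lr (γ : ℝ → ℝ) (x : ℝ) : ℝ := slabConv γ x / phi x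

lemma beta_eq (γ : ℝ → ℝ) (x : ℝ) : beta γ x = lr γ x - 1 := rfl

lemma lr_mul_phi (γ : ℝ → ℝ) (x : ℝ) : lr γ x * phi x = slabConv γ x :=
  div_mul_cancel₀ _ (phi_pos x).ne'

lemma SlabAssumptions.lr_pos (h : SlabAssumptions γ κ) (x : ℝ) : 0 < lr γ x :=
  div_pos (h.slabConv_pos x) (phi_pos x)

lemma SlabAssumptions.continuous_lr (h : SlabAssumptions γ κ) : Continuous (lr γ) :=
  h.continuous_slabConv.div continuous_phi fun x => (phi_pos x).ne'

lemma SlabAssumptions.lr_zero_le (h : SlabAssumptions γ κ) : lr γ 0 ≤ 1 :=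
  div_le_one_of_le₀ (h.slabConv_le 0) (phi_pos 0).le

lemma phi_sub_div (x u : ℝ) : phi (x - u) / phi x = Real.exp (x * u - u ^ 2 / 2) := by
  rw [sub_eq_add_neg, phi_add, mul_div_cancel_left₀ _ (phi_pos x).ne']; ring_nf

lemma SlabAssumptions.integrable_mul_exp (h : SlabAssumptions γ κ) (x : ℝ) :
    Integrable fun u => γ u * Real.exp (x * u - u ^ 2 / 2) := by
  simp_rw [← phi_sub_div, ← mul_div_assoc]
  exact (h.integrable_mul_phi' x).div_const _

lemma lr_eq_integral_exp (γ : ℝ → ℝ) (x : ℝ) :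
    lr γ x = ∫ u, γ u * Real.exp (x * u - u ^ 2 / 2) := by
  rw [lr, slabConv_eq, ← integral_div]
  simp_rw [← phi_sub_div, ← mul_div_assoc]

lemma SlabAssumptions.lr_neg (h : SlabAssumptions γ κ) (x : ℝ) : lr γ (-x) = lr γ x := by
  rw [lr_eq_integral_exp, lr_eq_integral_exp,
    ← integral_neg_eq_self (fun u => γ u * Real.exp (x * u - u ^ 2 / 2))]
  congr 1; ext u; rw [h.symmetric]; ring_nf

lemma SlabAssumptions.lr_abs (h : SlabAssumptions γ κ) (x : ℝ) : lr γ |x| = lr γ x := by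
  rcases abs_choice x with h1 | h1 <;> rw [h1]
  exact h.lr_neg x

lemma cosh_mul_eq (x u : ℝ) : Real.cosh (x * u) * Real.exp (-(u ^ 2 / 2)) =
    (Real.exp (x * u - u ^ 2 / 2) + Real.exp (-x * u - u ^ 2 / 2)) / 2 := by
  rw [Real.cosh_eq, sub_eq_add_neg, Real.exp_add, sub_eq_add_neg, Real.exp_add]; ring_nf

lemma SlabAssumptions.integrable_mul_cosh (h : SlabAssumptions γ κ) (x : ℝ) :
    Integrable fun u => γ u * (Real.cosh (x * u) * Real.exp (-(u ^ 2 / 2))) := by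
  simp_rw [cosh_mul_eq, ← mul_div_assoc, mul_add]
  exact ((h.integrable_mul_exp x).add (h.integrable_mul_exp (-x))).div_const 2

lemma SlabAssumptions.lr_eq_integral_cosh (h : SlabAssumptions γ κ) (x : ℝ) :
    lr γ x = ∫ u, γ u * (Real.cosh (x * u) * Real.exp (-(u ^ 2 / 2))) := by
  simp_rw [cosh_mul_eq, ← mul_div_assoc, mul_add]
  rw [integral_div, integral_add (h.integrable_mul_exp x) (h.integrable_mul_exp (-x)),
    ← lr_eq_integral_exp, ← lr_eq_integral_exp, h.lr_neg]
  ring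

/-- Symmetry of the slab replaces the exponential by a hyperbolic cosine, which increases in `|x|`.
Likelihood ratio events thus become two-sided threshold events. -/
lemma SlabAssumptions.lr_strictMonoOn (h : SlabAssumptions γ κ) :
    StrictMonoOn (lr γ) (Ici 0) := by
  intro x hx y hy hxy
  have hx : 0 ≤ x := hx
  rw [h.lr_eq_integral_cosh, h.lr_eq_integral_cosh]
  have hlt : ∀ u : ℝ, u ≠ 0 → Real.cosh (x * u) < Real.cosh (y * u) := fun u hu => by
    rw [Real.cosh_lt_cosh, abs_mul, abs_mul, abs_of_nonneg hx, abs_of_nonneg (hx.trans hxy.le)]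
    exact mul_lt_mul_of_pos_right hxy (abs_pos.2 hu)
  have hle : ∀ u : ℝ, Real.cosh (x * u) ≤ Real.cosh (y * u) := fun u => by
    rcases eq_or_ne u 0 with rfl | hu
    · simp
    · exact (hlt u hu).le
  rw [← sub_pos, ← integral_sub (h.integrable_mul_cosh y) (h.integrable_mul_cosh x),
    integral_pos_iff_support_of_nonneg]
  · have hsup : {(0 : ℝ)}ᶜ ⊆ Function.support fun u =>
        γ u * (Real.cosh (y * u) * Real.exp (-(u ^ 2 / 2))) -
          γ u * (Real.cosh (x * u) * Real.exp (-(u ^ 2 / 2))) := by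
      intro u hu
      rw [Function.mem_support]
      have : 0 < γ u * ((Real.cosh (y * u) - Real.cosh (x * u)) * Real.exp (-(u ^ 2 / 2))) :=
        mul_pos (h.pos u) (mul_pos (sub_pos.2 (hlt u hu)) (Real.exp_pos _))
      intro h0
      apply this.ne'
      rw [← h0]; ring
    refine lt_of_lt_of_le ?_ (measure_mono hsup)
    rw [measure_compl (measurableSet_singleton 0) (by simp)]
    simp
  · intro u
    have h1 := hle u
    have h2 := h.pos u
    simp only [Pi.zero_apply, sub_nonneg]
    gcongr
  · exact (h.integrable_mul_cosh y).sub (h.integrable_mul_cosh x)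

lemma SlabAssumptions.lr_le_lr (h : SlabAssumptions γ κ) {x y : ℝ} (hxy : |x| ≤ |y|) :
    lr γ x ≤ lr γ y := by
  rw [← h.lr_abs x, ← h.lr_abs y]
  exact h.lr_strictMonoOn.monotoneOn (abs_nonneg x) (abs_nonneg y) hxy

lemma SlabAssumptions.abs_le_of_lr_le (h : SlabAssumptions γ κ) {x y : ℝ}
    (hxy : lr γ x ≤ lr γ y) : |x| ≤ |y| := by
  rw [← h.lr_abs x, ← h.lr_abs y] at hxy
  exact (h.lr_strictMonoOn.le_iff_le (abs_nonneg x) (abs_nonneg y)).1 hxy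

/-- The convolution `g` inherits the log-Lipschitz constant of the slab, so the growth of `g/φ` is
that of `1/φ` up to an exponential factor. -/
lemma SlabAssumptions.lr_growth (h : SlabAssumptions γ κ)
    (hΛ : ∀ x y, γ x ≤ Real.exp (Λ * |x - y|) * γ y) (x y : ℝ) :
    lr γ x * Real.exp ((y ^ 2 - x ^ 2) / 2 - Λ * |x - y|) ≤ lr γ y := by
  have h1 := h.slabConv_lipschitz hΛ x y
  have h2 : phi x = phi y * Real.exp ((y ^ 2 - x ^ 2) / 2) := by
    rw [phi_eq, phi_eq, mul_assoc, ← Real.exp_add]; ring_nf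
  unfold lr
  have hp := phi_pos y
  have he := Real.exp_pos ((y ^ 2 - x ^ 2) / 2)
  rw [h2, le_div_iff₀ hp, Real.exp_sub]
  calc slabConv γ x / (phi y * Real.exp ((y ^ 2 - x ^ 2) / 2)) *
        (Real.exp ((y ^ 2 - x ^ 2) / 2) / Real.exp (Λ * |x - y|)) * phi y
      = slabConv γ x / Real.exp (Λ * |x - y|) := by
        generalize Real.exp ((y ^ 2 - x ^ 2) / 2) = e at he
        field_simp
    _ ≤ slabConv γ y := by rw [div_le_iff₀' (Real.exp_pos _)]; exact h1

lemma SlabAssumptions.tendsto_lr (h : SlabAssumptions γ κ) : Tendsto (lr γ) atTop atTop := by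
  obtain ⟨Λ, hΛ1, hΛ⟩ := h.exists_exp_lipschitz
  have h1 : Tendsto (fun y : ℝ => lr γ 0 * (y * (y / 2 - Λ))) atTop atTop := by
    apply Tendsto.const_mul_atTop (h.lr_pos 0)
    refine tendsto_id.atTop_mul_atTop₀ ?_
    exact tendsto_atTop_add_const_right _ _ (tendsto_id.atTop_div_const (by norm_num))
  refine tendsto_atTop_mono' _ ?_ h1
  filter_upwards [eventually_ge_atTop 0] with y hy
  refine le_trans ?_ (h.lr_growth hΛ 0 y)
  have := h.lr_pos 0
  gcongr
  rw [zero_sub, abs_neg, abs_of_nonneg hy]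
  calc y * (y / 2 - Λ) ≤ y * (y / 2 - Λ) + 1 := by linarith
    _ ≤ Real.exp (y * (y / 2 - Λ)) := Real.add_one_le_exp _
    _ = _ := by congr 1; ring

lemma SlabAssumptions.exists_lr_eq (h : SlabAssumptions γ κ) {v : ℝ} (hv : 1 ≤ v) :
    ∃ a, 0 ≤ a ∧ lr γ a = v := by
  obtain ⟨b, hb, hb0⟩ := ((h.tendsto_lr.eventually_ge_atTop v).and (eventually_ge_atTop 0)).exists
  obtain ⟨a, ha, hav⟩ := intermediate_value_Icc hb0 h.continuous_lr.continuousOn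
    (⟨h.lr_zero_le.trans hv, hb⟩ : v ∈ Icc (lr γ 0) (lr γ b))
  exact ⟨a, ha.1, hav⟩

lemma integrable_exp_mul_abs_mul_phi (Λ : ℝ) :
    Integrable fun u => Real.exp (Λ * |u|) * phi u := by
  refine Integrable.mono' ((integrable_exp_neg_mul_sq (b := 1 / 4) (by norm_num)).const_mul
    (Real.exp (Λ ^ 2))) ?_ (ae_of_all _ fun u => ?_)
  · exact ((by fun_prop : Continuous fun u : ℝ => Real.exp (Λ * |u|)).mul
      continuous_phi).aestronglyMeasurable
  · rw [Real.norm_of_nonneg (mul_pos (Real.exp_pos _) (phi_pos u)).le]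
    calc Real.exp (Λ * |u|) * phi u ≤ Real.exp (Λ * |u|) * Real.exp (-(u ^ 2) / 2) := by
          gcongr; exact phi_le_exp u
      _ ≤ _ := by
          rw [← Real.exp_add, ← Real.exp_add]
          apply Real.exp_le_exp.2
          nlinarith [sq_nonneg (Λ - |u| / 2), sq_abs u]

/-- A shift by `u` changes the slab density by a factor of at most `exp(Λ|u|)`, and the normal law
has all exponential moments. -/
lemma SlabAssumptions.exists_slabConv_bounds (h : SlabAssumptions γ κ) :
    ∃ c C : ℝ, 0 < c ∧ 0 < C ∧ ∀ x, c * γ x ≤ slabConv γ x ∧ slabConv γ x ≤ C * γ x := by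
  obtain ⟨Λ, hΛ1, hΛ⟩ := h.exists_exp_lipschitz
  have key : ∀ s : ℝ, 0 < ∫ u, Real.exp (s * |u|) * phi u := fun s => by
    rw [integral_pos_iff_support_of_nonneg
      (fun u => (mul_pos (Real.exp_pos _) (phi_pos u)).le) (integrable_exp_mul_abs_mul_phi s)]
    have : Function.support (fun u => Real.exp (s * |u|) * phi u) = univ := by
      ext u; simpa using (phi_pos u).ne'
    simp [this]
  refine ⟨∫ u, Real.exp (-Λ * |u|) * phi u, ∫ u, Real.exp (Λ * |u|) * phi u, key _, key _,
    fun x => ⟨?_, ?_⟩⟩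
  · rw [← integral_mul_const]
    refine integral_mono ((integrable_exp_mul_abs_mul_phi _).mul_const _)
      (h.integrable_mul_phi x) fun u => ?_
    have h1 := hΛ x (x - u)
    rw [sub_sub_cancel] at h1
    calc Real.exp (-Λ * |u|) * phi u * γ x
        ≤ Real.exp (-Λ * |u|) * phi u * (Real.exp (Λ * |u|) * γ (x - u)) :=
          mul_le_mul_of_nonneg_left h1 (mul_pos (Real.exp_pos _) (phi_pos u)).le
      _ = (Real.exp (-Λ * |u|) * Real.exp (Λ * |u|)) * (γ (x - u) * phi u) := by ring
      _ = _ := by rw [← Real.exp_add]; simp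
  · rw [← integral_mul_const]
    refine integral_mono (h.integrable_mul_phi x)
      ((integrable_exp_mul_abs_mul_phi _).mul_const _) fun u => ?_
    have h1 := hΛ (x - u) x
    rw [show x - u - x = -u by ring, abs_neg] at h1
    calc γ (x - u) * phi u ≤ (Real.exp (Λ * |u|) * γ x) * phi u :=
          mul_le_mul_of_nonneg_right h1 (phi_pos u).le
      _ = _ := by ring

/-- Comparability of `g` and `γ` transfers the lower tail bound. The power `y^(κ-1)` gained here,
with the `1/y` of the normal tail, produces the rate `κ/2` in `log n`. -/
lemma SlabAssumptions.exists_tail_bound (h : SlabAssumptions γ κ) :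
    ∃ c y₀ : ℝ, 0 < c ∧ 1 ≤ y₀ ∧ ∀ y, y₀ ≤ y →
      c * (y ^ (κ - 1) * slabConv γ y) ≤ ∫ u in Ioi y, slabConv γ u := by
  obtain ⟨c₁, C₁, hc₁, hC₁, hb⟩ := h.exists_slabConv_bounds
  obtain ⟨K, hK, hKb⟩ := h.tail.2.exists_pos
  rw [IsBigOWith] at hKb
  obtain ⟨y₀, hy₀⟩ := eventually_atTop.1 hKb
  refine ⟨c₁ / (K * C₁), max y₀ 1, by positivity, le_max_right _ _, fun y hy => ?_⟩
  have hy1 : 1 ≤ y := (le_max_right _ _).trans hy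
  have h1 := hy₀ y ((le_max_left _ _).trans hy)
  have hγI : 0 ≤ ∫ u in Ioi y, γ u := integral_nonneg fun u => (h.pos u).le
  rw [Real.norm_of_nonneg (by positivity),
    Real.norm_of_nonneg (mul_nonneg (inv_nonneg.2 (h.pos y).le) hγI)] at h1
  have h2 : c₁ * ∫ u in Ioi y, γ u ≤ ∫ u in Ioi y, slabConv γ u := by
    rw [← integral_const_mul]
    exact setIntegral_mono (h.integrable.const_mul _).integrableOn
      h.integrable_slabConv.integrableOn fun u => (hb u).1
  have h3 : y ^ (κ - 1) * γ y ≤ K * ∫ u in Ioi y, γ u := by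
    have h5 := mul_le_mul_of_nonneg_right h1 (h.pos y).le
    calc _ ≤ _ := h5
      _ = K * (∫ u in Ioi y, γ u) * ((γ y)⁻¹ * γ y) := by ring
      _ = _ := by rw [inv_mul_cancel₀ (h.pos y).ne', mul_one]
  have h4 : y ^ (κ - 1) * slabConv γ y ≤ C₁ * (K * ∫ u in Ioi y, γ u) := by
    calc y ^ (κ - 1) * slabConv γ y ≤ y ^ (κ - 1) * (C₁ * γ y) := by gcongr; exact (hb y).2
      _ = C₁ * (y ^ (κ - 1) * γ y) := by ring
      _ ≤ _ := by gcongr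
  calc c₁ / (K * C₁) * (y ^ (κ - 1) * slabConv γ y)
      ≤ c₁ / (K * C₁) * (C₁ * (K * ∫ u in Ioi y, γ u)) := by gcongr
    _ = c₁ * ∫ u in Ioi y, γ u := by field_simp
    _ ≤ _ := h2

end SpikeSlab

namespace SpikeSlab

variable {γ : ℝ → ℝ} {κ Λ : ℝ}

/-! ### Gaussian measures in terms of the standard density -/

lemma gaussianPDFReal_one_eq (θ x : ℝ) : gaussianPDFReal θ 1 x = phi (x - θ) := by
  simp [phi, gaussianPDFReal]

lemma integral_gaussian (θ : ℝ) (f : ℝ → ℝ) :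
    ∫ x, f x ∂(gaussianReal θ 1) = ∫ x, f x * phi (x - θ) := by
  rw [integral_gaussianReal_eq_integral_smul one_ne_zero]
  simp_rw [gaussianPDFReal_one_eq, smul_eq_mul, mul_comm]

lemma integrable_phi_sub (d : ℝ) : Integrable (fun u => phi (u - d)) :=
  integrable_phi.comp_sub_right d

lemma gaussian_real_Ici (θ a : ℝ) : (gaussianReal θ 1).real (Ici a) = upperTail (a - θ) := by
  rw [measureReal_def, gaussianReal_apply_eq_integral θ one_ne_zero,
    ENNReal.toReal_ofReal (integral_nonneg fun u => gaussianPDFReal_nonneg _ _ _)]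
  simp_rw [gaussianPDFReal_one_eq]
  rw [integral_Ici_eq_integral_Ioi, sub_eq_add_neg a, upperTail_add]
  rfl

lemma gaussianReal_neg_apply (θ : ℝ) {s : Set ℝ} (hs : MeasurableSet s)
    (hsym : ∀ x, -x ∈ s ↔ x ∈ s) : (gaussianReal (-θ) 1).real s = (gaussianReal θ 1).real s := by
  rw [← gaussianReal_map_neg, map_measureReal_apply measurable_neg hs]
  congr 1; ext x; exact hsym x

lemma gaussianReal_neg_integral (θ : ℝ) {f : ℝ → ℝ} (hf : Continuous f)
    (hsym : ∀ x, f (-x) = f x) :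
    ∫ x, f x ∂(gaussianReal (-θ) 1) = ∫ x, f x ∂(gaussianReal θ 1) := by
  rw [← gaussianReal_map_neg, integral_map measurable_neg.aemeasurable hf.aestronglyMeasurable]
  simp_rw [hsym]

/-! ### The mean score under the null -/

/-- The score contribution `w β / (1 + w β)` of one observation. -/
noncomputable def score (γ : ℝ → ℝ) (w x : ℝ) : ℝ := w * beta γ x / (1 + w * beta γ x)

/-- Minus the mean of `score` under the null; see `integral_score`. -/
noncomputable def nullScore (γ : ℝ → ℝ) (w : ℝ) : ℝ :=
  ∫ x, (w * beta γ x) ^ 2 / (1 + w * beta γ x) * phi x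

lemma SlabAssumptions.half_le (h : SlabAssumptions γ κ) {w : ℝ} (hw : w ∈ Ioc (0 : ℝ) (1 / 2))
    (x : ℝ) : 1 / 2 ≤ 1 + w * beta γ x := by
  have := h.lr_pos x
  have := mul_pos hw.1 this
  rw [beta_eq]; nlinarith [hw.2]

lemma SlabAssumptions.nullScore_integrand_le (h : SlabAssumptions γ κ) {w : ℝ}
    (hw : w ∈ Ioc (0 : ℝ) (1 / 2)) (x : ℝ) :
    (w * beta γ x) ^ 2 / (1 + w * beta γ x) * phi x ≤ w * (slabConv γ x + phi x) := by
  have h1 := h.half_le hw x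
  have hl := h.lr_pos x
  rw [← lr_mul_phi]
  have : (w * beta γ x) ^ 2 / (1 + w * beta γ x) ≤ w * (lr γ x + 1) := by
    rw [div_le_iff₀ (by linarith), beta_eq]
    obtain ⟨hw0, hw1⟩ := hw
    have : w * (1 - 3 * lr γ x) ≤ (lr γ x + 1) * (1 - w) := by nlinarith [mul_pos hw0 hl]
    nlinarith
  calc _ ≤ w * (lr γ x + 1) * phi x := mul_le_mul_of_nonneg_right this (phi_pos x).le
    _ = _ := by ring

lemma SlabAssumptions.nullScore_integrand_nonneg (h : SlabAssumptions γ κ) {w : ℝ}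
    (hw : w ∈ Ioc (0 : ℝ) (1 / 2)) (x : ℝ) :
    0 ≤ (w * beta γ x) ^ 2 / (1 + w * beta γ x) * phi x := by
  have h1 := h.half_le hw x
  have := phi_pos x
  positivity

lemma SlabAssumptions.continuous_beta (h : SlabAssumptions γ κ) : Continuous (beta γ) :=
  h.continuous_lr.sub continuous_const

lemma SlabAssumptions.continuous_score (h : SlabAssumptions γ κ) {w : ℝ}
    (hw : w ∈ Ioc (0 : ℝ) (1 / 2)) : Continuous (score γ w) := by
  have := h.continuous_beta
  unfold score
  exact Continuous.div (by fun_prop) (by fun_prop) fun x => by linarith [h.half_le hw x]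

lemma SlabAssumptions.integrable_nullScore (h : SlabAssumptions γ κ) {w : ℝ}
    (hw : w ∈ Ioc (0 : ℝ) (1 / 2)) :
    Integrable fun x => (w * beta γ x) ^ 2 / (1 + w * beta γ x) * phi x := by
  refine Integrable.mono' ((h.integrable_slabConv.add integrable_phi).const_mul w) ?_
    (ae_of_all _ fun x => ?_)
  · have := h.continuous_beta
    have := continuous_phi
    refine (Continuous.mul (Continuous.div (by fun_prop) (by fun_prop) fun x => ?_)
      (by fun_prop)).aestronglyMeasurable
    linarith [h.half_le hw x]
  · rw [Real.norm_of_nonneg (h.nullScore_integrand_nonneg hw x)]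
    exact h.nullScore_integrand_le hw x

lemma SlabAssumptions.nullScore_le (h : SlabAssumptions γ κ) {w : ℝ}
    (hw : w ∈ Ioc (0 : ℝ) (1 / 2)) : nullScore γ w ≤ 2 * w := by
  calc nullScore γ w ≤ ∫ x, w * (slabConv γ x + phi x) :=
        integral_mono (h.integrable_nullScore hw)
          ((h.integrable_slabConv.add integrable_phi).const_mul w)
          fun x => h.nullScore_integrand_le hw x
    _ = 2 * w := by
        rw [integral_const_mul, integral_add h.integrable_slabConv integrable_phi,
          h.integral_slabConv, integral_phi]; ring

/-- With `z = wβ`, this is the pointwise inequality `4z²/(1+2z) ≥ 2z²/(1+z)`. The converse in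
`nullScore_two_mul_le` uses `1+2z ≥ 1/2`, which gives `1+z ≤ 2(1+2z)`. -/
lemma SlabAssumptions.two_mul_nullScore_le (h : SlabAssumptions γ κ) {w : ℝ}
    (hw : w ∈ Ioc (0 : ℝ) (1 / 4)) : 2 * nullScore γ w ≤ nullScore γ (2 * w) := by
  have hw1 : w ∈ Ioc (0 : ℝ) (1 / 2) := ⟨hw.1, by linarith [hw.2]⟩
  have hw2 : 2 * w ∈ Ioc (0 : ℝ) (1 / 2) := ⟨by linarith [hw.1], by linarith [hw.2]⟩
  unfold nullScore
  rw [← integral_const_mul]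
  refine integral_mono ((h.integrable_nullScore hw1).const_mul 2) (h.integrable_nullScore hw2)
    fun x => ?_
  simp only
  rw [← mul_assoc]
  refine mul_le_mul_of_nonneg_right ?_ (phi_pos x).le
  have h1 := h.half_le hw1 x
  have h2 := h.half_le hw2 x
  rw [← mul_div_assoc, div_le_div_iff₀ (by linarith) (by linarith)]
  nlinarith [sq_nonneg (w * beta γ x)]

lemma SlabAssumptions.nullScore_two_mul_le (h : SlabAssumptions γ κ) {w : ℝ}
    (hw : w ∈ Ioc (0 : ℝ) (1 / 4)) : nullScore γ (2 * w) ≤ 8 * nullScore γ w := by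
  have hw1 : w ∈ Ioc (0 : ℝ) (1 / 2) := ⟨hw.1, by linarith [hw.2]⟩
  have hw2 : 2 * w ∈ Ioc (0 : ℝ) (1 / 2) := ⟨by linarith [hw.1], by linarith [hw.2]⟩
  unfold nullScore
  rw [← integral_const_mul]
  refine integral_mono (h.integrable_nullScore hw2) ((h.integrable_nullScore hw1).const_mul 8)
    fun x => ?_
  simp only
  rw [← mul_assoc]
  refine mul_le_mul_of_nonneg_right ?_ (phi_pos x).le
  have h1 := h.half_le hw1 x
  have h2 := h.half_le hw2 x
  rw [← mul_div_assoc, div_le_div_iff₀ (by linarith) (by linarith)]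
  have h3 : 1 + w * beta γ x ≤ 2 * (1 + 2 * w * beta γ x) := by linarith
  nlinarith [mul_le_mul_of_nonneg_left h3 (sq_nonneg (w * beta γ x))]

/-- Beyond `r`, `z = wβ` is at least half of `w g/φ`, hence at least `1/4`, so `z²/(1+z) ≥ z/5`; the
two losses make the `1/10`. -/
lemma SlabAssumptions.le_nullScore (h : SlabAssumptions γ κ) {w r : ℝ}
    (hw : w ∈ Ioc (0 : ℝ) (1 / 4)) (hr : 0 ≤ r) (hwr : 1 / 2 ≤ w * lr γ r) :
    w / 10 * ∫ x in Ioi r, slabConv γ x ≤ nullScore γ w := by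
  have hw1 : w ∈ Ioc (0 : ℝ) (1 / 2) := ⟨hw.1, by linarith [hw.2]⟩
  rw [← integral_const_mul]
  refine le_trans ?_ (setIntegral_le_integral (h.integrable_nullScore hw1)
    (ae_of_all _ fun x => h.nullScore_integrand_nonneg hw1 x) (s := Ioi r))
  refine setIntegral_mono_on (h.integrable_slabConv.const_mul _).integrableOn
    (h.integrable_nullScore hw1).integrableOn measurableSet_Ioi fun x hx => ?_
  have hx' : r < x := hx
  have hlr : lr γ r ≤ lr γ x :=
    h.lr_le_lr (by rw [abs_of_nonneg hr, abs_of_nonneg (hr.trans hx'.le)]; exact hx'.le)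
  have hl : 1 / 2 ≤ w * lr γ x := hwr.trans (mul_le_mul_of_nonneg_left hlr hw.1.le)
  rw [← lr_mul_phi, ← mul_assoc]
  refine mul_le_mul_of_nonneg_right ?_ (phi_pos x).le
  have h1 := h.half_le hw1 x
  rw [le_div_iff₀ (by linarith), beta_eq]
  have hz : w * lr γ x / 2 ≤ w * (lr γ x - 1) := by nlinarith [hw.2]
  set z := w * (lr γ x - 1)
  nlinarith

lemma SlabAssumptions.exp_neg_sq_le (h : SlabAssumptions γ κ) (a : ℝ) :
    Real.exp (-(a ^ 2) / 2) * lr γ a ≤ 1 := by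
  have h1 : phi a = phi 0 * Real.exp (-(a ^ 2) / 2) := by
    rw [phi_eq, phi_eq]; simp
  have h2 := h.slabConv_le a
  rw [← lr_mul_phi, h1] at h2
  nlinarith [phi_pos 0]

lemma SlabAssumptions.two_log_lr_le (h : SlabAssumptions γ κ) (a : ℝ) :
    2 * Real.log (lr γ a) ≤ a ^ 2 := by
  have h1 := Real.log_le_log (mul_pos (Real.exp_pos _) (h.lr_pos a)) (h.exp_neg_sq_le a)
  rw [Real.log_mul (Real.exp_pos _).ne' (h.lr_pos a).ne', Real.log_exp, Real.log_one] at h1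
  linarith

/-- The coefficient 4, rather than 2, absorbs the linear term `Λa` of `lr_growth`. Together with
`two_log_lr_le` this places the point where `g/φ = 1/w` at the scale `√(log(1/w))`. -/
lemma SlabAssumptions.exists_sq_le_log (h : SlabAssumptions γ κ) :
    ∃ C : ℝ, 0 ≤ C ∧ ∀ a, 0 ≤ a → a ^ 2 ≤ 4 * Real.log (lr γ a) + C := by
  obtain ⟨Λ, hΛ1, hΛ⟩ := h.exists_exp_lipschitz
  refine ⟨4 * (Λ ^ 2 + |Real.log (lr γ 0)|), by positivity, fun a ha => ?_⟩
  have h1 := Real.log_le_log (mul_pos (h.lr_pos 0) (Real.exp_pos _)) (h.lr_growth hΛ 0 a)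
  rw [Real.log_mul (h.lr_pos 0).ne' (Real.exp_pos _).ne', Real.log_exp, zero_sub, abs_neg,
    abs_of_nonneg ha] at h1
  have := neg_abs_le (Real.log (lr γ 0))
  nlinarith [sq_nonneg (Λ - a / 2)]

/-- The mean null score decays hardly faster than linearly in the weight. -/
lemma SlabAssumptions.exists_nullScore_ge (h : SlabAssumptions γ κ) {η : ℝ} (hη : 0 < η) :
    ∃ c w₀ : ℝ, 0 < c ∧ 0 < w₀ ∧ w₀ ≤ 1 / 4 ∧ ∀ w ∈ Ioc 0 w₀,
      c * w ^ (1 + η) ≤ nullScore γ w := by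
  obtain ⟨Λ, hΛ1, hΛ⟩ := h.exists_exp_lipschitz
  obtain ⟨c, y₀, hc, hy₀, htail⟩ := h.exists_tail_bound
  obtain ⟨C, hC, hsq⟩ := h.exists_sq_le_log
  -- The constant left over from `Λa ≤ (η/4) a² + Λ²/η` and `a² ≤ 4 log(1/w) + C`; it makes
  -- `exp(-Λa)` at least `exp(-D) w^η`.
  set D := η / 4 * C + Λ ^ 2 / η with hD
  refine ⟨c / 10 * slabConv γ 0 * Real.exp (-D), min (1 / 4) (Real.exp (-(y₀ ^ 2))),
    by have := h.slabConv_pos 0; positivity, by positivity, min_le_left _ _, fun w hw => ?_⟩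
  have hw0 := hw.1
  have hw4 : w ≤ 1 / 4 := hw.2.trans (min_le_left _ _)
  have hwe : w ≤ Real.exp (-(y₀ ^ 2)) := hw.2.trans (min_le_right _ _)
  obtain ⟨a, ha, hla⟩ := h.exists_lr_eq (v := 1 / w) (by rw [le_div_iff₀ hw0]; linarith)
  have hlog : Real.log (lr γ a) = -Real.log w := by rw [hla, one_div, Real.log_inv]
  have hya : y₀ ≤ a := by
    have h1 := h.two_log_lr_le a
    have h2 : Real.log w ≤ -(y₀ ^ 2) := by
      rw [← Real.log_exp (-(y₀ ^ 2))]; exact Real.log_le_log hw0 hwe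
    rw [hlog] at h1
    refine le_of_sq_le_sq ?_ ha
    nlinarith [sq_nonneg y₀]
  have h1 := h.le_nullScore ⟨hw0, hw4⟩ ha (by rw [hla]; field_simp; norm_num)
  have h2 := htail a hya
  have h3 : 1 ≤ a ^ (κ - 1) :=
    Real.one_le_rpow (hy₀.trans hya) (by linarith [h.kappa_mem.1])
  have h4 := h.slabConv_lipschitz hΛ 0 a
  rw [zero_sub, abs_neg, abs_of_nonneg ha] at h4
  have h5 : Λ * a ≤ η * (-Real.log w) + D := by
    have h6 := hsq a ha
    rw [hlog] at h6
    have h7 : Λ * a ≤ η / 4 * a ^ 2 + Λ ^ 2 / η := by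
      have : 0 ≤ (η * a / 2 - Λ) ^ 2 / η := by positivity
      have h8 : (η * a / 2 - Λ) ^ 2 / η = η / 4 * a ^ 2 - Λ * a + Λ ^ 2 / η := by
        field_simp; ring
      linarith
    have := mul_le_mul_of_nonneg_left h6 (by positivity : 0 ≤ η / 4)
    linarith
  have h6 : Real.exp (-D) * w ^ η * slabConv γ 0 ≤ slabConv γ a := by
    have hg := h.slabConv_pos a
    calc Real.exp (-D) * w ^ η * slabConv γ 0
        = Real.exp (-(η * (-Real.log w) + D)) * slabConv γ 0 := by
          rw [Real.rpow_def_of_pos hw0, ← Real.exp_add]; ring_nf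
      _ ≤ Real.exp (-(Λ * a)) * (Real.exp (Λ * a) * slabConv γ a) := by
          have := (h.slabConv_pos 0).le
          gcongr
      _ = slabConv γ a := by rw [← mul_assoc, ← Real.exp_add]; simp
  have hga := h.slabConv_pos a
  calc c / 10 * slabConv γ 0 * Real.exp (-D) * w ^ (1 + η)
      = w / 10 * (c * (1 * (Real.exp (-D) * w ^ η * slabConv γ 0))) := by
        rw [Real.rpow_add hw0, Real.rpow_one]; ring
    _ ≤ w / 10 * (c * (a ^ (κ - 1) * slabConv γ a)) := by
        have := (h.slabConv_pos 0).le
        gcongr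
    _ ≤ w / 10 * ∫ x in Ioi a, slabConv γ x := by gcongr
    _ ≤ _ := h1

lemma SlabAssumptions.measurableSet_lr (h : SlabAssumptions γ κ) (v w : ℝ) :
    MeasurableSet {x | v ≤ w * lr γ x} :=
  measurableSet_le measurable_const (h.continuous_lr.measurable.const_mul w)

/-- Under the null, large likelihood ratios are rarer than the mean null score. -/
lemma SlabAssumptions.exists_null_rejection_le (h : SlabAssumptions γ κ) :
    ∃ C w₀ : ℝ, 0 < C ∧ 0 < w₀ ∧ w₀ ≤ 1 / 4 ∧ ∀ t ∈ Ioo (0 : ℝ) (1 / 2), ∀ w ∈ Ioc 0 w₀,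
      (gaussianReal 0 1).real {x | 1 / (4 * t) ≤ w * lr γ x} ≤
        C * t * ((-Real.log w) ^ (κ / 2))⁻¹ * nullScore γ w := by
  obtain ⟨c, y₀, hc, hy₀, htail⟩ := h.exists_tail_bound
  refine ⟨80 / c, min (1 / 4) (Real.exp (-(y₀ ^ 2))), by positivity, by positivity,
    min_le_left _ _, fun t ht w hw => ?_⟩
  have hw0 := hw.1
  have ht0 := ht.1
  have hw4 : w ≤ 1 / 4 := hw.2.trans (min_le_left _ _)
  have hwe : w ≤ Real.exp (-(y₀ ^ 2)) := hw.2.trans (min_le_right _ _)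
  have htw : 4 * t * w ≤ 2 * w := by nlinarith [ht.2]
  obtain ⟨r, hr, hlr⟩ := h.exists_lr_eq (v := 1 / (4 * t * w))
    (by rw [le_div_iff₀ (by positivity)]; linarith)
  have hwr : w * lr γ r = 1 / (4 * t) := by rw [hlr]; field_simp
  have hlogw : Real.log w ≤ -(y₀ ^ 2) := by
    rw [← Real.log_exp (-(y₀ ^ 2))]; exact Real.log_le_log hw0 hwe
  -- Here `r² ≥ 2 log(1/(4tw)) ≥ 2 log(1/w) - 2 log 2`, and `w ≤ 1/4` absorbs the constant, so the
  -- bound is uniform in `t`.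
  have hr2 : -Real.log w ≤ r ^ 2 := by
    have h1 := h.two_log_lr_le r
    rw [hlr, one_div, Real.log_inv] at h1
    have h2 : Real.log (4 * t * w) ≤ Real.log 2 + Real.log w := by
      rw [← Real.log_mul (by norm_num) hw0.ne']; exact Real.log_le_log (by positivity) htw
    have h3 : Real.log w ≤ -(2 * Real.log 2) := by
      have h4 := Real.log_le_log hw0 hw4
      have h5 : Real.log (1 / 4) = -(2 * Real.log 2) := by
        rw [one_div, Real.log_inv, show (4 : ℝ) = 2 ^ 2 by norm_num, Real.log_pow]; norm_num
      linarith
    linarith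
  have hyr : y₀ ≤ r := le_of_sq_le_sq (by linarith) hr
  have hr0 : 0 < r := by linarith
  have hset : (gaussianReal 0 1).real {x | 1 / (4 * t) ≤ w * lr γ x} ≤ 2 * upperTail r := by
    have hsub : {x | 1 / (4 * t) ≤ w * lr γ x} ⊆ Ici r ∪ (Neg.neg ⁻¹' Ici r) := by
      intro x hx
      rw [mem_ofPred_eq, ← hwr, mul_le_mul_iff_right₀ hw0] at hx
      have := h.abs_le_of_lr_le hx
      rw [abs_of_nonneg hr] at this
      rcases le_abs.1 this with h1 | h1
      · exact Or.inl h1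
      · exact Or.inr h1
    calc _ ≤ (gaussianReal 0 1).real (Ici r ∪ (Neg.neg ⁻¹' Ici r)) := measureReal_mono hsub
      _ ≤ (gaussianReal 0 1).real (Ici r) + (gaussianReal 0 1).real (Neg.neg ⁻¹' Ici r) :=
        measureReal_union_le _ _
      _ = _ := by
        rw [← map_measureReal_apply measurable_neg measurableSet_Ici]
        have := gaussianReal_map_neg (μ := 0) (v := 1)
        rw [neg_zero] at this
        change _ + ((gaussianReal 0 1).map fun x => -x).real _ = _
        rw [this, gaussian_real_Ici, sub_zero]; ring
  -- The factor `t` of the conclusion comes from this identity at the threshold.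
  have hphi : phi r = 4 * t * w * slabConv γ r := by
    rw [← lr_mul_phi, hlr]; field_simp
  have h1 := h.le_nullScore ⟨hw0, hw4⟩ hr (by
    rw [hwr, div_le_div_iff₀ (by norm_num) (by positivity)]; linarith [ht.2])
  have h2 := htail r hyr
  have hrk : 0 < r ^ (κ - 1) := Real.rpow_pos_of_pos hr0 _
  have hlog0 : 0 < -Real.log w := by nlinarith
  have h3 : (-Real.log w) ^ (κ / 2) ≤ r * r ^ (κ - 1) := by
    calc (-Real.log w) ^ (κ / 2) ≤ (r ^ 2) ^ (κ / 2) :=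
          Real.rpow_le_rpow hlog0.le hr2 (by linarith [h.kappa_mem.1])
      _ = r ^ κ := by
          rw [← Real.rpow_natCast, ← Real.rpow_mul hr]; congr 1; push_cast; ring
      _ = r * r ^ (κ - 1) := by
          nth_rewrite 2 [← Real.rpow_one r]
          rw [← Real.rpow_add hr0]; ring_nf
  have hL : 0 < (-Real.log w) ^ (κ / 2) := Real.rpow_pos_of_pos hlog0 _
  have hq : w * slabConv γ r ≤ 10 / c * nullScore γ w / r ^ (κ - 1) := by
    rw [le_div_iff₀ hrk]
    have h4 : w / 10 * (c * (r ^ (κ - 1) * slabConv γ r)) ≤ nullScore γ w :=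
      (mul_le_mul_of_nonneg_left h2 (by positivity)).trans h1
    calc w * slabConv γ r * r ^ (κ - 1)
        = 10 / c * (w / 10 * (c * (r ^ (κ - 1) * slabConv γ r))) := by field_simp
      _ ≤ _ := by gcongr
  have hq0 : 0 ≤ nullScore γ w :=
    integral_nonneg fun x => h.nullScore_integrand_nonneg ⟨hw0, by linarith⟩ x
  calc _ ≤ 2 * upperTail r := hset
    _ ≤ 2 * (phi r / r) := by gcongr; exact upperTail_le_div hr0
    _ = 8 * t * (w * slabConv γ r) / r := by rw [hphi]; ring
    _ ≤ 8 * t * (10 / c * nullScore γ w / r ^ (κ - 1)) / r := by gcongr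
    _ = 80 / c * t * (r * r ^ (κ - 1))⁻¹ * nullScore γ w := by field_simp; ring
    _ ≤ _ := by gcongr

/-! ### The mean truncated likelihood ratio under an alternative -/

/-- The likelihood ratio weighted by `w` and truncated at one. -/
noncomputable def cappedLR (γ : ℝ → ℝ) (w x : ℝ) : ℝ := min 1 (w * lr γ x)

lemma SlabAssumptions.continuous_cappedLR (h : SlabAssumptions γ κ) (w : ℝ) :
    Continuous (cappedLR γ w) :=
  continuous_const.min (continuous_const.mul h.continuous_lr)

lemma SlabAssumptions.cappedLR_nonneg (h : SlabAssumptions γ κ) {w : ℝ} (hw : 0 ≤ w) (x : ℝ) :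
    0 ≤ cappedLR γ w x := le_min zero_le_one (mul_nonneg hw (h.lr_pos x).le)

lemma cappedLR_le_one (γ : ℝ → ℝ) (w x : ℝ) : cappedLR γ w x ≤ 1 := min_le_left _ _

lemma SlabAssumptions.integrable_cappedLR_mul_phi (h : SlabAssumptions γ κ) {w : ℝ} (hw : 0 ≤ w)
    (θ : ℝ) : Integrable fun x => cappedLR γ w x * phi (x - θ) := by
  refine (integrable_phi_sub θ).bdd_mul (c := 1)
    (h.continuous_cappedLR w).aestronglyMeasurable (ae_of_all _ fun x => ?_)
  rw [Real.norm_of_nonneg (h.cappedLR_nonneg hw x)]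
  exact cappedLR_le_one _ _ _

/-- The truncation level 1 is used above `a` and the untruncated ratio below it; `f` is a dominating
function left to be chosen according to the size of `θ`. -/
lemma SlabAssumptions.integral_cappedLR_le_of_forall (h : SlabAssumptions γ κ) {w : ℝ}
    (hw : 0 ≤ w) {θ a : ℝ} {f : ℝ → ℝ} (hf : IntegrableOn f (Iic a))
    (hle : ∀ x ≤ a, w * lr γ x * phi (x - θ) ≤ f x) :
    ∫ x, cappedLR γ w x ∂(gaussianReal θ 1) ≤ upperTail (a - θ) + ∫ x in Iic a, f x := by
  have hi := h.integrable_cappedLR_mul_phi hw θ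
  rw [integral_gaussian, ← integral_add_compl measurableSet_Ioi hi (s := Ioi a), compl_Ioi,
    sub_eq_add_neg a, upperTail_add]
  refine add_le_add ?_ ?_
  · refine setIntegral_mono_on hi.integrableOn (integrable_phi_add _).integrableOn
      measurableSet_Ioi fun x _ => ?_
    rw [← sub_eq_add_neg]
    exact mul_le_of_le_one_left (phi_pos _).le (cappedLR_le_one _ _ _)
  · refine setIntegral_mono_on hi.integrableOn hf measurableSet_Iic fun x hx => ?_
    exact (mul_le_mul_of_nonneg_right (min_le_right _ _) (phi_pos _).le).trans (hle x hx)

lemma lr_mul_phi_sub (γ : ℝ → ℝ) (x θ : ℝ) :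
    lr γ x * phi (x - θ) = slabConv γ x * Real.exp (θ * x - θ ^ 2 / 2) := by
  rw [lr, div_mul_eq_mul_div, mul_div_assoc, phi_sub_div]; ring_nf

/-- By `lr_mul_phi_sub` the integrand below `a` is `g` with an exponential tilt of at most
`exp(θa)`, and `g` has total mass one. -/
lemma SlabAssumptions.integral_cappedLR_le_small (h : SlabAssumptions γ κ) {w θ a : ℝ}
    (hw : 0 ≤ w) (hθ : 0 ≤ θ) :
    ∫ x, cappedLR γ w x ∂(gaussianReal θ 1) ≤ upperTail (a - θ) + w * Real.exp (θ * a) := by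
  refine (h.integral_cappedLR_le_of_forall hw (a := a)
    (f := fun x => w * Real.exp (θ * a) * slabConv γ x)
    (h.integrable_slabConv.const_mul _).integrableOn fun x hx => ?_).trans ?_
  · rw [mul_assoc, lr_mul_phi_sub, mul_assoc, mul_comm (slabConv γ x)]
    have := (h.slabConv_pos x).le
    gcongr
    nlinarith [sq_nonneg θ]
  · rw [integral_const_mul]
    have : ∫ x in Iic a, slabConv γ x ≤ 1 := by
      rw [← h.integral_slabConv]
      exact setIntegral_le_integral h.integrable_slabConv
        (ae_of_all _ fun x => (h.slabConv_pos x).le)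
    have h2 := mul_le_of_le_one_right
      (mul_nonneg hw (Real.exp_pos (θ * a)).le) this
    linarith

/-- At `a`, where the weighted ratio is one, the integrand equals `φ(a-θ)`. To the left the tilt
decays at rate `θ` while `g` grows at rate at most `Λ`, leaving an exponential integral of rate
`θ-Λ`. -/
lemma SlabAssumptions.integral_cappedLR_le_large (h : SlabAssumptions γ κ)
    (hΛ : ∀ x y, γ x ≤ Real.exp (Λ * |x - y|) * γ y) {w θ a : ℝ}
    (hw : 0 ≤ w) (hθ : Λ < θ) (ha : w * lr γ a = 1) :
    ∫ x, cappedLR γ w x ∂(gaussianReal θ 1) ≤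
      upperTail (a - θ) + phi (a - θ) / (θ - Λ) := by
  have hθ' : 0 < θ - Λ := sub_pos.2 hθ
  have hexp : (fun x => phi (a - θ) * Real.exp (-((θ - Λ) * (a - x)))) =
      fun x => phi (a - θ) * Real.exp (-((θ - Λ) * a)) * Real.exp ((θ - Λ) * x) := by
    ext x; rw [mul_assoc, ← Real.exp_add]; ring_nf
  refine (h.integral_cappedLR_le_of_forall hw (a := a)
    (f := fun x => phi (a - θ) * Real.exp (-((θ - Λ) * (a - x)))) ?_ fun x hx => ?_).trans ?_
  · rw [hexp]
    exact (integrableOn_exp_mul_Iic hθ' a).const_mul _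
  · have h1 : phi (a - θ) = w * (slabConv γ a * Real.exp (θ * a - θ ^ 2 / 2)) := by
      rw [← lr_mul_phi_sub, ← mul_assoc, ha, one_mul]
    rw [mul_assoc, lr_mul_phi_sub, h1]
    have h2 := h.slabConv_lipschitz hΛ x a
    rw [abs_sub_comm, abs_of_nonneg (sub_nonneg.2 hx)] at h2
    calc w * (slabConv γ x * Real.exp (θ * x - θ ^ 2 / 2))
        ≤ w * ((Real.exp (Λ * (a - x)) * slabConv γ a) * Real.exp (θ * x - θ ^ 2 / 2)) := by
          gcongr
      _ = w * slabConv γ a * (Real.exp (Λ * (a - x)) * Real.exp (θ * x - θ ^ 2 / 2)) := by ring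
      _ = w * slabConv γ a *
          (Real.exp (θ * a - θ ^ 2 / 2) * Real.exp (-((θ - Λ) * (a - x)))) := by
          rw [← Real.exp_add, ← Real.exp_add]; ring_nf
      _ = _ := by ring
  · rw [hexp, integral_const_mul, integral_exp_mul_Iic hθ', mul_assoc, ← mul_div_assoc,
      ← Real.exp_add]
    simp [div_eq_mul_inv]

end SpikeSlab

/-! ### Small and large means: comparing the truncated ratio with a detection probability -/

namespace SpikeSlab

variable {γ : ℝ → ℝ} {κ Λ : ℝ}

lemma phi_le_mul_upperTail {x m : ℝ} (hm : 0 ≤ m) (hx : x ≤ m) :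
    phi x ≤ Real.exp (3 / 2) * (1 + m) * upperTail x := by
  have hE : Real.exp (3 / 2) * Real.exp (-(3 / 2)) = 1 := by rw [← Real.exp_add]; simp
  rcases le_total 0 x with h0 | h0
  · have h1 := phi_div_le_upperTail h0
    have h2 : 0 < 1 + x := by linarith
    calc phi x = (Real.exp (3 / 2) * Real.exp (-(3 / 2))) * (1 + x) * (phi x / (1 + x)) := by
          rw [hE]; field_simp
      _ = Real.exp (3 / 2) * (1 + x) * (Real.exp (-(3 / 2)) * (phi x / (1 + x))) := by ring
      _ ≤ Real.exp (3 / 2) * (1 + x) * upperTail x := by gcongr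
      _ ≤ _ := by have := upperTail_nonneg x; gcongr
  · have h1 := phi_div_le_upperTail (le_refl (0 : ℝ))
    have h2 := upperTail_antitone h0
    have h3 := phi_le_phi_zero x
    have h4 := upperTail_nonneg x
    calc phi x ≤ phi 0 := h3
      _ = Real.exp (3 / 2) * (Real.exp (-(3 / 2)) * (phi 0 / (1 + 0))) := by
          rw [← mul_assoc, hE]; simp
      _ ≤ Real.exp (3 / 2) * upperTail x := by gcongr; linarith
      _ ≤ _ := by gcongr; nlinarith [Real.exp_pos (3 / 2)]

lemma SlabAssumptions.upperTail_sub_le_prob (h : SlabAssumptions γ κ) {v w b θ : ℝ} (hw : 0 ≤ w)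
    (hb : 0 ≤ b) (hwb : w * lr γ b = v) :
    upperTail (b - θ) ≤ (gaussianReal θ 1).real {x | v ≤ w * lr γ x} := by
  rw [← gaussian_real_Ici]
  refine measureReal_mono fun x hx => ?_
  have hx : b ≤ x := hx
  rw [mem_ofPred_eq, ← hwb]
  refine mul_le_mul_of_nonneg_left (h.lr_le_lr ?_) hw
  rwa [abs_of_nonneg hb, abs_of_nonneg (hb.trans hx)]

/-- For such `θ`, `θa ≤ (η/4) a²` is at most `η log(1/w)` plus a constant, so the tilt costs only
`w^(-η)`. The normal tail beyond `a-θ` obeys the same bound because `exp(-a²/2) ≤ w`. -/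
lemma SlabAssumptions.integral_cappedLR_le_rpow (h : SlabAssumptions γ κ) {η D : ℝ}
    (hη : η ∈ Ioo (0 : ℝ) 1) (hsq : ∀ a, 0 ≤ a → a ^ 2 ≤ 4 * Real.log (lr γ a) + D) {w a θ : ℝ}
    (hw0 : 0 < w) (ha : 0 ≤ a) (hwa : w * lr γ a = 1) (hθ : 0 ≤ θ) (hsmall : θ ≤ η / 4 * a) :
    ∫ x, cappedLR γ w x ∂(gaussianReal θ 1) ≤ 2 * Real.exp (η / 4 * D) * w ^ (1 - η) := by
  obtain ⟨hη0, hη1⟩ := hη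
  have hla : lr γ a = 1 / w := by rw [eq_div_iff hw0.ne', mul_comm]; exact hwa
  have hlog : Real.log (lr γ a) = -Real.log w := by rw [hla, one_div, Real.log_inv]
  have hθa : θ ≤ a := by
    have := mul_le_of_le_one_left ha (by linarith : η / 4 ≤ 1)
    linarith
  have h1 : Real.exp (-(a ^ 2) / 2) ≤ w := by
    have := h.exp_neg_sq_le a
    rw [hla, mul_one_div, div_le_one hw0] at this
    exact this
  have h2 : Real.exp (θ * a) ≤ Real.exp (η / 4 * D) * w ^ (-η) := by
    rw [Real.rpow_def_of_pos hw0, ← Real.exp_add]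
    apply Real.exp_le_exp.2
    have h3 := hsq a ha
    rw [hlog] at h3
    have h4 := mul_le_mul_of_nonneg_right hsmall ha
    have h5 := mul_le_mul_of_nonneg_left h3 (by positivity : 0 ≤ η / 4)
    linarith
  have h3 : upperTail (a - θ) ≤ w * Real.exp (θ * a) := by
    calc upperTail (a - θ) ≤ Real.exp (-((a - θ) ^ 2) / 2) :=
          upperTail_le_exp (sub_nonneg.2 hθa)
      _ ≤ Real.exp (-(a ^ 2) / 2) * Real.exp (θ * a) := by
          rw [← Real.exp_add]; apply Real.exp_le_exp.2; linarith [sq_nonneg θ]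
      _ ≤ _ := by gcongr
  have h4 := h.integral_cappedLR_le_small (a := a) hw0.le hθ
  calc _ ≤ _ := h4
    _ ≤ 2 * (w * (Real.exp (η / 4 * D) * w ^ (-η))) := by
        have := mul_le_mul_of_nonneg_left h2 hw0.le
        linarith
    _ = 2 * Real.exp (η / 4 * D) * w ^ (1 - η) := by
        rw [sub_eq_add_neg, Real.rpow_add hw0, Real.rpow_one]; ring

/-- Here `θ-Λ` is of order at least `a`, which compensates the factor `1+a` lost when the density at
`a-θ` is bounded by the tail. -/
lemma SlabAssumptions.integral_cappedLR_le_upperTail (h : SlabAssumptions γ κ) (hΛ1 : 1 ≤ Λ)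
    (hΛ : ∀ x y, γ x ≤ Real.exp (Λ * |x - y|) * γ y) {η : ℝ} (hη : η ∈ Ioo (0 : ℝ) 1)
    {w a θ : ℝ} (hw0 : 0 ≤ w) (hwa : w * lr γ a = 1) (hΛη : 8 * Λ ≤ η * a)
    (hlarge : η / 4 * a < θ) :
    ∫ x, cappedLR γ w x ∂(gaussianReal θ 1) ≤
      (1 + 16 * Real.exp (3 / 2) / η) * upperTail (a - θ) := by
  obtain ⟨hη0, hη1⟩ := hη
  have hΛθ : Λ < θ := by linarith
  have hθΛ : η / 8 * a ≤ θ - Λ := by linarith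
  have h1 := h.integral_cappedLR_le_large hΛ hw0 hΛθ hwa
  have hut := upperTail_nonneg (a - θ)
  have ha1 : 1 ≤ a := by
    by_contra hcon
    push Not at hcon
    have := mul_lt_mul_of_pos_left hcon hη0
    linarith
  have h3 := phi_le_mul_upperTail (x := a - θ) (m := a) (by linarith) (by linarith)
  have h2 : phi (a - θ) / (θ - Λ) ≤ 16 * Real.exp (3 / 2) / η * upperTail (a - θ) := by
    rw [div_le_iff₀ (by linarith)]
    calc phi (a - θ) ≤ Real.exp (3 / 2) * (1 + a) * upperTail (a - θ) := h3
      _ ≤ Real.exp (3 / 2) * (2 * a) * upperTail (a - θ) := by gcongr; linarith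
      _ = 16 * Real.exp (3 / 2) / η * upperTail (a - θ) * (η / 8 * a) := by field_simp; ring
      _ ≤ _ := by gcongr
  linarith

lemma SlabAssumptions.upperTail_le_prob (h : SlabAssumptions γ κ) (hΛ1 : 1 ≤ Λ)
    (hΛ : ∀ x y, γ x ≤ Real.exp (Λ * |x - y|) * γ y) {t w a θ : ℝ} (ht : t ∈ Ioo (0 : ℝ) (1 / 2))
    (hw0 : 0 < w) (hw1 : w ≤ 1) (ha : 0 ≤ a) (hwa : w * lr γ a = 1) (hθ : Λ ≤ θ)
    (haℓ : 2 * Real.log (2 / t) + 2 * Λ ≤ a) :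
    (1 - Real.exp (-(1 / 2))) * (Real.exp (-1) * (t / 2)) * upperTail (a - θ) ≤
      (gaussianReal θ 1).real {x | 2 / t ≤ w * lr γ x} := by
  have ht0 := ht.1
  have h2t : 1 ≤ 2 / t := by rw [le_div_iff₀ ht0]; linarith [ht.2]
  set ℓ := Real.log (2 / t) with hℓ
  have hℓ0 : 0 ≤ ℓ := Real.log_nonneg h2t
  obtain ⟨b, hb, hlb⟩ := h.exists_lr_eq (v := 2 / t / w) (by
    rw [le_div_iff₀ hw0, one_mul]; exact hw1.trans h2t)
  have hwb : w * lr γ b = 2 / t := by rw [hlb]; field_simp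
  have hab : a ≤ b := by
    have h3 : lr γ a ≤ lr γ b := by
      rw [← mul_le_mul_iff_right₀ hw0, hwa, hwb]; exact h2t
    have := h.abs_le_of_lr_le h3
    rwa [abs_of_nonneg ha, abs_of_nonneg hb] at this
  obtain ⟨δ, hδ0, rfl⟩ : ∃ δ, 0 ≤ δ ∧ b = a + δ := ⟨b - a, by linarith, by ring⟩
  -- Raising `w g/φ` from 1 to `2/t` needs a shift of only about `ℓ/a`, by the Gaussian growth of
  -- the ratio.
  have hδ : δ * (a - Λ) ≤ ℓ := by
    have h3 := h.lr_growth hΛ a (a + δ)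
    have h4 : Real.exp (((a + δ) ^ 2 - a ^ 2) / 2 - Λ * |a - (a + δ)|) ≤ 2 / t := by
      have h5 := mul_le_mul_of_nonneg_left h3 hw0.le
      rwa [← mul_assoc, hwa, one_mul, hwb] at h5
    have h5 := Real.log_le_log (Real.exp_pos _) h4
    rw [Real.log_exp, sub_add_cancel_left, abs_neg, abs_of_nonneg hδ0] at h5
    linarith [sq_nonneg δ]
  have hδ1 : δ ≤ 1 / 2 := by
    have h6 : δ * (2 * ℓ + Λ) ≤ ℓ := (mul_le_mul_of_nonneg_left (by linarith) hδ0).trans hδ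
    by_contra hcon
    push Not at hcon
    have := mul_le_mul_of_nonneg_right hcon.le (by linarith : 0 ≤ 2 * ℓ + Λ)
    linarith
  have hmax : δ * max (a - θ) 0 ≤ ℓ := by
    have h3 : max (a - θ) 0 ≤ a - Λ := by
      apply max_le <;> linarith
    exact (mul_le_mul_of_nonneg_left h3 hδ0).trans hδ
  have h3 := upperTail_add_ge (a - θ) hδ0
  refine le_trans ?_ (h.upperTail_sub_le_prob hw0.le hb hwb)
  rw [show a + δ - θ = a - θ + δ by ring]
  refine le_trans ?_ h3
  have hc₁0 : 0 ≤ 1 - Real.exp (-(1 / 2)) :=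
    sub_nonneg.2 (by rw [Real.exp_le_one_iff]; norm_num)
  have := upperTail_nonneg (a - θ)
  gcongr
  -- The shift costs `exp(-ℓ) = t/2` through `δ max(a-θ, 0) ≤ ℓ`; the rest, `δ + δ²/2`, is at most 1
  -- and gives `exp(-1)`.
  have h5 : t / 2 = Real.exp (-ℓ) := by
    rw [Real.exp_neg, hℓ, Real.exp_log (by positivity), inv_div]
  rw [h5, ← Real.exp_add]
  apply Real.exp_le_exp.2
  have h7 := mul_le_mul_of_nonneg_left hδ1 hδ0
  linarith

/-- The mean truncated likelihood ratio of an observation is controlled by the probability of a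
large likelihood ratio, up to a term that is nearly linear in the weight. -/
lemma SlabAssumptions.exists_cappedLR_le (h : SlabAssumptions γ κ) {η : ℝ}
    (hη : η ∈ Ioo (0 : ℝ) 1) :
    ∃ C : ℝ, 0 < C ∧ ∀ t ∈ Ioo (0 : ℝ) (1 / 2), ∃ w₀ : ℝ, 0 < w₀ ∧ ∀ w ∈ Ioc 0 w₀, ∀ θ : ℝ,
      ∫ x, cappedLR γ w x ∂(gaussianReal θ 1) ≤
        C / t * (gaussianReal θ 1).real {x | 2 / t ≤ w * lr γ x} + C * w ^ (1 - η) := by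
  have hη0 := hη.1
  have hη1 := hη.2
  obtain ⟨Λ, hΛ1, hΛ⟩ := h.exists_exp_lipschitz
  obtain ⟨D, hD, hsq⟩ := h.exists_sq_le_log
  set c₁ : ℝ := 1 - Real.exp (-(1 / 2)) with hc₁
  have hc₁0 : 0 < c₁ := sub_pos.2 (by rw [Real.exp_lt_one_iff]; norm_num)
  set C₁ : ℝ := 1 + 16 * Real.exp (3 / 2) / η with hC₁
  have hC₁0 : 0 < C₁ := by positivity
  set C₂ : ℝ := C₁ * (2 * Real.exp 1 / c₁) with hC₂
  set C₃ : ℝ := 2 * Real.exp (η / 4 * D) with hC₃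
  have hC₂0 : 0 < C₂ := by positivity
  have hC₃0 : 0 < C₃ := by positivity
  refine ⟨C₂ + C₃, by positivity, fun t ht => ?_⟩
  have ht0 := ht.1
  have h2t : 1 ≤ 2 / t := by rw [le_div_iff₀ ht0]; linarith [ht.2]
  have hℓ0 : 0 ≤ Real.log (2 / t) := Real.log_nonneg h2t
  -- The first term serves the large-mean bound, the other two the threshold shift. Only `a₀`, hence
  -- the range of weights, depends on `t`; the constant `C₂ + C₃` does not.
  set a₀ := 8 * Λ / η + 2 * Λ + 2 * Real.log (2 / t) with ha₀
  have ha₀0 : 0 < a₀ := by positivity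
  refine ⟨min 1 (Real.exp (-(a₀ ^ 2) / 2)), by positivity, fun w hw => ?_⟩
  have hw0 := hw.1
  have hw1 : w ≤ 1 := hw.2.trans (min_le_left _ _)
  have hwe : w ≤ Real.exp (-(a₀ ^ 2) / 2) := hw.2.trans (min_le_right _ _)
  obtain ⟨a, ha, hla⟩ := h.exists_lr_eq (v := 1 / w) (by rw [le_div_iff₀ hw0]; linarith)
  have hwa : w * lr γ a = 1 := by rw [hla]; field_simp
  have haa₀ : a₀ ≤ a := by
    have h1 := h.two_log_lr_le a
    have h2 : Real.log w ≤ -(a₀ ^ 2) / 2 := by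
      rw [← Real.log_exp (-(a₀ ^ 2) / 2)]; exact Real.log_le_log hw0 hwe
    rw [hla, one_div, Real.log_inv] at h1
    exact le_of_sq_le_sq (by linarith) ha
  have ha1 : 8 * Λ / η ≤ a := by linarith
  have hΛη : 8 * Λ ≤ η * a := by rwa [div_le_iff₀' hη0] at ha1
  have hΛη' : 0 ≤ 8 * Λ / η := by positivity
  have key : ∀ θ : ℝ, 0 ≤ θ → ∫ x, cappedLR γ w x ∂(gaussianReal θ 1) ≤
      (C₂ + C₃) / t * (gaussianReal θ 1).real {x | 2 / t ≤ w * lr γ x} +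
        (C₂ + C₃) * w ^ (1 - η) := by
    intro θ hθ
    set P := (gaussianReal θ 1).real {x | 2 / t ≤ w * lr γ x} with hP
    have hP0 : 0 ≤ P := measureReal_nonneg
    have hwη : 0 < w ^ (1 - η) := Real.rpow_pos_of_pos hw0 _
    rcases le_or_gt θ (η / 4 * a) with hsmall | hlarge
    · calc _ ≤ _ := h.integral_cappedLR_le_rpow hη hsq hw0 ha hwa hθ hsmall
        _ ≤ (C₂ + C₃) * w ^ (1 - η) := by gcongr; linarith
        _ ≤ _ := le_add_of_nonneg_left (by positivity)
    · have h4 := h.upperTail_le_prob hΛ1 hΛ ht hw0 hw1 ha hwa (θ := θ) (by linarith)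
        (by linarith)
      have h5 : upperTail (a - θ) ≤ 2 * Real.exp 1 / c₁ / t * P := by
        have hE : Real.exp 1 * Real.exp (-1) = 1 := by rw [← Real.exp_add]; simp
        calc upperTail (a - θ) = 2 / c₁ / t * (c₁ * (t / 2)) * upperTail (a - θ) := by
              field_simp
          _ = 2 / c₁ / t * (c₁ * ((Real.exp 1 * Real.exp (-1)) * (t / 2))) *
              upperTail (a - θ) := by rw [hE, one_mul]
          _ = 2 * Real.exp 1 / c₁ / t *
              (c₁ * (Real.exp (-1) * (t / 2)) * upperTail (a - θ)) := by ring
          _ ≤ _ := by gcongr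
      calc _ ≤ _ := h.integral_cappedLR_le_upperTail hΛ1 hΛ hη hw0.le hwa hΛη hlarge
        _ ≤ C₁ * (2 * Real.exp 1 / c₁ / t * P) := by gcongr
        _ = C₂ / t * P := by rw [hC₂]; ring
        _ ≤ (C₂ + C₃) / t * P := by gcongr; linarith
        _ ≤ _ := le_add_of_nonneg_right (by positivity)
  intro θ
  rcases le_total 0 θ with hθ | hθ
  · exact key θ hθ
  · have h1 := key (-θ) (by linarith)
    rwa [gaussianReal_neg_integral θ (h.continuous_cappedLR w) (fun x => by
      simp only [cappedLR, h.lr_neg]), gaussianReal_neg_apply θ (h.measurableSet_lr _ _)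
      (fun x => by simp only [mem_ofPred_eq, h.lr_neg])] at h1

end SpikeSlab

namespace SpikeSlab

variable {γ : ℝ → ℝ} {κ : ℝ} {n : ℕ}

/-! ### Exponential inequalities under the law of the data -/

instance (θ : Fin n → ℝ) : IsProbabilityMeasure (dataLaw θ) := by
  unfold dataLaw; infer_instance

lemma integral_prod_dataLaw (θ : Fin n → ℝ) (f : Fin n → ℝ → ℝ) :
    ∫ x, ∏ i, f i (x i) ∂(dataLaw θ) = ∏ i, ∫ x, f i x ∂(gaussianReal (θ i) 1) :=
  integral_fintype_prod_eq_prod f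

lemma integrable_eval_dataLaw (θ : Fin n → ℝ) (i : Fin n) {f : ℝ → ℝ}
    (hf : Integrable f (gaussianReal (θ i) 1)) :
    Integrable (fun x : Fin n → ℝ => f (x i)) (dataLaw θ) :=
  integrable_comp_eval (μ := fun i => gaussianReal (θ i) 1) hf

lemma integral_eval_dataLaw (θ : Fin n → ℝ) (i : Fin n) {f : ℝ → ℝ} (hf : Measurable f) :
    ∫ x, f (x i) ∂(dataLaw θ) = ∫ x, f x ∂(gaussianReal (θ i) 1) :=
  integral_comp_eval (μ := fun i => gaussianReal (θ i) 1) hf.aestronglyMeasurable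

lemma integral_exp_sum_le (θ : Fin n → ℝ) {f : Fin n → ℝ → ℝ} {b : Fin n → ℝ}
    (hb : ∀ i, ∫ x, Real.exp (f i x) ∂(gaussianReal (θ i) 1) ≤ Real.exp (b i)) :
    ∫ x, Real.exp (∑ i, f i (x i)) ∂(dataLaw θ) ≤ Real.exp (∑ i, b i) := by
  simp_rw [Real.exp_sum]
  rw [integral_prod_dataLaw θ fun i x => Real.exp (f i x)]
  exact Finset.prod_le_prod (fun i _ => integral_nonneg fun x => (Real.exp_pos _).le)
    fun i _ => hb i

lemma integrable_exp_sum (θ : Fin n → ℝ) {f : Fin n → ℝ → ℝ} (hf : ∀ i, Measurable (f i))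
    {B : ℝ} (hB : ∀ i x, f i x ≤ B) :
    Integrable (fun x => Real.exp (∑ i, f i (x i))) (dataLaw θ) := by
  refine Integrable.of_bound (C := Real.exp (∑ _i : Fin n, B)) ?_ (ae_of_all _ fun x => ?_)
  · exact (Real.measurable_exp.comp (Finset.measurable_sum _ fun i _ =>
      (hf i).comp (measurable_pi_apply i))).aestronglyMeasurable
  · rw [Real.norm_of_nonneg (Real.exp_pos _).le]
    exact Real.exp_le_exp.2 (Finset.sum_le_sum fun i _ => hB i _)

lemma chernoff (θ : Fin n → ℝ) {f : Fin n → ℝ → ℝ} (hf : ∀ i, Measurable (f i))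
    {B : ℝ} (hB : ∀ i x, f i x ≤ B) {b : Fin n → ℝ}
    (hb : ∀ i, ∫ x, Real.exp (f i x) ∂(gaussianReal (θ i) 1) ≤ Real.exp (b i)) (c : ℝ) :
    (dataLaw θ).real {x | c ≤ ∑ i, f i (x i)} ≤ Real.exp (∑ i, b i - c) := by
  have h1 := mul_meas_ge_le_integral_of_nonneg (μ := dataLaw θ)
    (ae_of_all _ fun x => (Real.exp_pos (∑ i, f i (x i))).le) (integrable_exp_sum θ hf hB)
    (Real.exp c)
  simp_rw [Real.exp_le_exp] at h1
  rw [Real.exp_sub, le_div_iff₀' (Real.exp_pos c)]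
  exact h1.trans (integral_exp_sum_le θ hb)

lemma integral_exp_mul_indicator_le (ν : Measure ℝ) [IsProbabilityMeasure ν] {A : Set ℝ}
    (hA : MeasurableSet A) (l : ℝ) :
    ∫ x, Real.exp (l * A.indicator 1 x) ∂ν ≤ Real.exp ((Real.exp l - 1) * ν.real A) := by
  have h1 : ∀ x, Real.exp (l * A.indicator (1 : ℝ → ℝ) x) =
      1 + (Real.exp l - 1) * A.indicator (1 : ℝ → ℝ) x := fun x => by
    by_cases hx : x ∈ A <;> simp [hx]
  simp_rw [h1]
  have hi : Integrable (A.indicator (1 : ℝ → ℝ)) ν := (integrable_const 1).indicator hA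
  rw [integral_add (integrable_const _) (hi.const_mul _), integral_const_mul,
    integral_indicator_one hA]
  simp only [integral_const, probReal_univ, smul_eq_mul, mul_one]
  linarith [Real.add_one_le_exp ((Real.exp l - 1) * ν.real A)]

/-- The number of coordinates in `S` whose observation lies in `A`. -/
noncomputable def countIn (S : Finset (Fin n)) (A : Set ℝ) (x : Fin n → ℝ) : ℝ :=
  ∑ i ∈ S, A.indicator 1 (x i)

lemma countIn_nonneg (S : Finset (Fin n)) (A : Set ℝ) (x : Fin n → ℝ) : 0 ≤ countIn S A x :=
  Finset.sum_nonneg fun _ _ => indicator_nonneg (fun _ _ => zero_le_one) _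

lemma measurable_countIn (S : Finset (Fin n)) {A : Set ℝ} (hA : MeasurableSet A) :
    Measurable (countIn S A) :=
  Finset.measurable_sum _ fun i _ => (measurable_one.indicator hA).comp (measurable_pi_apply i)

lemma mul_countIn_eq (S : Finset (Fin n)) (A : Set ℝ) (l : ℝ) (x : Fin n → ℝ) :
    l * countIn S A x = ∑ i, (if i ∈ S then fun y => l * A.indicator 1 y else 0 : ℝ → ℝ) (x i) := by
  have h1 : ∀ i, (if i ∈ S then fun y => l * A.indicator 1 y else 0 : ℝ → ℝ) (x i) =
      if i ∈ S then l * A.indicator 1 (x i) else 0 := fun i => by split_ifs <;> rfl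
  simp_rw [h1]
  rw [Finset.sum_ite_mem, Finset.univ_inter, countIn, Finset.mul_sum]

lemma exp_ite_bound (θ : Fin n → ℝ) (S : Finset (Fin n)) {A : Set ℝ} (hA : MeasurableSet A)
    (l : ℝ) (i : Fin n) :
    ∫ x, Real.exp ((if i ∈ S then fun y => l * A.indicator 1 y else 0 : ℝ → ℝ) x)
      ∂(gaussianReal (θ i) 1) ≤
    Real.exp (if i ∈ S then (Real.exp l - 1) * (gaussianReal (θ i) 1).real A else 0) := by
  by_cases hi : i ∈ S
  · simpa [hi] using integral_exp_mul_indicator_le (gaussianReal (θ i) 1) hA l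
  · simp [hi]

lemma measurable_ite_indicator (S : Finset (Fin n)) {A : Set ℝ} (hA : MeasurableSet A)
    (l : ℝ) (i : Fin n) :
    Measurable (if i ∈ S then fun y => l * A.indicator 1 y else 0 : ℝ → ℝ) := by
  split_ifs
  · exact (measurable_one.indicator hA).const_mul l
  · exact measurable_zero

lemma ite_indicator_le (S : Finset (Fin n)) (A : Set ℝ) (l : ℝ) (i : Fin n) (x : ℝ) :
    (if i ∈ S then fun y => l * A.indicator 1 y else 0 : ℝ → ℝ) x ≤ |l| := by
  split_ifs
  · by_cases hx : x ∈ A <;> simp [hx, le_abs_self]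
  · simp

lemma sum_ite_mul (θ : Fin n → ℝ) (S : Finset (Fin n)) (A : Set ℝ) (l : ℝ) :
    ∑ i, (if i ∈ S then l * (gaussianReal (θ i) 1).real A else 0) =
      l * ∑ i ∈ S, (gaussianReal (θ i) 1).real A := by
  rw [Finset.mul_sum, Finset.sum_ite_mem, Finset.univ_inter]

/-- Exponential tilt at `-1`: since `exp(-1) ≤ 1/2`, the exponent is at most `-m/2 + m/4`, with `m`
the mean of the count. -/
lemma countIn_lower_tail (θ : Fin n → ℝ) (S : Finset (Fin n)) {A : Set ℝ}
    (hA : MeasurableSet A) :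
    (dataLaw θ).real {x | countIn S A x ≤ (∑ i ∈ S, (gaussianReal (θ i) 1).real A) / 4} ≤
      Real.exp (-((∑ i ∈ S, (gaussianReal (θ i) 1).real A) / 4)) := by
  set m := ∑ i ∈ S, (gaussianReal (θ i) 1).real A with hm
  have hm0 : 0 ≤ m := Finset.sum_nonneg fun i _ => measureReal_nonneg
  have h1 := chernoff θ (measurable_ite_indicator S hA (-1)) (ite_indicator_le S A (-1))
    (exp_ite_bound θ S hA (-1)) (-(m / 4))
  simp_rw [← mul_countIn_eq] at h1
  rw [sum_ite_mul, ← hm] at h1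
  have hset : {x | countIn S A x ≤ m / 4} = {x | -(m / 4) ≤ -1 * countIn S A x} := by
    ext x; simp
  rw [hset]
  refine h1.trans (Real.exp_le_exp.2 ?_)
  have h2 : Real.exp (-1) ≤ 1 / 2 := by
    rw [Real.exp_neg, inv_le_comm₀ (Real.exp_pos _) (by norm_num)]
    linarith [Real.add_one_le_exp 1]
  nlinarith

lemma integrable_countIn (θ : Fin n → ℝ) (S : Finset (Fin n)) {A : Set ℝ}
    (hA : MeasurableSet A) : Integrable (countIn S A) (dataLaw θ) :=
  integrable_finsetSum _ fun i _ =>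
    integrable_eval_dataLaw θ i ((integrable_const 1).indicator hA)

lemma integral_countIn (θ : Fin n → ℝ) (S : Finset (Fin n)) {A : Set ℝ}
    (hA : MeasurableSet A) :
    ∫ x, countIn S A x ∂(dataLaw θ) = ∑ i ∈ S, (gaussianReal (θ i) 1).real A := by
  unfold countIn
  have hi : ∀ i ∈ S, Integrable (fun x : Fin n → ℝ => A.indicator (1 : ℝ → ℝ) (x i))
      (dataLaw θ) := fun i _ =>
    integrable_eval_dataLaw θ i ((integrable_const 1).indicator hA)
  rw [integral_finsetSum _ hi]
  refine Finset.sum_congr rfl fun i _ => ?_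
  rw [integral_eval_dataLaw θ i (measurable_one.indicator hA), integral_indicator_one hA]

lemma integrable_countIn_excess (θ : Fin n → ℝ) (S : Finset (Fin n)) {A : Set ℝ}
    (hA : MeasurableSet A) (v : ℝ) :
    Integrable (fun x => max (countIn S A x - v) 0) (dataLaw θ) :=
  ((integrable_countIn θ S hA).sub (integrable_const v)).pos_part

/-- The bound by `v` is the mean of the count. The bound by 1 uses `max(y,0) ≤ exp y` at `y = V -
2v`, with `V` the count, together with `e - 1 ≤ 2`. -/
lemma integral_countIn_excess_le (θ : Fin n → ℝ) (S : Finset (Fin n)) {A : Set ℝ}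
    (hA : MeasurableSet A) {v : ℝ} (hv : ∑ i ∈ S, (gaussianReal (θ i) 1).real A ≤ v) :
    ∫ x, max (countIn S A x - 2 * v) 0 ∂(dataLaw θ) ≤ min v 1 := by
  set m := ∑ i ∈ S, (gaussianReal (θ i) 1).real A with hm
  have hm0 : 0 ≤ m := Finset.sum_nonneg fun i _ => measureReal_nonneg
  refine le_min ?_ ?_
  · calc ∫ x, max (countIn S A x - 2 * v) 0 ∂(dataLaw θ) ≤ ∫ x, countIn S A x ∂(dataLaw θ) := by
          refine integral_mono (integrable_countIn_excess θ S hA _) (integrable_countIn θ S hA)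
            fun x => max_le ?_ (countIn_nonneg S A x)
          linarith
      _ ≤ v := by rw [integral_countIn θ S hA]; exact hv
  · have h1 := integral_exp_sum_le θ (exp_ite_bound θ S hA 1)
    have h2 := integrable_exp_sum θ (measurable_ite_indicator S hA 1) (ite_indicator_le S A 1)
    simp_rw [← mul_countIn_eq, one_mul] at h1 h2
    rw [sum_ite_mul, ← hm] at h1
    calc ∫ x, max (countIn S A x - 2 * v) 0 ∂(dataLaw θ)
        ≤ ∫ x, Real.exp (-(2 * v)) * Real.exp (countIn S A x) ∂(dataLaw θ) := by
          refine integral_mono (integrable_countIn_excess θ S hA _) (h2.const_mul _)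
            fun x => ?_
          simp only
          rw [← Real.exp_add]
          refine max_le ?_ (Real.exp_pos _).le
          linarith [Real.add_one_le_exp (-(2 * v) + countIn S A x)]
      _ ≤ Real.exp (-(2 * v)) * Real.exp ((Real.exp 1 - 1) * m) := by
          rw [integral_const_mul]; gcongr
      _ ≤ 1 := by
          rw [← Real.exp_add, Real.exp_le_one_iff]
          nlinarith [Real.exp_one_lt_three]

/-! ### Concentration of the score -/

lemma SlabAssumptions.score_le_cappedLR (h : SlabAssumptions γ κ) {w : ℝ}
    (hw : w ∈ Ioc (0 : ℝ) (1 / 2)) (x : ℝ) : score γ w x ≤ cappedLR γ w x := by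
  have h1 := h.half_le hw x
  have hl := h.lr_pos x
  have hwl := mul_pos hw.1 hl
  unfold score cappedLR
  refine le_min ?_ ?_
  · rw [div_le_one (by linarith)]; linarith
  · rw [div_le_iff₀ (by linarith)]
    rw [beta_eq] at *
    have hw1 := hw.1
    have hw2 := hw.2
    have : 0 ≤ w * lr γ x * (w * lr γ x) := by positivity
    nlinarith

lemma SlabAssumptions.abs_score_le (h : SlabAssumptions γ κ) {w : ℝ}
    (hw : w ∈ Ioc (0 : ℝ) (1 / 2)) (x : ℝ) : |score γ w x| ≤ 1 := by
  have h1 := h.half_le hw x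
  unfold score
  rw [abs_le]
  constructor
  · rw [le_div_iff₀ (by linarith)]; linarith
  · rw [div_le_one (by linarith)]; linarith

lemma SlabAssumptions.integrable_score (h : SlabAssumptions γ κ) {w : ℝ}
    (hw : w ∈ Ioc (0 : ℝ) (1 / 2)) (ν : Measure ℝ) [IsFiniteMeasure ν] :
    Integrable (score γ w) ν :=
  Integrable.of_bound (C := 1) (h.continuous_score hw).aestronglyMeasurable
    (ae_of_all _ fun x => h.abs_score_le hw x)

lemma SlabAssumptions.integrable_score_sq (h : SlabAssumptions γ κ) {w : ℝ}
    (hw : w ∈ Ioc (0 : ℝ) (1 / 2)) (ν : Measure ℝ) [IsFiniteMeasure ν] :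
    Integrable (fun x => score γ w x ^ 2) ν := by
  refine Integrable.of_bound (C := 1) ((h.continuous_score hw).pow 2).aestronglyMeasurable
    (ae_of_all _ fun x => ?_)
  rw [norm_pow, Real.norm_eq_abs]
  exact pow_le_one₀ (abs_nonneg _) (h.abs_score_le hw x)

/-- Write `z/(1+z) = z - z²/(1+z)` with `z = wβ`; the linear part integrates to zero because `g` and
`φ` have equal mass. -/
lemma SlabAssumptions.integral_score (h : SlabAssumptions γ κ) {w : ℝ}
    (hw : w ∈ Ioc (0 : ℝ) (1 / 2)) :
    ∫ x, score γ w x ∂(gaussianReal 0 1) = -nullScore γ w := by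
  rw [integral_gaussian]
  have h1 : ∀ x, score γ w x * phi (x - 0) = w * (slabConv γ x - phi x) -
      (w * beta γ x) ^ 2 / (1 + w * beta γ x) * phi x := fun x => by
    have h2 := h.half_le hw x
    rw [sub_zero, ← lr_mul_phi, score]
    have h3 : lr γ x = beta γ x + 1 := by rw [beta_eq]; ring
    rw [h3]
    have h4 : 1 + w * beta γ x ≠ 0 := by linarith
    field_simp
    ring
  simp_rw [h1]
  have hi : Integrable fun x => w * (slabConv γ x - phi x) :=
    (h.integrable_slabConv.sub integrable_phi).const_mul w
  rw [integral_sub hi (h.integrable_nullScore hw), integral_const_mul,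
    integral_sub h.integrable_slabConv integrable_phi, h.integral_slabConv, integral_phi,
    nullScore]
  ring

/-- From `1+z ≥ 1/2`. The second moment is controlled by the size of the mean, so the exponential
bounds have rate `q(w)` itself rather than its square. -/
lemma SlabAssumptions.integral_score_sq_le (h : SlabAssumptions γ κ) {w : ℝ}
    (hw : w ∈ Ioc (0 : ℝ) (1 / 2)) :
    ∫ x, score γ w x ^ 2 ∂(gaussianReal 0 1) ≤ 2 * nullScore γ w := by
  rw [integral_gaussian, nullScore, ← integral_const_mul]
  refine integral_mono_of_nonneg (ae_of_all _ fun x => mul_nonneg (sq_nonneg _) (phi_pos _).le)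
    ((h.integrable_nullScore hw).const_mul 2) (ae_of_all _ fun x => ?_)
  simp only [sub_zero]
  rw [← mul_assoc]
  refine mul_le_mul_of_nonneg_right ?_ (phi_pos x).le
  have h1 := h.half_le hw x
  have h2 : 0 < 1 + w * beta γ x := by linarith
  rw [score, div_pow, div_le_iff₀ (by positivity)]
  have h3 : 2 * ((w * beta γ x) ^ 2 / (1 + w * beta γ x)) * (1 + w * beta γ x) ^ 2 =
      2 * (w * beta γ x) ^ 2 * (1 + w * beta γ x) := by field_simp
  rw [h3]
  nlinarith [sq_nonneg (w * beta γ x)]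

lemma exp_quarter_le {y : ℝ} (hy : |y| ≤ 1) : Real.exp (y / 4) ≤ 1 + y / 4 + y ^ 2 / 16 := by
  have h1 := Real.abs_exp_sub_one_sub_id_le (x := y / 4)
    (by rw [abs_div]; norm_num; linarith)
  have h2 := (abs_le.1 h1).2
  nlinarith

lemma SlabAssumptions.integrable_exp_score (h : SlabAssumptions γ κ) {w : ℝ}
    (hw : w ∈ Ioc (0 : ℝ) (1 / 2)) (ν : Measure ℝ) [IsFiniteMeasure ν] :
    Integrable (fun x => Real.exp (score γ w x / 4)) ν := by
  have := h.continuous_score hw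
  refine Integrable.of_bound (C := Real.exp (1 / 4)) (by fun_prop) (ae_of_all _ fun x => ?_)
  rw [Real.norm_of_nonneg (Real.exp_pos _).le]
  apply Real.exp_le_exp.2
  linarith [(abs_le.1 (h.abs_score_le hw x)).2]

/-- At tilt `1/4` the mean contributes `-q/4` and the second moment at most `2q/16`, leaving `-q/8`.
-/
lemma SlabAssumptions.integral_exp_score_null (h : SlabAssumptions γ κ) {w : ℝ}
    (hw : w ∈ Ioc (0 : ℝ) (1 / 2)) :
    ∫ x, Real.exp (score γ w x / 4) ∂(gaussianReal 0 1) ≤ Real.exp (-(nullScore γ w / 8)) := by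
  have hi1 := (h.integrable_score hw (gaussianReal 0 1)).div_const 4
  have hi2 := (h.integrable_score_sq hw (gaussianReal 0 1)).div_const 16
  have hi3 : Integrable (fun x => 1 + score γ w x / 4) (gaussianReal 0 1) :=
    (integrable_const 1).add hi1
  calc ∫ x, Real.exp (score γ w x / 4) ∂(gaussianReal 0 1)
      ≤ ∫ x, (1 + score γ w x / 4 + score γ w x ^ 2 / 16) ∂(gaussianReal 0 1) :=
        integral_mono (h.integrable_exp_score hw _) (hi3.add hi2) fun x =>
          exp_quarter_le (h.abs_score_le hw x)
    _ = 1 + (-nullScore γ w) / 4 +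
        (∫ x, score γ w x ^ 2 ∂(gaussianReal 0 1)) / 16 := by
        rw [integral_add hi3 hi2, integral_add (integrable_const 1) hi1, integral_div,
          integral_div, h.integral_score hw]
        simp
    _ ≤ -(nullScore γ w / 8) + 1 := by linarith [h.integral_score_sq_le hw]
    _ ≤ _ := Real.add_one_le_exp _

lemma SlabAssumptions.integral_exp_score_le (h : SlabAssumptions γ κ) {w : ℝ}
    (hw : w ∈ Ioc (0 : ℝ) (1 / 2)) (θ : ℝ) :
    ∫ x, Real.exp (score γ w x / 4) ∂(gaussianReal θ 1) ≤
      Real.exp (5 / 16 * ∫ x, cappedLR γ w x ∂(gaussianReal θ 1)) := by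
  have hi : Integrable (cappedLR γ w) (gaussianReal θ 1) := by
    refine Integrable.of_bound (C := 1) (h.continuous_cappedLR w).aestronglyMeasurable
      (ae_of_all _ fun x => ?_)
    rw [Real.norm_of_nonneg (h.cappedLR_nonneg hw.1.le x)]
    exact cappedLR_le_one _ _ _
  calc ∫ x, Real.exp (score γ w x / 4) ∂(gaussianReal θ 1)
      ≤ ∫ x, (1 + 5 / 16 * cappedLR γ w x) ∂(gaussianReal θ 1) := by
        refine integral_mono (h.integrable_exp_score hw _)
          ((integrable_const 1).add (hi.const_mul _)) fun x => ?_
        have h0 := h.cappedLR_nonneg hw.1.le x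
        have h1 := cappedLR_le_one γ w x
        have h2 := exp_quarter_le (abs_le.2 ⟨by linarith, h1⟩)
        have h3 : Real.exp (score γ w x / 4) ≤ Real.exp (cappedLR γ w x / 4) :=
          Real.exp_le_exp.2 (by linarith [h.score_le_cappedLR hw x])
        simp only
        nlinarith
    _ = 5 / 16 * (∫ x, cappedLR γ w x ∂(gaussianReal θ 1)) + 1 := by
        rw [integral_add (integrable_const 1) (hi.const_mul _), integral_const_mul]
        simp [add_comm]
    _ ≤ _ := Real.add_one_le_exp _

/-- The indices of the nonzero coordinates. -/
noncomputable def signals (θ : Fin n → ℝ) : Finset (Fin n) := Finset.univ.filter fun i => θ i ≠ 0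

/-- The indices of the zero coordinates. -/
noncomputable def nulls (θ : Fin n → ℝ) : Finset (Fin n) := Finset.univ.filter fun i => θ i = 0

lemma card_nulls_add_card_signals (θ : Fin n → ℝ) : (nulls θ).card + (signals θ).card = n := by
  have := Finset.card_filter_add_card_filter_not (s := (Finset.univ : Finset (Fin n)))
    (fun i => θ i = 0)
  simpa [nulls, signals] using this

lemma SlabAssumptions.nullScore_nonneg (h : SlabAssumptions γ κ) {w : ℝ}
    (hw : w ∈ Ioc (0 : ℝ) (1 / 2)) : 0 ≤ nullScore γ w :=
  integral_nonneg fun x => h.nullScore_integrand_nonneg hw x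

/-- At least half of the coordinates are null and contribute `-nq/16` to the exponent; the signals
give back at most `(5/16)(nq/10) = nq/32`. -/
lemma SlabAssumptions.score_concentration (h : SlabAssumptions γ κ) {w : ℝ}
    (hw : w ∈ Ioc (0 : ℝ) (1 / 2)) (θ : Fin n → ℝ) (hs : 2 * ((signals θ).card : ℝ) ≤ n)
    (hA : ∑ i ∈ signals θ, ∫ x, cappedLR γ w x ∂(gaussianReal (θ i) 1) ≤
      n * nullScore γ w / 10) :
    (dataLaw θ).real {x | 0 ≤ ∑ i, score γ w (x i)} ≤ Real.exp (-(n * nullScore γ w / 32)) := by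
  have hq := h.nullScore_nonneg hw
  have hcont := h.continuous_score hw
  have h1 := chernoff θ (f := fun _ x => score γ w x / 4)
    (fun i => (hcont.div_const 4).measurable) (B := 1)
    (fun i x => by linarith [(abs_le.1 (h.abs_score_le hw x)).2])
    (b := fun i => if θ i = 0 then -(nullScore γ w / 8) else
      5 / 16 * ∫ x, cappedLR γ w x ∂(gaussianReal (θ i) 1))
    (fun i => by
      split_ifs with hi
      · rw [hi]; exact h.integral_exp_score_null hw
      · exact h.integral_exp_score_le hw _) 0
  have hset : {x : Fin n → ℝ | 0 ≤ ∑ i, score γ w (x i) / 4} =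
      {x | 0 ≤ ∑ i, score γ w (x i)} := by
    ext x
    simp only [mem_ofPred_eq]
    rw [← Finset.sum_div]
    constructor <;> intro hx <;> linarith
  rw [hset] at h1
  refine h1.trans (Real.exp_le_exp.2 ?_)
  rw [sub_zero, Finset.sum_ite, Finset.sum_const, ← Finset.mul_sum, nsmul_eq_mul]
  change ((nulls θ).card : ℝ) * _ + 5 / 16 * ∑ i ∈ signals θ, _ ≤ _
  have hcard : ((nulls θ).card : ℝ) + (signals θ).card = n := by
    exact_mod_cast card_nulls_add_card_signals θ
  have h2 : (n : ℝ) / 2 ≤ (nulls θ).card := by linarith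
  have h3 := mul_le_mul_of_nonneg_right h2 hq
  linarith

/-- A nonnegative total score together with few large likelihood ratios is unlikely. -/
lemma SlabAssumptions.few_signals_concentration (h : SlabAssumptions γ κ) {w t C : ℝ}
    (hw : w ∈ Ioc (0 : ℝ) (1 / 2)) (ht : t ∈ Ioo (0 : ℝ) (1 / 2)) (hC : 1 ≤ C)
    (θ : Fin n → ℝ) (hs : 2 * ((signals θ).card : ℝ) ≤ n)
    (hA : ∑ i ∈ signals θ, ∫ x, cappedLR γ w x ∂(gaussianReal (θ i) 1) ≤
      C / t * ∑ i ∈ signals θ, (gaussianReal (θ i) 1).real {x | 2 / t ≤ w * lr γ x} +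
      n * nullScore γ w / 20) :
    (dataLaw θ).real {x | 0 ≤ ∑ i, score γ w (x i) ∧
        countIn (signals θ) {x | 2 / t ≤ w * lr γ x} x < t / (80 * C) * (n * nullScore γ w)} ≤
      Real.exp (-(t / (80 * C) * (n * nullScore γ w))) := by
  have hq := h.nullScore_nonneg hw
  have ht0 := ht.1
  set Q := n * nullScore γ w with hQ
  have hQ0 : 0 ≤ Q := by positivity
  set m := ∑ i ∈ signals θ, (gaussianReal (θ i) 1).real {x | 2 / t ≤ w * lr γ x} with hm
  -- Either few detections are expected and the score is unlikely to be nonnegative, or the expected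
  -- count `m` is at least `tQ/(20C)` and falling below a quarter of it is unlikely. Hence `80 = 4 ·
  -- 20`.
  rcases le_or_gt (C / t * m) (Q / 20) with h1 | h1
  · refine (measureReal_mono fun x hx => hx.1).trans
      ((h.score_concentration hw θ hs (by rw [← hQ]; linarith)).trans (Real.exp_le_exp.2 ?_))
    rw [neg_le_neg_iff, ← hQ]
    have : t / (80 * C) ≤ 1 / 32 := by
      rw [div_le_div_iff₀ (by positivity) (by norm_num)]; linarith [ht.2]
    nlinarith
  · have h2 : t / (80 * C) * Q ≤ m / 4 := by
      have h3 : Q / 20 * t ≤ C * m := by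
        have := mul_le_mul_of_nonneg_right h1.le ht0.le
        calc _ ≤ _ := this
          _ = C * m := by field_simp
      calc t / (80 * C) * Q = (Q / 20 * t) / (4 * C) := by field_simp; ring
        _ ≤ (C * m) / (4 * C) := by gcongr
        _ = m / 4 := by field_simp
    refine (measureReal_mono fun x hx => ?_).trans
      ((countIn_lower_tail θ (signals θ) (h.measurableSet_lr (2 / t) w)).trans
        (Real.exp_le_exp.2 (neg_le_neg h2)))
    exact hx.2.le.trans h2

end SpikeSlab

namespace SpikeSlab

variable {γ : ℝ → ℝ} {κ : ℝ} {n : ℕ}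

/-! ### Product measures and densities -/

lemma lintegral_fin_prod_eq_prod {n : ℕ} {μ : Fin n → Measure ℝ} [∀ i, SigmaFinite (μ i)]
    {f : Fin n → ℝ → ENNReal} (hf : ∀ i, Measurable (f i)) :
    ∫⁻ x, ∏ i, f i (x i) ∂(Measure.pi μ) = ∏ i, ∫⁻ x, f i x ∂(μ i) := by
  induction n with
  | zero => simp
  | succ n ih =>
    have hF : Measurable fun x : Fin (n + 1) → ℝ => ∏ i, f i (x i) :=
      Finset.measurable_prod _ fun i _ => (hf i).comp (measurable_pi_apply i)
    have hG : Measurable fun x : Fin n → ℝ => ∏ i, f (Fin.succ i) (x i) :=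
      Finset.measurable_prod _ fun i _ => (hf _).comp (measurable_pi_apply i)
    calc
      _ = ∫⁻ x : ℝ × (Fin n → ℝ), f 0 x.1 * ∏ i : Fin n, f (Fin.succ i) (x.2 i)
            ∂((μ 0).prod (Measure.pi (fun i ↦ μ i.succ))) := by
          rw [← ((measurePreserving_piFinSuccAbove μ 0).symm).lintegral_comp hF]
          simp_rw [MeasurableEquiv.piFinSuccAbove_symm_apply, Fin.insertNthEquiv,
            Fin.prod_univ_succ, Fin.insertNth_zero, Equiv.coe_fn_mk, Fin.cons_succ,
            Fin.zero_succAbove, cast_eq, Fin.cons_zero]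
      _ = (∫⁻ x, f 0 x ∂μ 0) * ∏ i : Fin n, ∫⁻ x, f (Fin.succ i) x ∂(μ i.succ) := by
          rw [← ih fun i => hf i.succ, ← lintegral_prod_mul (hf 0).aemeasurable
            hG.aemeasurable]
      _ = _ := by rw [Fin.prod_univ_succ]

/-- Transfers Lebesgue almost-everywhere properties of the estimated weight to the law of the data.
-/
lemma dataLaw_absolutelyContinuous (θ : Fin n → ℝ) : dataLaw θ ≪ volume := by
  have h1 : dataLaw θ = (volume : Measure (Fin n → ℝ)).withDensity
      fun x => ∏ i, gaussianPDF (θ i) 1 (x i) := by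
    refine Measure.pi_eq fun s hs => ?_
    rw [withDensity_apply _ (MeasurableSet.univ_pi hs),
      ← lintegral_indicator (MeasurableSet.univ_pi hs)]
    have h2 : ∀ x : Fin n → ℝ, (univ.pi s).indicator
        (fun x => ∏ i, gaussianPDF (θ i) 1 (x i)) x =
        ∏ i, (s i).indicator (gaussianPDF (θ i) 1) (x i) := fun x => by
      by_cases hx : x ∈ univ.pi s
      · rw [indicator_of_mem hx]
        exact Finset.prod_congr rfl fun i _ => (indicator_of_mem (hx i (mem_univ i)) _).symm
      · rw [indicator_of_notMem hx]
        simp only [mem_univ_pi, not_forall] at hx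
        obtain ⟨i, hi⟩ := hx
        exact (Finset.prod_eq_zero (Finset.mem_univ i) (indicator_of_notMem hi _)).symm
    simp_rw [h2]
    rw [volume_pi, lintegral_fin_prod_eq_prod fun i => (measurable_gaussianPDF _ _).indicator (hs i)]
    refine Finset.prod_congr rfl fun i _ => ?_
    rw [lintegral_indicator (hs i), gaussianReal_apply _ one_ne_zero]
  rw [h1]
  exact withDensity_absolutelyContinuous _ _

/-! ### The coordinate posterior -/

/-- The contribution of the set `A` to the marginal density of the slab at `x`. -/
noncomputable def slabMass (γ : ℝ → ℝ) (x : ℝ) (A : Set ℝ) : ℝ := ∫ u in A, γ u * phi (x - u)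

/-- The marginal density of one observation under the prior with weight `w`. -/
noncomputable def marginalDensity (γ : ℝ → ℝ) (w x : ℝ) : ℝ := (1 - w) * phi x + w * slabConv γ x

/-- The posterior mass of `A` for one coordinate. -/
noncomputable def postMass (γ : ℝ → ℝ) (w x : ℝ) (A : Set ℝ) : ℝ :=
  (A.indicator 1 0 * ((1 - w) * phi x) + w * slabMass γ x A) / marginalDensity γ w x

lemma SlabAssumptions.slabMass_nonneg (h : SlabAssumptions γ κ) (x : ℝ) (A : Set ℝ) :
    0 ≤ slabMass γ x A := integral_nonneg fun u => (mul_pos (h.pos u) (phi_pos _)).le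

lemma slabMass_univ (γ : ℝ → ℝ) (x : ℝ) :
    slabMass γ x univ = slabConv γ x := by rw [slabMass, setIntegral_univ, slabConv_eq]

lemma SlabAssumptions.slabMass_le (h : SlabAssumptions γ κ) (x : ℝ) (A : Set ℝ) :
    slabMass γ x A ≤ slabConv γ x := by
  rw [slabConv_eq]
  exact setIntegral_le_integral (h.integrable_mul_phi' x)
    (ae_of_all _ fun u => (mul_pos (h.pos u) (phi_pos _)).le)

lemma SlabAssumptions.marginalDensity_pos (h : SlabAssumptions γ κ) {w : ℝ}
    (hw : w ∈ Ioc (0 : ℝ) 1) (x : ℝ) : 0 < marginalDensity γ w x := by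
  have h1 := mul_pos hw.1 (h.slabConv_pos x)
  have h2 := mul_nonneg (sub_nonneg.2 hw.2) (phi_pos x).le
  unfold marginalDensity; linarith

lemma gaussianPDF_one_eq (θ x : ℝ) : gaussianPDF θ 1 x = ENNReal.ofReal (phi (x - θ)) := by
  rw [gaussianPDF, gaussianPDFReal_one_eq]

lemma SlabAssumptions.isFiniteMeasure_coordPrior (h : SlabAssumptions γ κ) (w : ℝ) :
    IsFiniteMeasure (coordPrior γ w) := by
  have : IsFiniteMeasure ((volume : Measure ℝ).withDensity fun u => ENNReal.ofReal (γ u)) :=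
    isFiniteMeasure_withDensity_ofReal h.integrable.2
  refine ⟨?_⟩
  simp only [coordPrior, Measure.coe_add, Measure.coe_smul, Pi.add_apply, Pi.smul_apply,
    smul_eq_mul]
  exact ENNReal.add_lt_top.2 ⟨ENNReal.mul_lt_top ENNReal.ofReal_lt_top (measure_lt_top _ _),
    ENNReal.mul_lt_top ENNReal.ofReal_lt_top (measure_lt_top _ _)⟩

lemma measurable_gaussianPDF_left (x : ℝ) : Measurable fun θ => gaussianPDF θ 1 x := by
  simp_rw [gaussianPDF_one_eq]
  have := continuous_phi
  exact (by fun_prop : Continuous fun θ => phi (x - θ)).measurable.ennreal_ofReal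

lemma SlabAssumptions.lintegral_coordPrior (h : SlabAssumptions γ κ) {w : ℝ}
    (hw : w ∈ Ioc (0 : ℝ) 1) (x : ℝ) {A : Set ℝ} (hA : MeasurableSet A) :
    ∫⁻ θ in A, gaussianPDF θ 1 x ∂(coordPrior γ w) =
      ENNReal.ofReal (A.indicator 1 0 * ((1 - w) * phi x) + w * slabMass γ x A) := by
  have hm := measurable_gaussianPDF_left x
  have hw1 : 0 ≤ 1 - w := sub_nonneg.2 hw.2
  have h00 : 0 ≤ A.indicator (1 : ℝ → ℝ) 0 := indicator_nonneg (fun _ _ => zero_le_one) _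
  have hγm : Measurable fun u => ENNReal.ofReal (γ u) :=
    h.continuous.measurable.ennreal_ofReal
  rw [coordPrior, Measure.restrict_add, lintegral_add_measure, Measure.restrict_smul,
    Measure.restrict_smul, lintegral_smul_measure, lintegral_smul_measure,
    ← lintegral_indicator hA, lintegral_dirac' _ (hm.indicator hA),
    setLIntegral_withDensity_eq_setLIntegral_mul _ hγm hm hA,
    ENNReal.ofReal_add (mul_nonneg h00 (mul_nonneg hw1 (phi_pos x).le)) (mul_nonneg hw.1.le (h.slabMass_nonneg x A))]
  congr 1
  · by_cases h0 : (0 : ℝ) ∈ A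
    · simp only [h0, indicator_of_mem, Pi.one_apply, one_mul, gaussianPDF_one_eq, sub_zero,
        smul_eq_mul]
      rw [ENNReal.ofReal_mul hw1]
    · simp [h0]
  · rw [smul_eq_mul, ENNReal.ofReal_mul hw.1.le, slabMass,
      ofReal_integral_eq_lintegral_ofReal (h.integrable_mul_phi' x).integrableOn
        (ae_of_all _ fun u => (mul_pos (h.pos u) (phi_pos _)).le)]
    congr 1
    refine lintegral_congr fun u => ?_
    rw [Pi.mul_apply, gaussianPDF_one_eq, ENNReal.ofReal_mul (h.pos u).le]

lemma SlabAssumptions.lintegral_coordPrior_univ (h : SlabAssumptions γ κ) {w : ℝ}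
    (hw : w ∈ Ioc (0 : ℝ) 1) (x : ℝ) :
    ∫⁻ θ, gaussianPDF θ 1 x ∂(coordPrior γ w) = ENNReal.ofReal (marginalDensity γ w x) := by
  rw [← setLIntegral_univ, h.lintegral_coordPrior hw x MeasurableSet.univ, slabMass_univ]
  simp [marginalDensity]

/-- The coordinates are independent under the posterior, so that the posterior of a coordinate is
the one-dimensional posterior. -/
lemma SlabAssumptions.coordPosterior_apply (h : SlabAssumptions γ κ) {w : ℝ}
    (hw : w ∈ Ioc (0 : ℝ) 1) (x : Fin n → ℝ) (i : Fin n) {A : Set ℝ} (hA : MeasurableSet A) :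
    coordPosterior γ w x i A = ENNReal.ofReal (postMass γ w (x i) A) := by
  have := h.isFiniteMeasure_coordPrior w
  have hm : ∀ j, Measurable fun θ => gaussianPDF θ 1 (x j) := fun j =>
    measurable_gaussianPDF_left (x j)
  have hD := fun j => h.marginalDensity_pos hw (x j)
  have hZ : ∫⁻ θ, likelihood x θ ∂(prior γ w n) =
      ∏ j, ENNReal.ofReal (marginalDensity γ w (x j)) := by
    unfold likelihood prior
    rw [lintegral_fin_prod_eq_prod hm]
    exact Finset.prod_congr rfl fun j _ => h.lintegral_coordPrior_univ hw (x j)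
  have hpre : MeasurableSet ((fun θ : Fin n → ℝ => θ i) ⁻¹' A) := measurable_pi_apply i hA
  have hnum : ∫⁻ θ in (fun θ : Fin n → ℝ => θ i) ⁻¹' A, likelihood x θ ∂(prior γ w n) =
      ENNReal.ofReal (A.indicator 1 0 * ((1 - w) * phi (x i)) + w * slabMass γ (x i) A) *
        ∏ j ∈ Finset.univ.erase i, ENNReal.ofReal (marginalDensity γ w (x j)) := by
    rw [← lintegral_indicator hpre]
    have h2 : ∀ θ : Fin n → ℝ, ((fun θ : Fin n → ℝ => θ i) ⁻¹' A).indicator (likelihood x) θ =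
        ∏ j, (if j = i then A.indicator fun θ => gaussianPDF θ 1 (x j)
          else fun θ => gaussianPDF θ 1 (x j)) (θ j) := fun θ => by
      by_cases hθ : θ i ∈ A
      · rw [indicator_of_mem (by exact hθ)]
        refine Finset.prod_congr rfl fun j _ => ?_
        split_ifs with hj
        · subst hj; rw [indicator_of_mem hθ]
        · rfl
      · rw [indicator_of_notMem (by exact hθ)]
        refine (Finset.prod_eq_zero (Finset.mem_univ i) ?_).symm
        rw [if_pos rfl, indicator_of_notMem hθ]
    simp_rw [h2]
    unfold prior
    rw [lintegral_fin_prod_eq_prod fun j => by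
      split_ifs
      · exact (hm j).indicator hA
      · exact hm j]
    rw [← Finset.mul_prod_erase _ _ (Finset.mem_univ i), if_pos rfl, lintegral_indicator hA,
      h.lintegral_coordPrior hw _ hA]
    congr 1
    refine Finset.prod_congr rfl fun j hj => ?_
    rw [if_neg (Finset.ne_of_mem_erase hj), h.lintegral_coordPrior_univ hw]
  rw [coordPosterior, Measure.map_apply (measurable_pi_apply i) hA, posterior, Measure.smul_apply,
    withDensity_apply _ hpre, hZ, hnum, smul_eq_mul,
    ← Finset.mul_prod_erase _ _ (Finset.mem_univ i)]
  set P := ∏ j ∈ Finset.univ.erase i, ENNReal.ofReal (marginalDensity γ w (x j)) with hP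
  have hP0 : P ≠ 0 := Finset.prod_ne_zero_iff.2 fun j _ => (ENNReal.ofReal_pos.2 (hD j)).ne'
  have hPt : P ≠ ⊤ := ENNReal.prod_ne_top fun j _ => ENNReal.ofReal_ne_top
  rw [postMass, ENNReal.ofReal_div_of_pos (hD i), mul_comm, ← div_eq_mul_inv,
    ENNReal.mul_div_mul_right _ _ hP0 hPt]

lemma SlabAssumptions.postMass_nonneg (h : SlabAssumptions γ κ) {w : ℝ}
    (hw : w ∈ Ioc (0 : ℝ) 1) (x : ℝ) (A : Set ℝ) : 0 ≤ postMass γ w x A :=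
  div_nonneg (add_nonneg (mul_nonneg (indicator_nonneg (fun _ _ => zero_le_one) _)
    (mul_nonneg (sub_nonneg.2 hw.2) (phi_pos x).le)) (mul_nonneg hw.1.le (h.slabMass_nonneg x A)))
    (h.marginalDensity_pos hw x).le

lemma SlabAssumptions.coordPosterior_real (h : SlabAssumptions γ κ) {w : ℝ}
    (hw : w ∈ Ioc (0 : ℝ) 1) (x : Fin n → ℝ) (i : Fin n) {A : Set ℝ} (hA : MeasurableSet A) :
    (coordPosterior γ w x i).real A = postMass γ w (x i) A := by
  rw [measureReal_def, h.coordPosterior_apply hw x i hA,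
    ENNReal.toReal_ofReal (h.postMass_nonneg hw _ _)]

lemma SlabAssumptions.isProbabilityMeasure_coordPosterior (h : SlabAssumptions γ κ) {w : ℝ}
    (hw : w ∈ Ioc (0 : ℝ) 1) (x : Fin n → ℝ) (i : Fin n) :
    IsProbabilityMeasure (coordPosterior γ w x i) := by
  refine ⟨?_⟩
  rw [h.coordPosterior_apply hw x i MeasurableSet.univ, postMass, slabMass_univ]
  have := (h.marginalDensity_pos hw (x i)).ne'
  unfold marginalDensity at *
  simp [div_self this]

/-! ### Quantiles -/

section Quantile

variable (μ : Measure ℝ) [IsProbabilityMeasure μ] {t : ℝ}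

lemma quantile_set_bddBelow (ht : 0 < t) : BddBelow {z : ℝ | t ≤ μ.real (Iic z)} := by
  have h1 := (tendsto_cdf_atBot μ).eventually_lt_const ht
  obtain ⟨b, hb⟩ := eventually_atBot.1 h1
  refine ⟨b, fun z hz => ?_⟩
  by_contra hcon
  have h2 := hb z (not_le.1 hcon).le
  rw [cdf_eq_real] at h2
  exact absurd hz (not_le.2 h2)

lemma quantile_set_nonempty (ht : t < 1) : {z : ℝ | t ≤ μ.real (Iic z)}.Nonempty := by
  obtain ⟨b, hb⟩ := ((tendsto_cdf_atTop μ).eventually_const_lt ht).exists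
  refine ⟨b, ?_⟩
  rw [cdf_eq_real] at hb
  exact hb.le

lemma quantile_neg_iff (ht : t ∈ Ioo (0 : ℝ) 1) :
    quantile μ t < 0 ↔ ∃ z < 0, t ≤ μ.real (Iic z) := by
  rw [quantile, csInf_lt_iff (quantile_set_bddBelow μ ht.1) (quantile_set_nonempty μ ht.2)]
  simp only [mem_ofPred_eq]
  exact ⟨fun ⟨b, h1, h2⟩ => ⟨b, h2, h1⟩, fun ⟨b, h1, h2⟩ => ⟨b, h2, h1⟩⟩

lemma quantile_pos_iff (ht : t ∈ Ioo (0 : ℝ) 1) :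
    0 < quantile μ t ↔ μ.real (Iic 0) < t := by
  constructor
  · intro h0
    by_contra hcon
    exact absurd (csInf_le (quantile_set_bddBelow μ ht.1) (by exact not_lt.1 hcon))
      (not_le.2 h0)
  · intro h0
    have h1 : ∀ᶠ z in nhdsWithin 0 (Ioi 0), cdf μ z < t := by
      have h2 := ((cdf μ).right_continuous 0).mono Ioi_subset_Ici_self
      exact h2.eventually_lt_const (by rw [cdf_eq_real]; exact h0)
    obtain ⟨z, hz, hz0⟩ := (h1.and self_mem_nhdsWithin).exists
    have hz0 : 0 < z := hz0
    refine lt_of_lt_of_le hz0 (le_csInf (quantile_set_nonempty μ ht.2) fun b hb => ?_)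
    by_contra hcon
    have h3 := monotone_cdf μ (not_le.1 hcon).le
    rw [cdf_eq_real μ b] at h3
    exact absurd (hb.trans h3) (not_le.2 hz)

end Quantile

/-! ### The rejection event -/

/-- The rejection event of the credible interval procedure for one observation. -/
def Rejects (γ : ℝ → ℝ) (t w x : ℝ) : Prop :=
  postMass γ w x (Iic 0) < t ∨ ∃ q : ℚ, (q : ℝ) < 0 ∧ 1 - t ≤ postMass γ w x (Iic (q : ℝ))

lemma SlabAssumptions.postMass_mono (h : SlabAssumptions γ κ) {w : ℝ}
    (hw : w ∈ Ioc (0 : ℝ) 1) (x : ℝ) {a b : ℝ} (hab : a ≤ b) :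
    postMass γ w x (Iic a) ≤ postMass γ w x (Iic b) := by
  rw [← h.coordPosterior_real hw (fun _ : Fin 1 => x) 0 measurableSet_Iic,
    ← h.coordPosterior_real hw (fun _ : Fin 1 => x) 0 measurableSet_Iic]
  have := h.isProbabilityMeasure_coordPosterior hw (fun _ : Fin 1 => x) 0
  exact measureReal_mono (Iic_subset_Iic.2 hab)

lemma SlabAssumptions.mci_eq (h : SlabAssumptions γ κ) {t : ℝ} (ht : t ∈ Ioo (0 : ℝ) (1 / 2))
    {what : (Fin n → ℝ) → ℝ} {x : Fin n → ℝ} (hw : what x ∈ Ioc (0 : ℝ) 1) (i : Fin n) :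
    mci γ t what x i = {y | Rejects γ t (what x) y}.indicator 1 (x i) := by
  have := h.isProbabilityMeasure_coordPosterior hw x i
  have ht1 : t ∈ Ioo (0 : ℝ) 1 := ⟨ht.1, by linarith [ht.2]⟩
  have ht2 : 1 - t ∈ Ioo (0 : ℝ) 1 := ⟨by linarith [ht.2], by linarith [ht.1]⟩
  have key : (0 : ℝ) ∉ Icc (quantile (coordPosterior γ (what x) x i) t)
      (quantile (coordPosterior γ (what x) x i) (1 - t)) ↔ Rejects γ t (what x) (x i) := by
    rw [mem_Icc, not_and_or, not_le, not_le, quantile_pos_iff _ ht1, quantile_neg_iff _ ht2,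
      Rejects, h.coordPosterior_real hw x i measurableSet_Iic]
    refine or_congr Iff.rfl ⟨?_, ?_⟩
    · rintro ⟨z, hz, hzt⟩
      -- Monotonicity of the posterior distribution function allows rational points only, which
      -- makes the rejection event a countable union.
      obtain ⟨q, hq1, hq2⟩ := exists_rat_btwn hz
      rw [h.coordPosterior_real hw x i measurableSet_Iic] at hzt
      exact ⟨q, hq2, hzt.trans (h.postMass_mono hw _ hq1.le)⟩
    · rintro ⟨q, hq, hqt⟩
      exact ⟨q, hq, by rwa [h.coordPosterior_real hw x i measurableSet_Iic]⟩
  unfold mci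
  by_cases hr : Rejects γ t (what x) (x i)
  · rw [if_pos (key.2 hr), indicator_of_mem (by exact hr), Pi.one_apply]
  · rw [if_neg (mt key.1 hr), indicator_of_notMem (by exact hr)]

/-- A rejection forces a large likelihood ratio. -/
lemma SlabAssumptions.lr_ge_of_rejects (h : SlabAssumptions γ κ) {t w v x : ℝ}
    (ht : t ∈ Ioo (0 : ℝ) (1 / 2)) (hw : 0 < w) (hwv : w ≤ v) (hv : v ≤ 1 / 2)
    (hr : Rejects γ t w x) : 1 / (4 * t) ≤ v * lr γ x := by
  have ht0 := ht.1
  have ht2 := ht.2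
  have hw' : w ∈ Ioc (0 : ℝ) 1 := ⟨hw, by linarith⟩
  have hD := h.marginalDensity_pos hw' x
  have hφ := phi_pos x
  have hg := h.slabConv_pos x
  -- Each side of the interval gives this inequality: a rejection on either side puts posterior mass
  -- at most `t` on the spike. Then `(1-t)(1-w) ≥ 1/4`.
  have key : (1 - t) * ((1 - w) * phi x) ≤ t * (w * slabConv γ x) := by
    rcases hr with h1 | ⟨q, hq, h1⟩
    · rw [postMass, div_lt_iff₀ hD] at h1
      have h0 : (0 : ℝ) ∈ Iic (0 : ℝ) := self_mem_Iic
      rw [indicator_of_mem h0, Pi.one_apply, one_mul, marginalDensity] at h1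
      have h2 := mul_nonneg hw.le (h.slabMass_nonneg x (Iic 0))
      linarith
    · rw [postMass, le_div_iff₀ hD] at h1
      have h0 : (0 : ℝ) ∉ Iic (q : ℝ) := by simpa using hq
      rw [indicator_of_notMem h0, zero_mul, zero_add, marginalDensity] at h1
      have h2 := mul_le_mul_of_nonneg_left (h.slabMass_le x (Iic (q : ℝ))) hw.le
      linarith
  have h2 : 1 / 4 * phi x ≤ t * (w * slabConv γ x) := by
    refine le_trans ?_ key
    have : (1 / 4 : ℝ) ≤ (1 - t) * (1 - w) := by nlinarith
    nlinarith
  rw [lr, ← mul_div_assoc, div_le_div_iff₀ (by positivity) hφ]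
  have h3 := mul_le_mul_of_nonneg_right hwv hg.le
  nlinarith

/-- On such a set every `u` explains `x` no better than the value zero does, and the slab has mass
at most one there. -/
lemma SlabAssumptions.slabMass_le_phi (h : SlabAssumptions γ κ) {x : ℝ} {A : Set ℝ}
    (hA : MeasurableSet A) (hxA : ∀ u ∈ A, |x| ≤ |x - u|) : slabMass γ x A ≤ phi x := by
  calc slabMass γ x A ≤ ∫ u in A, γ u * phi x :=
        setIntegral_mono_on (h.integrable_mul_phi' x).integrableOn
          (h.integrable.mul_const _).integrableOn hA fun u hu =>
          mul_le_mul_of_nonneg_left (phi_le_phi_of_abs_le (hxA u hu)) (h.pos u).le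
    _ = (∫ u in A, γ u) * phi x := integral_mul_const _ _
    _ ≤ 1 * phi x := by
        have := setIntegral_le_integral h.integrable (s := A) (ae_of_all _ fun u => (h.pos u).le)
        rw [h.integral_eq_one] at this
        exact mul_le_mul_of_nonneg_right this (phi_pos x).le
    _ = phi x := one_mul _

/-- The numerator is at most `φ(x)` and the denominator at least `w g(x) ≥ (2/t) φ(x)`. Having `t/2`
instead of `t` leaves room for strict inequalities. -/
lemma SlabAssumptions.postMass_le_half (h : SlabAssumptions γ κ) {t w x : ℝ} (ht : 0 < t)
    (hw : w ∈ Ioc (0 : ℝ) 1) (hlr : 2 / t ≤ w * lr γ x) {A : Set ℝ} (hA : MeasurableSet A)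
    (hxA : ∀ u ∈ A, |x| ≤ |x - u|) : postMass γ w x A ≤ t / 2 := by
  have hD := h.marginalDensity_pos hw x
  have hφ := phi_pos x
  have h1 := mul_le_mul_of_nonneg_left (h.slabMass_le_phi hA hxA) hw.1.le
  have h2 : A.indicator 1 0 * ((1 - w) * phi x) ≤ (1 - w) * phi x := by
    have h3 := mul_nonneg (sub_nonneg.2 hw.2) hφ.le
    by_cases h0 : (0 : ℝ) ∈ A <;> simp [h0, h3]
  rw [postMass, div_le_iff₀ hD, marginalDensity]
  rw [lr, ← mul_div_assoc, div_le_div_iff₀ ht hφ] at hlr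
  have h3 := mul_nonneg (mul_nonneg ht.le (sub_nonneg.2 hw.2)) hφ.le
  nlinarith

/-- A very large likelihood ratio forces a rejection. -/
lemma SlabAssumptions.rejects_of_lr_ge (h : SlabAssumptions γ κ) {t v w x : ℝ}
    (ht : t ∈ Ioo (0 : ℝ) (1 / 2)) (hvw : v ≤ w) (hw : w ∈ Ioc (0 : ℝ) 1)
    (hlr : 2 / t ≤ v * lr γ x) : Rejects γ t w x := by
  have ht0 := ht.1
  have hlr' : 2 / t ≤ w * lr γ x :=
    hlr.trans (mul_le_mul_of_nonneg_right hvw (h.lr_pos x).le)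
  rcases le_total 0 x with hx | hx
  · left
    have := h.postMass_le_half ht0 hw hlr' measurableSet_Iic (A := Iic 0) fun u hu => by
      have hu : u ≤ 0 := hu
      rw [abs_of_nonneg hx, abs_of_nonneg (by linarith)]; linarith
    linarith
  · right
    have h1 := h.postMass_le_half ht0 hw hlr' measurableSet_Ici (A := Ici 0) fun u hu => by
      have hu : 0 ≤ u := hu
      rw [abs_of_nonpos hx, abs_of_nonpos (by linarith)]; linarith
    set X : Fin 1 → ℝ := fun _ => x with hX
    set μ := coordPosterior γ w X 0 with hμ
    have hprob : IsProbabilityMeasure μ := h.isProbabilityMeasure_coordPosterior hw X 0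
    have hreal : ∀ A, MeasurableSet A → μ.real A = postMass γ w x A := fun A hA =>
      h.coordPosterior_real hw X 0 hA
    -- The upper quantile must be strictly negative, so the strict bound on the open half-line is
    -- moved to a slightly negative point by continuity from below.
    have h2 : 1 - t < μ.real (Iio 0) := by
      have h3 := probReal_compl_eq_one_sub (μ := μ) (measurableSet_Ici (a := (0 : ℝ)))
      rw [compl_Ici, hreal _ measurableSet_Ici] at h3
      linarith
    obtain ⟨u, hmono, hu0, hu⟩ := exists_seq_strictMono_tendsto (0 : ℝ)
    have h4 : ⋃ k, Iic (u k) = Iio 0 := by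
      ext y
      simp only [mem_iUnion, mem_Iic, mem_Iio]
      constructor
      · rintro ⟨k, hk⟩; exact hk.trans_lt (hu0 k)
      · intro hy
        obtain ⟨k, hk⟩ := (hu.eventually_const_lt hy).exists
        exact ⟨k, hk.le⟩
    have h5 := tendsto_measure_iUnion_atTop (μ := μ) (s := fun k => Iic (u k))
      fun a b hab => Iic_subset_Iic.2 (hmono.monotone hab)
    rw [h4] at h5
    have h6 := (ENNReal.tendsto_toReal (measure_ne_top μ (Iio 0))).comp h5
    obtain ⟨k, hk⟩ := (h6.eventually_const_lt h2).exists
    obtain ⟨q, hq1, hq2⟩ := exists_rat_btwn (hu0 k)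
    refine ⟨q, hq2, le_trans ?_ (h.postMass_mono hw x hq1.le)⟩
    rw [← hreal _ measurableSet_Iic]
    exact hk.le

end SpikeSlab

namespace SpikeSlab

variable {γ : ℝ → ℝ} {κ : ℝ} {n : ℕ}

/-! ### The marginal maximum likelihood weight -/

lemma SlabAssumptions.one_add_mul_beta_pos (h : SlabAssumptions γ κ) {w : ℝ}
    (hw : w ∈ Ioc (0 : ℝ) 1) (x : ℝ) : 0 < 1 + w * beta γ x := by
  have h1 := mul_pos hw.1 (h.lr_pos x)
  rw [beta_eq]; linarith [hw.2]

/-- The derivative of the log marginal likelihood in the weight. -/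
noncomputable def totalScore (γ : ℝ → ℝ) (w : ℝ) (x : Fin n → ℝ) : ℝ :=
  ∑ i, beta γ (x i) / (1 + w * beta γ (x i))

lemma sum_score_eq (γ : ℝ → ℝ) (w : ℝ) (x : Fin n → ℝ) :
    ∑ i, score γ w (x i) = w * totalScore γ w x := by
  rw [totalScore, Finset.mul_sum]
  exact Finset.sum_congr rfl fun i _ => by rw [score, mul_div_assoc]

lemma SlabAssumptions.log_sub_le (h : SlabAssumptions γ κ) {w c : ℝ} (hw : w ∈ Ioc (0 : ℝ) 1)
    (hc : c ∈ Ioc (0 : ℝ) 1) (x : ℝ) :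
    Real.log (1 + w * beta γ x) - Real.log (1 + c * beta γ x) ≤
      (w - c) * (beta γ x / (1 + c * beta γ x)) := by
  have h1 := h.one_add_mul_beta_pos hw x
  have h2 := h.one_add_mul_beta_pos hc x
  rw [← Real.log_div h1.ne' h2.ne']
  refine (Real.log_le_sub_one_of_pos (div_pos h1 h2)).trans (le_of_eq ?_)
  rw [div_sub_one h2.ne', ← mul_div_assoc]
  ring

lemma SlabAssumptions.log_sub_lt (h : SlabAssumptions γ κ) {w c : ℝ} (hw : w ∈ Ioc (0 : ℝ) 1)
    (hc : c ∈ Ioc (0 : ℝ) 1) (hwc : w ≠ c) {x : ℝ} (hx : beta γ x ≠ 0) :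
    Real.log (1 + w * beta γ x) - Real.log (1 + c * beta γ x) <
      (w - c) * (beta γ x / (1 + c * beta γ x)) := by
  have h1 := h.one_add_mul_beta_pos hw x
  have h2 := h.one_add_mul_beta_pos hc x
  rw [← Real.log_div h1.ne' h2.ne']
  refine (Real.log_lt_sub_one_of_pos (div_pos h1 h2) ?_).trans_le (le_of_eq ?_)
  · rw [Ne, div_eq_one_iff_eq h2.ne']
    intro h3
    have : (w - c) * beta γ x = 0 := by linarith
    rcases mul_eq_zero.1 this with h4 | h4
    · exact hwc (by linarith)
    · exact hx h4
  · rw [div_sub_one h2.ne', ← mul_div_assoc]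
    ring

lemma SlabAssumptions.logMarginal_sub_le (h : SlabAssumptions γ κ) {w c : ℝ}
    (hw : w ∈ Ioc (0 : ℝ) 1) (hc : c ∈ Ioc (0 : ℝ) 1) (x : Fin n → ℝ) :
    logMarginal γ x w - logMarginal γ x c ≤ (w - c) * totalScore γ c x := by
  unfold logMarginal totalScore
  rw [add_sub_add_left_eq_sub, ← Finset.sum_sub_distrib, Finset.mul_sum]
  exact Finset.sum_le_sum fun i _ => h.log_sub_le hw hc (x i)

lemma SlabAssumptions.logMarginal_sub_lt (h : SlabAssumptions γ κ) {w c : ℝ}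
    (hw : w ∈ Ioc (0 : ℝ) 1) (hc : c ∈ Ioc (0 : ℝ) 1) (hwc : w ≠ c) {x : Fin n → ℝ}
    (hx : ∃ i, beta γ (x i) ≠ 0) :
    logMarginal γ x w - logMarginal γ x c < (w - c) * totalScore γ c x := by
  obtain ⟨i, hi⟩ := hx
  unfold logMarginal totalScore
  rw [add_sub_add_left_eq_sub, ← Finset.sum_sub_distrib, Finset.mul_sum]
  exact Finset.sum_lt_sum (fun i _ => h.log_sub_le hw hc (x i))
    ⟨i, Finset.mem_univ i, h.log_sub_lt hw hc hwc hi⟩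

lemma IsMMLE.mem_Ioc (hn : 1 ≤ n) {x : Fin n → ℝ} {w : ℝ} (hw : IsMMLE γ x w) :
    w ∈ Ioc (0 : ℝ) 1 :=
  ⟨lt_of_lt_of_le (by positivity) hw.1.1, hw.1.2⟩

/-- The tangent at `c` lies above the concave likelihood, so a maximiser to the right of `c`
excludes a negative slope there. -/
lemma SlabAssumptions.sum_score_nonneg (h : SlabAssumptions γ κ) (hn : 1 ≤ n) {x : Fin n → ℝ}
    {w c : ℝ} (hw : IsMMLE γ x w) (hc : 1 / (n : ℝ) ≤ c) (hcw : c < w) :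
    0 ≤ ∑ i, score γ c (x i) := by
  have hw' := hw.mem_Ioc hn
  have hc0 : 0 < c := lt_of_lt_of_le (by positivity) hc
  have hc1 : c ≤ 1 := hcw.le.trans hw'.2
  have h1 := h.logMarginal_sub_le hw' ⟨hc0, hc1⟩ x
  have h2 : logMarginal γ x c ≤ logMarginal γ x w := hw.2 ⟨hc, hc1⟩
  have h3 : 0 ≤ (w - c) * totalScore γ c x := by linarith
  rw [sum_score_eq]
  exact mul_nonneg hc0.le (nonneg_of_mul_nonneg_right h3 (sub_pos.2 hcw))

lemma SlabAssumptions.continuousOn_totalScore (h : SlabAssumptions γ κ) (x : Fin n → ℝ) :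
    ContinuousOn (fun w => totalScore γ w x) (Ioc 0 1) := by
  unfold totalScore
  refine continuousOn_finsetSum _ fun i _ => ?_
  exact ContinuousOn.div (by fun_prop) (by fun_prop)
    fun w hw => (h.one_add_mul_beta_pos hw (x i)).ne'

lemma SlabAssumptions.totalScore_pos_iff (h : SlabAssumptions γ κ) (hn : 1 ≤ n) {x : Fin n → ℝ}
    {w c : ℝ} (hw : IsMMLE γ x w) (hx : ∃ i, beta γ (x i) ≠ 0)
    (hc : c ∈ Ico (1 / (n : ℝ)) 1) : c < w ↔ 0 < totalScore γ c x := by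
  have hw' := hw.mem_Ioc hn
  have hc0 : 0 < c := lt_of_lt_of_le (by positivity) hc.1
  constructor
  · intro hcw
    have h1 := h.logMarginal_sub_lt hw' ⟨hc0, hc.2.le⟩ hcw.ne' hx
    have h2 : logMarginal γ x c ≤ logMarginal γ x w := hw.2 ⟨hc.1, hc.2.le⟩
    exact pos_of_mul_pos_right (by linarith : 0 < (w - c) * totalScore γ c x)
      (sub_pos.2 hcw).le
  -- The maximiser may equal `c`, so the sign is first obtained at points `v > c` and passed to `c`
  -- by continuity; this is where `c < 1` is needed.
  · contrapose!
    intro hwc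
    have hev : ∀ᶠ v in nhdsWithin c (Ioi c), totalScore γ v x ≤ 0 := by
      filter_upwards [Ioc_mem_nhdsGT hc.2] with v hv
      have hv' : v ∈ Ioc (0 : ℝ) 1 := ⟨hc0.trans hv.1, hv.2⟩
      have h1 := h.logMarginal_sub_le hw' hv' x
      have h2 : logMarginal γ x v ≤ logMarginal γ x w := hw.2 ⟨hc.1.trans hv.1.le, hv.2⟩
      have h3 : 0 ≤ (w - v) * totalScore γ v x := by linarith
      have h4 : w - v < 0 := by linarith [hv.1]
      by_contra hcon
      push Not at hcon
      nlinarith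
    have hcont : Tendsto (fun v => totalScore γ v x) (nhdsWithin c (Ioi c))
        (nhds (totalScore γ c x)) := by
      refine ((h.continuousOn_totalScore x) c ⟨hc0, hc.2.le⟩).mono_left ?_
      rw [← nhdsWithin_Ioc_eq_nhdsGT hc.2]
      exact nhdsWithin_mono _ fun v hv => ⟨hc0.trans hv.1, hv.2⟩
    exact le_of_tendsto hcont hev

/-- `β` vanishes only at the two points where `g/φ = 1`, by strict monotonicity in `|x|`. One
nonzero value suffices for strict concavity in the weight. -/
lemma SlabAssumptions.ae_exists_beta_ne_zero (h : SlabAssumptions γ κ) (hn : 1 ≤ n) :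
    ∀ᵐ x ∂(volume : Measure (Fin n → ℝ)), ∃ i, beta γ (x i) ≠ 0 := by
  obtain ⟨a, ha, hla⟩ := h.exists_lr_eq (v := 1) le_rfl
  have h1 : ∀ᵐ y ∂(volume : Measure ℝ), beta γ y ≠ 0 := by
    have h2 : {y | ¬ beta γ y ≠ 0} ⊆ {a, -a} := by
      intro y hy
      have hy : beta γ y = 0 := by simpa using hy
      rw [beta_eq] at hy
      have h3 : lr γ y = lr γ a := by rw [hla]; linarith
      have h4 := le_antisymm (h.abs_le_of_lr_le h3.le) (h.abs_le_of_lr_le h3.ge)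
      rw [abs_of_nonneg ha] at h4
      exact eq_or_eq_neg_of_abs_eq h4
    exact measure_mono_null h2 ((Set.toFinite _).measure_zero _)
  have h2 := (Measure.quasiMeasurePreserving_eval (fun _ : Fin n => (volume : Measure ℝ))
    ⟨0, hn⟩).ae h1
  filter_upwards [h2] with x hx using ⟨_, hx⟩

lemma SlabAssumptions.measurable_totalScore (h : SlabAssumptions γ κ) (c : ℝ) :
    Measurable (totalScore (n := n) γ c) := by
  have hb := h.continuous_beta.measurable
  unfold totalScore
  refine Finset.measurable_sum _ fun i _ => ?_
  have : Measurable fun x : Fin n → ℝ => beta γ (x i) := hb.comp (measurable_pi_apply i)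
  exact this.div (measurable_const.add (this.const_mul c))

/-- Any version of the marginal maximum likelihood weight is almost everywhere measurable. -/
lemma SlabAssumptions.aemeasurable_mmle (h : SlabAssumptions γ κ) (hn : 1 ≤ n)
    {what : (Fin n → ℝ) → ℝ}
    (hw : ∀ᵐ x ∂(volume : Measure (Fin n → ℝ)), IsMMLE γ x (what x)) :
    AEMeasurable what (volume : Measure (Fin n → ℝ)) := by
  refine NullMeasurable.aemeasurable ?_
  refine measurable_of_Ioi (δ := NullMeasurableSpace (Fin n → ℝ) volume) fun c => ?_
  change NullMeasurableSet (what ⁻¹' Ioi c) volume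
  rcases lt_or_ge c (1 / (n : ℝ)) with hc | hc
  · refine MeasurableSet.univ.nullMeasurableSet.congr ?_
    filter_upwards [hw] with x hx
    exact propext ⟨fun _ => hc.trans_le hx.1.1, fun _ => trivial⟩
  rcases lt_or_ge c 1 with hc1 | hc1
  · have hS : MeasurableSet {x : Fin n → ℝ | 0 < totalScore γ c x} :=
      measurableSet_lt measurable_const (h.measurable_totalScore c)
    refine hS.nullMeasurableSet.congr ?_
    filter_upwards [hw, h.ae_exists_beta_ne_zero hn] with x hx hb
    exact propext (h.totalScore_pos_iff hn hx hb ⟨hc, hc1⟩).symm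
  · refine MeasurableSet.empty.nullMeasurableSet.congr ?_
    filter_upwards [hw] with x hx
    refine propext ⟨fun hf => hf.elim, fun hf => ?_⟩
    have : c < what x := hf
    linarith [hx.1.2]

/-! ### Measurability of the false discovery proportion -/

lemma SlabAssumptions.measurable_slabMass (h : SlabAssumptions γ κ) (A : Set ℝ) :
    Measurable fun x => slabMass γ x A := by
  unfold slabMass
  have hc : Continuous (Function.uncurry fun x u : ℝ => γ u * phi (x - u)) := by
    have h1 := h.continuous
    have h2 := continuous_phi
    exact (h1.comp continuous_snd).mul (h2.comp (continuous_fst.sub continuous_snd))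
  exact (hc.stronglyMeasurable.integral_prod_right (ν := volume.restrict A)).measurable

lemma SlabAssumptions.measurable_postMass (h : SlabAssumptions γ κ) (A : Set ℝ) :
    Measurable fun p : ℝ × ℝ => postMass γ p.1 p.2 A := by
  have h1 : Measurable fun p : ℝ × ℝ => slabMass γ p.2 A :=
    (h.measurable_slabMass A).comp measurable_snd
  have h2 : Measurable fun p : ℝ × ℝ => phi p.2 := continuous_phi.measurable.comp measurable_snd
  have h3 : Measurable fun p : ℝ × ℝ => slabConv γ p.2 :=
    h.continuous_slabConv.measurable.comp measurable_snd
  have h4 : Measurable fun p : ℝ × ℝ => p.1 := measurable_fst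
  have h5 : Measurable fun p : ℝ × ℝ => (1 - p.1) * phi p.2 := (measurable_const.sub h4).mul h2
  unfold postMass marginalDensity
  exact ((h5.const_mul _).add (h4.mul h1)).div (h5.add (h4.mul h3))

lemma SlabAssumptions.measurableSet_rejects (h : SlabAssumptions γ κ) (t : ℝ) :
    MeasurableSet {p : ℝ × ℝ | Rejects γ t p.1 p.2} := by
  have h1 : {p : ℝ × ℝ | Rejects γ t p.1 p.2} = {p : ℝ × ℝ | postMass γ p.1 p.2 (Iic 0) < t} ∪
      ⋃ q : ℚ, ({_p : ℝ × ℝ | (q : ℝ) < 0} ∩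
        {p : ℝ × ℝ | 1 - t ≤ postMass γ p.1 p.2 (Iic (q : ℝ))}) := by
    ext p
    simp only [Rejects, mem_ofPred_eq, mem_union, mem_iUnion, mem_inter_iff]
  rw [h1]
  exact (measurableSet_lt (h.measurable_postMass _) measurable_const).union
    (MeasurableSet.iUnion fun q => (MeasurableSet.const _).inter
      (measurableSet_le measurable_const (h.measurable_postMass _)))

lemma fdp_eq (θ d : Fin n → ℝ) :
    fdp θ d = (∑ i ∈ nulls θ, d i) / max 1 (∑ i, d i) := by
  rw [fdp, nulls, Finset.sum_filter]

lemma measurable_fdp (θ : Fin n → ℝ) : Measurable (fdp θ) := by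
  have : fdp θ = fun d => (∑ i ∈ nulls θ, d i) / max 1 (∑ i, d i) := funext (fdp_eq θ)
  rw [this]
  exact (Finset.measurable_sum _ fun i _ => measurable_pi_apply i).div
    (measurable_const.max (Finset.measurable_sum _ fun i _ => measurable_pi_apply i))

lemma SlabAssumptions.aemeasurable_fdp (h : SlabAssumptions γ κ) (hn : 1 ≤ n) {t : ℝ}
    (ht : t ∈ Ioo (0 : ℝ) (1 / 2)) {what : (Fin n → ℝ) → ℝ}
    (hw : ∀ᵐ x ∂(volume : Measure (Fin n → ℝ)), IsMMLE γ x (what x)) (θ : Fin n → ℝ) :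
    AEMeasurable (fun x => fdp θ (mci γ t what x)) (dataLaw θ) := by
  have hm := (h.aemeasurable_mmle hn hw).mono_ac (dataLaw_absolutelyContinuous θ)
  have hw' := (dataLaw_absolutelyContinuous θ).ae_le hw
  refine ⟨fun x => fdp θ fun i =>
    {p : ℝ × ℝ | Rejects γ t p.1 p.2}.indicator 1 (hm.mk what x, x i), ?_, ?_⟩
  · refine (measurable_fdp θ).comp (measurable_pi_lambda _ fun i => ?_)
    exact (measurable_one.indicator (h.measurableSet_rejects t)).comp
      (hm.measurable_mk.prodMk (measurable_pi_apply i))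
  · filter_upwards [hw', hm.ae_eq_mk] with x hx hmk
    congr 1
    ext i
    rw [h.mci_eq ht (hx.mem_Ioc hn), ← hmk]
    rfl

/-! ### Elementary bounds on the false discovery proportion -/

lemma sum_nulls_add_sum_signals (θ d : Fin n → ℝ) :
    ∑ i ∈ nulls θ, d i + ∑ i ∈ signals θ, d i = ∑ i, d i :=
  Finset.sum_filter_add_sum_filter_not _ _ _

lemma fdp_nonneg (θ : Fin n → ℝ) {d : Fin n → ℝ} (hd : ∀ i, 0 ≤ d i) : 0 ≤ fdp θ d := by
  rw [fdp_eq]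
  exact div_nonneg (Finset.sum_nonneg fun i _ => hd i) (zero_le_one.trans (le_max_left _ _))

lemma fdp_le_one (θ : Fin n → ℝ) {d : Fin n → ℝ} (hd : ∀ i, 0 ≤ d i) : fdp θ d ≤ 1 := by
  rw [fdp_eq]
  refine div_le_one_of_le₀ ?_ (zero_le_one.trans (le_max_left _ _))
  refine le_trans ?_ (le_max_right _ _)
  exact Finset.sum_le_univ_sum_of_nonneg hd

lemma fdp_le_sum (θ : Fin n → ℝ) {d : Fin n → ℝ} (hd : ∀ i, 0 ≤ d i) :
    fdp θ d ≤ ∑ i ∈ nulls θ, d i := by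
  rw [fdp_eq]
  exact div_le_self (Finset.sum_nonneg fun i _ => hd i) (le_max_left _ _)

lemma fdp_le_div (θ : Fin n → ℝ) {d : Fin n → ℝ} (hd : ∀ i, 0 ≤ d i) {T : ℝ} (hT : 0 < T)
    (hTd : T ≤ ∑ i ∈ signals θ, d i) : fdp θ d ≤ (∑ i ∈ nulls θ, d i) / T := by
  rw [fdp_eq]
  have h0 : 0 ≤ ∑ i ∈ nulls θ, d i := Finset.sum_nonneg fun i _ => hd i
  have h1 := sum_nulls_add_sum_signals θ d
  have h2 : T ≤ max 1 (∑ i, d i) := le_trans (by linarith) (le_max_right _ _)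
  gcongr

lemma mci_nonneg (γ : ℝ → ℝ) (t : ℝ) (what : (Fin n → ℝ) → ℝ) (x : Fin n → ℝ)
    (i : Fin n) : 0 ≤ mci γ t what x i := by
  unfold mci; split_ifs <;> norm_num

lemma SlabAssumptions.sum_mci_le (h : SlabAssumptions γ κ) {t v : ℝ}
    (ht : t ∈ Ioo (0 : ℝ) (1 / 2)) {what : (Fin n → ℝ) → ℝ} {x : Fin n → ℝ}
    (hw : what x ∈ Ioc (0 : ℝ) 1) (hv : v ≤ 1 / 2) (hwv : what x ≤ v) (S : Finset (Fin n)) :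
    ∑ i ∈ S, mci γ t what x i ≤ countIn S {y | 1 / (4 * t) ≤ v * lr γ y} x := by
  refine Finset.sum_le_sum fun i _ => ?_
  rw [h.mci_eq ht hw]
  exact indicator_le_indicator_of_subset
    (fun y hy => h.lr_ge_of_rejects ht hw.1 hwv hv hy) (fun _ => zero_le_one) _

lemma SlabAssumptions.le_sum_mci (h : SlabAssumptions γ κ) {t v : ℝ}
    (ht : t ∈ Ioo (0 : ℝ) (1 / 2)) {what : (Fin n → ℝ) → ℝ} {x : Fin n → ℝ}
    (hw : what x ∈ Ioc (0 : ℝ) 1) (hvw : v ≤ what x) (S : Finset (Fin n)) :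
    countIn S {y | 2 / t ≤ v * lr γ y} x ≤ ∑ i ∈ S, mci γ t what x i := by
  refine Finset.sum_le_sum fun i _ => ?_
  rw [h.mci_eq ht hw]
  exact indicator_le_indicator_of_subset
    (fun y hy => h.rejects_of_lr_ge ht hvw hw hy) (fun _ => zero_le_one) _

end SpikeSlab

namespace SpikeSlab

variable {γ : ℝ → ℝ} {κ : ℝ} {n : ℕ}

/-! ### The false discovery rate along a dyadic grid of weights -/

lemma integrable_fdp_of_aemeasurable {t : ℝ} {what : (Fin n → ℝ) → ℝ} (θ : Fin n → ℝ)
    (hm : AEMeasurable (fun x => fdp θ (mci γ t what x)) (dataLaw θ)) :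
    Integrable (fun x => fdp θ (mci γ t what x)) (dataLaw θ) := by
  refine Integrable.of_bound (C := 1) hm.aestronglyMeasurable (ae_of_all _ fun x => ?_)
  have h0 := mci_nonneg γ t what x
  rw [Real.norm_of_nonneg (fdp_nonneg θ h0)]
  exact fdp_le_one θ h0

lemma sum_min_geometric_le {a b : ℝ} (ha : 0 ≤ a) (hb : 0 ≤ b) (J K : ℕ) :
    ∑ j ∈ Finset.range K, min a (b / 2 ^ j) ≤ J * a + 2 * b / 2 ^ J := by
  rcases le_total K J with hKJ | hJK
  · calc ∑ j ∈ Finset.range K, min a (b / 2 ^ j) ≤ ∑ _j ∈ Finset.range K, a :=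
          Finset.sum_le_sum fun _ _ => min_le_left _ _
      _ = K * a := by simp
      _ ≤ J * a := by gcongr
      _ ≤ _ := le_add_of_nonneg_right (by positivity)
  -- The subtracted term is the unused remainder of the geometric series; keeping it makes the
  -- induction close.
  · have key : ∑ j ∈ Finset.range K, min a (b / 2 ^ j) ≤
        J * a + 2 * b / 2 ^ J - 2 * b / 2 ^ K := by
      induction K, hJK using Nat.le_induction with
      | base =>
        calc ∑ j ∈ Finset.range J, min a (b / 2 ^ j) ≤ ∑ _j ∈ Finset.range J, a :=
              Finset.sum_le_sum fun _ _ => min_le_left _ _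
          _ = _ := by simp
      | succ K _ ih =>
        rw [Finset.sum_range_succ]
        have h1 : min a (b / 2 ^ K) ≤ 2 * b / 2 ^ K - 2 * b / 2 ^ (K + 1) := by
          refine (min_le_right _ _).trans (le_of_eq ?_)
          rw [pow_succ]; field_simp; ring
        linarith
    have : 0 ≤ 2 * b / 2 ^ K := by positivity
    linarith

lemma exists_grid_cell {w : ℕ → ℝ} {v : ℝ} : ∀ {K : ℕ}, v ≤ w 0 → w K < v →
    ∃ k < K, w (k + 1) < v ∧ v ≤ w k
  | 0, h0, hK => absurd hK (not_lt.2 h0)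
  | K + 1, h0, hK => by
    rcases lt_or_ge (w K) v with h1 | h1
    · obtain ⟨k, hk, hkv⟩ := exists_grid_cell h0 h1
      exact ⟨k, hk.trans (Nat.lt_succ_self K), hkv⟩
    · exact ⟨K, Nat.lt_succ_self K, hK, h1⟩

/-- The event that the score at `w` is nonnegative although few signals are detected. -/
def fewSignals (γ : ℝ → ℝ) (t w T : ℝ) (θ : Fin n → ℝ) : Set (Fin n → ℝ) :=
  {x | 0 ≤ ∑ i, score γ w (x i) ∧ countIn (signals θ) {y | 2 / t ≤ w * lr γ y} x < T}

lemma SlabAssumptions.measurable_sum_score (h : SlabAssumptions γ κ) (w : ℝ) :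
    Measurable fun x : Fin n → ℝ => ∑ i, score γ w (x i) := by
  simp_rw [sum_score_eq]
  exact (h.measurable_totalScore w).const_mul w

lemma SlabAssumptions.measurableSet_fewSignals (h : SlabAssumptions γ κ) (t w T : ℝ)
    (θ : Fin n → ℝ) : MeasurableSet (fewSignals γ t w T θ) :=
  (measurableSet_le measurable_const (h.measurable_sum_score w)).inter
    (measurableSet_lt (measurable_countIn _ (h.measurableSet_lr _ _)) measurable_const)

lemma indicator_one_nonneg {α : Type*} (s : Set α) (x : α) : 0 ≤ s.indicator (1 : α → ℝ) x :=
  indicator_nonneg (fun _ _ => zero_le_one) _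

/-- Pointwise bound on the false discovery proportion, according to the cell of the grid in which
the estimated weight lies. -/
lemma SlabAssumptions.fdp_le_grid (h : SlabAssumptions γ κ) {t : ℝ} (hn : 1 ≤ n)
    (ht : t ∈ Ioo (0 : ℝ) (1 / 2)) {what : (Fin n → ℝ) → ℝ} {x : Fin n → ℝ}
    (hx : IsMMLE γ x (what x)) (θ : Fin n → ℝ) {w T v : ℕ → ℝ} {K : ℕ} {r : ℝ}
    (hw : ∀ k ≤ K, w k ∈ Icc (1 / (n : ℝ)) (1 / 2)) (hT : ∀ k ≤ K, 0 < T k) (hr : 0 ≤ r)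
    (hvT : ∀ k < K, 2 * v k / T (k + 1) ≤ r) :
    fdp θ (mci γ t what x) ≤
      {x : Fin n → ℝ | 0 ≤ ∑ i, score γ (w 0) (x i)}.indicator 1 x +
      countIn (nulls θ) {y | 1 / (4 * t) ≤ w K * lr γ y} x +
      ∑ k ∈ Finset.range K, (fewSignals γ t (w (k + 1)) (T (k + 1)) θ).indicator 1 x + r +
      ∑ k ∈ Finset.range K,
        max (countIn (nulls θ) {y | 1 / (4 * t) ≤ w k * lr γ y} x - 2 * v k) 0 / T (k + 1) := by
  have hw' := hx.mem_Ioc hn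
  have hd := mci_nonneg γ t what x
  set A := {x : Fin n → ℝ | 0 ≤ ∑ i, score γ (w 0) (x i)}.indicator (1 : (Fin n → ℝ) → ℝ) x with hA
  set B := countIn (nulls θ) {y | 1 / (4 * t) ≤ w K * lr γ y} x with hB
  have hA0 : 0 ≤ A := indicator_one_nonneg _ _
  have hB0 : 0 ≤ B := countIn_nonneg _ _ _
  have hCk : ∀ k ∈ Finset.range K,
      0 ≤ (fewSignals γ t (w (k + 1)) (T (k + 1)) θ).indicator (1 : (Fin n → ℝ) → ℝ) x :=
    fun k _ => indicator_one_nonneg _ _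
  have hDk : ∀ k ∈ Finset.range K,
      0 ≤ max (countIn (nulls θ) {y | 1 / (4 * t) ≤ w k * lr γ y} x - 2 * v k) 0 / T (k + 1) :=
    fun k hk => div_nonneg (le_max_right _ _) (hT _ (Finset.mem_range.1 hk)).le
  have hC0 := Finset.sum_nonneg hCk
  have hD0 := Finset.sum_nonneg hDk
  rcases lt_or_ge (w 0) (what x) with h1 | h1
  · have h2 : A = 1 := by
      rw [hA, indicator_of_mem, Pi.one_apply]
      exact h.sum_score_nonneg hn hx (hw 0 (Nat.zero_le K)).1 h1
    have := fdp_le_one θ hd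
    linarith
  rcases le_or_gt (what x) (w K) with h2 | h2
  · have h3 := (fdp_le_sum θ hd).trans (h.sum_mci_le ht hw' (hw K le_rfl).2 h2 (nulls θ))
    linarith
  -- The lower endpoint `w (k+1)` carries the score event and the detected signals, the upper
  -- endpoint `w k` bounds the false rejections.
  obtain ⟨k, hkK, hk1, hk2⟩ := exists_grid_cell h1 h2
  have hkr := Finset.mem_range.2 hkK
  have hsc := h.sum_score_nonneg hn hx (hw (k + 1) hkK).1 hk1
  have hTk := hT (k + 1) hkK
  rcases lt_or_ge (countIn (signals θ) {y | 2 / t ≤ w (k + 1) * lr γ y} x) (T (k + 1))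
    with h3 | h3
  · have h4 := Finset.single_le_sum hCk hkr
    have h5 : (fewSignals γ t (w (k + 1)) (T (k + 1)) θ).indicator (1 : (Fin n → ℝ) → ℝ) x = 1 := by
      rw [indicator_of_mem, Pi.one_apply]
      exact ⟨hsc, h3⟩
    have := fdp_le_one θ hd
    linarith
  · have h4 := Finset.single_le_sum hDk hkr
    have h5 := fdp_le_div θ hd hTk (h3.trans (h.le_sum_mci ht hw' hk1.le (signals θ)))
    have h6 := h.sum_mci_le ht hw' (hw k hkK.le).2 hk2 (nulls θ)
    set V := countIn (nulls θ) {y | 1 / (4 * t) ≤ w k * lr γ y} x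
    -- The part `2 v k` gives the uniform ratio `r`. Only the excess depends on the random cell, and
    -- it is paid by summing over all cells.
    have h7 : V ≤ 2 * v k + max (V - 2 * v k) 0 := by linarith [le_max_left (V - 2 * v k) 0]
    have h8 : (∑ i ∈ nulls θ, mci γ t what x i) / T (k + 1) ≤
        2 * v k / T (k + 1) + max (V - 2 * v k) 0 / T (k + 1) := by
      rw [← add_div]; gcongr; exact h6.trans h7
    have h9 := hvT k hkK
    linarith

/-- The integrated form of `fdp_le_grid`. -/
lemma SlabAssumptions.fdr_le_grid (h : SlabAssumptions γ κ) {t : ℝ} (hn : 1 ≤ n)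
    (ht : t ∈ Ioo (0 : ℝ) (1 / 2)) {what : (Fin n → ℝ) → ℝ}
    (hwhat : ∀ᵐ x ∂(volume : Measure (Fin n → ℝ)), IsMMLE γ x (what x)) (θ : Fin n → ℝ)
    {w T v : ℕ → ℝ} {K : ℕ} {r a b : ℝ}
    (hw : ∀ k ≤ K, w k ∈ Icc (1 / (n : ℝ)) (1 / 2)) (hT : ∀ k ≤ K, 0 < T k) (hr : 0 ≤ r)
    (hvT : ∀ k < K, 2 * v k / T (k + 1) ≤ r)
    (hnull : ∀ k ≤ K, ∑ i ∈ nulls θ,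
      (gaussianReal (θ i) 1).real {y | 1 / (4 * t) ≤ w k * lr γ y} ≤ v k)
    (htop : (dataLaw θ).real {x | 0 ≤ ∑ i, score γ (w 0) (x i)} ≤ a)
    (hfew : ∀ k < K, (dataLaw θ).real (fewSignals γ t (w (k + 1)) (T (k + 1)) θ) ≤ b) :
    fdr θ (mci γ t what) ≤
      a + v K + K * b + r + ∑ k ∈ Finset.range K, min (v k) 1 / T (k + 1) := by
  set μ := dataLaw θ with hμ
  have hae := (dataLaw_absolutelyContinuous θ).ae_le hwhat
  have hi := integrable_fdp_of_aemeasurable θ (h.aemeasurable_fdp hn ht hwhat θ)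
  have hmA : MeasurableSet {x : Fin n → ℝ | 0 ≤ ∑ i, score γ (w 0) (x i)} :=
    measurableSet_le measurable_const (h.measurable_sum_score (w 0))
  have hiA : Integrable ({x : Fin n → ℝ | 0 ≤ ∑ i, score γ (w 0) (x i)}.indicator
      (1 : (Fin n → ℝ) → ℝ)) μ := (integrable_const 1).indicator hmA
  have hiB := integrable_countIn θ (nulls θ) (h.measurableSet_lr (1 / (4 * t)) (w K))
  have hiCk : ∀ k ∈ Finset.range K, Integrable
      (fun x => (fewSignals γ t (w (k + 1)) (T (k + 1)) θ).indicator (1 : (Fin n → ℝ) → ℝ) x) μ :=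
    fun k _ => (integrable_const 1).indicator (h.measurableSet_fewSignals _ _ _ _)
  have hiDk : ∀ k ∈ Finset.range K, Integrable (fun x =>
      max (countIn (nulls θ) {y | 1 / (4 * t) ≤ w k * lr γ y} x - 2 * v k) 0 / T (k + 1)) μ :=
    fun k _ => (integrable_countIn_excess θ (nulls θ) (h.measurableSet_lr _ _) _).div_const _
  have hiC := integrable_finsetSum _ hiCk
  have hiD := integrable_finsetSum _ hiDk
  have hmain := integral_mono_ae hi
    ((((hiA.add hiB).add hiC).add (integrable_const r)).add hiD)
    (by
      filter_upwards [hae] with x hx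
      exact h.fdp_le_grid hn ht hx θ hw hT hr hvT)
  refine hmain.trans ?_
  rw [integral_add' (((hiA.add hiB).add hiC).add (integrable_const r)) hiD,
    integral_add' ((hiA.add hiB).add hiC) (integrable_const r),
    integral_add' (hiA.add hiB) hiC, integral_add' hiA hiB, integral_indicator_one hmA,
    integral_countIn θ _ (h.measurableSet_lr _ _), integral_finsetSum _ hiCk,
    integral_finsetSum _ hiDk]
  have h1 : ∫ _x, r ∂μ = r := by simp
  rw [h1]
  refine add_le_add (add_le_add (add_le_add (add_le_add htop (hnull K le_rfl)) ?_) le_rfl) ?_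
  · calc _ ≤ ∑ _k ∈ Finset.range K, b := Finset.sum_le_sum fun k hk => by
          have h2 := integral_indicator_one (μ := μ)
            (h.measurableSet_fewSignals t (w (k + 1)) (T (k + 1)) θ)
          calc _ = _ := h2
            _ ≤ b := hfew k (Finset.mem_range.1 hk)
      _ = K * b := by simp
  · refine Finset.sum_le_sum fun k hk => ?_
    have hk' := Finset.mem_range.1 hk
    rw [integral_div]
    have h2 := integral_countIn_excess_le θ (nulls θ) (h.measurableSet_lr (1 / (4 * t)) (w k))
      (hnull k hk'.le)
    have h3 := (hT (k + 1) hk').le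
    gcongr

end SpikeSlab

namespace SpikeSlab

variable {γ : ℝ → ℝ} {κ : ℝ} {n : ℕ}

/-- The bound on the false discovery rate in terms of the mean null scores along a dyadic grid of
weights that stops when the expected score falls below `B`. -/
lemma SlabAssumptions.fdr_le_of_dyadic (h : SlabAssumptions γ κ) {t : ℝ} (hn : 1 ≤ n)
    (ht : t ∈ Ioo (0 : ℝ) (1 / 2)) {what : (Fin n → ℝ) → ℝ}
    (hwhat : ∀ᵐ x ∂(volume : Measure (Fin n → ℝ)), IsMMLE γ x (what x)) (θ : Fin n → ℝ)
    (hs : 2 * ((signals θ).card : ℝ) ≤ n) {w₀ B C₁ C₂ R τ : ℝ} (hw₀ : w₀ ∈ Ioc (0 : ℝ) (1 / 4))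
    (hB : 2 ≤ B) (hC₁ : 0 < C₁) (hC₂ : 1 ≤ C₂) (hR : 0 < R)
    (hQ₀ : B ≤ n * nullScore γ w₀)
    (hnull : ∀ w ∈ Ioc 0 w₀, (gaussianReal 0 1).real {x | 1 / (4 * t) ≤ w * lr γ x} ≤
      C₁ * t * R * nullScore γ w)
    (hcap : ∀ w ∈ Ioc 0 w₀, 1 / (n : ℝ) ≤ w →
      ∑ i ∈ signals θ, ∫ x, cappedLR γ w x ∂(gaussianReal (θ i) 1) ≤
        C₂ / t * ∑ i ∈ signals θ, (gaussianReal (θ i) 1).real {x | 2 / t ≤ w * lr γ x} +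
        n * nullScore γ w / 20)
    (htop : (dataLaw θ).real {x | 0 ≤ ∑ i, score γ w₀ (x i)} ≤ τ) (J : ℕ) :
    fdr θ (mci γ t what) ≤ τ + 8 * C₁ * t * R * B +
      2 * Real.log n * Real.exp (-(t / (80 * C₂) * B)) + 1280 * C₁ * C₂ * R +
      (J * (640 * C₁ * C₂ * R) + 2 * (80 * C₂ / t) / 2 ^ J) := by
  have ht0 := ht.1
  have hw₀0 := hw₀.1
  have hC₂0 : 0 < C₂ := by linarith
  have hn0 : (0 : ℝ) < n := by positivity
  set w : ℕ → ℝ := fun k => w₀ / 2 ^ k with hwdef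
  set Q : ℕ → ℝ := fun k => n * nullScore γ (w k) with hQdef
  have hw0 : w 0 = w₀ := by simp [hwdef]
  have hwmem : ∀ k, w k ∈ Ioc 0 w₀ := fun k =>
    ⟨by positivity, div_le_self hw₀0.le (one_le_pow₀ (by norm_num))⟩
  have hw4 : ∀ k, w k ∈ Ioc (0 : ℝ) (1 / 4) := fun k => ⟨(hwmem k).1, (hwmem k).2.trans hw₀.2⟩
  have hw2 : ∀ k, w k ∈ Ioc (0 : ℝ) (1 / 2) := fun k => ⟨(hwmem k).1, by linarith [(hw4 k).2]⟩
  have hwsucc : ∀ k, 2 * w (k + 1) = w k := fun k => by simp only [hwdef, pow_succ]; field_simp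
  have hQnn : ∀ k, 0 ≤ Q k := fun k => mul_nonneg hn0.le (h.nullScore_nonneg (hw2 k))
  have hQ2 : ∀ k, 2 * Q (k + 1) ≤ Q k := fun k => by
    have h1 := h.two_mul_nullScore_le (hw4 (k + 1))
    rw [hwsucc] at h1
    simp only [hQdef]
    nlinarith
  have hQ8 : ∀ k, Q k ≤ 8 * Q (k + 1) := fun k => by
    have h1 := h.nullScore_two_mul_le (hw4 (k + 1))
    rw [hwsucc] at h1
    simp only [hQdef]
    nlinarith
  have hQadd : ∀ k j, 2 ^ j * Q (k + j) ≤ Q k := fun k j => by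
    induction j with
    | zero => simp
    | succ j ih =>
      have h1 := hQ2 (k + j)
      have h2 : (0 : ℝ) < 2 ^ j := by positivity
      calc 2 ^ (j + 1) * Q (k + (j + 1)) = 2 ^ j * (2 * Q (k + j + 1)) := by
            rw [pow_succ, add_assoc]; ring
        _ ≤ 2 ^ j * Q (k + j) := by gcongr
        _ ≤ Q k := ih
  have hQn : Q 0 ≤ n := by
    have h1 := h.nullScore_le (hw2 0)
    have h2 := (hw2 0).2
    simp only [hQdef]
    nlinarith
  -- `Q` at least halves at each step and starts below `n`.
  have hex : ∃ k, Q (k + 1) < B := by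
    obtain ⟨k, hk⟩ := pow_unbounded_of_one_lt (n : ℝ) (by norm_num : (1 : ℝ) < 2)
    refine ⟨k, ?_⟩
    have h1 := hQadd 0 k
    rw [zero_add] at h1
    have h2 := hQ2 k
    have h3 : Q k ≤ 1 := by
      by_contra hcon
      push Not at hcon
      nlinarith
    linarith [hQnn (k + 1)]
  classical
  set K := Nat.find hex with hK
  have hKlt : Q (K + 1) < B := Nat.find_spec hex
  have hKge : ∀ k ≤ K, B ≤ Q k := by
    intro k hk
    rcases k with _ | k
    · simp only [hQdef, hw0]; exact hQ₀
    · exact not_lt.1 (Nat.find_min hex (Nat.lt_of_succ_le hk))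
  -- Stopping above `B ≥ 2` keeps the grid inside the range of the maximisation, because `q(w) ≤
  -- 2w`.
  have hwn : ∀ k ≤ K, 1 / (n : ℝ) ≤ w k := fun k hk => by
    have h1 := hKge k hk
    have h2 := h.nullScore_le (hw2 k)
    simp only [hQdef] at h1
    rw [div_le_iff₀ hn0]
    nlinarith
  have hKlog : (K : ℝ) ≤ 2 * Real.log n := by
    have h1 := hQadd 0 K
    rw [zero_add] at h1
    have h2 := hKge K le_rfl
    have h3 : (2 : ℝ) ^ K ≤ n := by
      have : (0 : ℝ) < 2 ^ K := by positivity
      nlinarith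
    have h4 := Real.log_le_log (by positivity) h3
    rw [Real.log_pow] at h4
    have h5 : (1 / 2 : ℝ) ≤ Real.log 2 := by linarith [Real.log_two_gt_d9]
    have h6 : (0 : ℝ) ≤ K := Nat.cast_nonneg K
    nlinarith
  set c := t / (80 * C₂) with hc
  have hc0 : 0 < c := by positivity
  have hTpos : ∀ k ≤ K, 0 < c * Q k := fun k hk =>
    mul_pos hc0 (lt_of_lt_of_le (by linarith) (hKge k hk))
  have hgrid := h.fdr_le_grid hn ht hwhat θ (w := w) (T := fun k => c * Q k)
    (v := fun k => C₁ * t * R * Q k) (K := K) (r := 1280 * C₁ * C₂ * R) (a := τ)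
    (b := Real.exp (-(c * B))) (fun k hk => ⟨hwn k hk, (hw2 k).2⟩) hTpos (by positivity)
    -- The factor `t` cancels between `v` and the signal threshold: `1280 = 2 · 8 · 80`.
    (fun k hk => by
      rw [div_le_iff₀ (hTpos (k + 1) hk)]
      calc 2 * (C₁ * t * R * Q k) ≤ 2 * (C₁ * t * R * (8 * Q (k + 1))) := by
            gcongr; exact hQ8 k
        _ = 1280 * C₁ * C₂ * R * (c * Q (k + 1)) := by rw [hc]; field_simp; ring)
    (fun k _ => by
      have h1 : ∀ i ∈ nulls θ, (gaussianReal (θ i) 1).real {y | 1 / (4 * t) ≤ w k * lr γ y} ≤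
          C₁ * t * R * nullScore γ (w k) := fun i hi => by
        rw [(Finset.mem_filter.1 hi).2]; exact hnull _ (hwmem k)
      refine (Finset.sum_le_card_nsmul _ _ _ h1).trans ?_
      rw [nsmul_eq_mul]
      have h2 : ((nulls θ).card : ℝ) ≤ n := by
        have := card_nulls_add_card_signals θ
        exact_mod_cast (by omega : (nulls θ).card ≤ n)
      have h3 := h.nullScore_nonneg (hw2 k)
      calc ((nulls θ).card : ℝ) * (C₁ * t * R * nullScore γ (w k))
          ≤ n * (C₁ * t * R * nullScore γ (w k)) := by gcongr
        _ = C₁ * t * R * Q k := by simp only [hQdef]; ring)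
    (by simp only [hw0]; exact htop)
    (fun k hk => by
      refine (h.few_signals_concentration (hw2 (k + 1)) ht hC₂ θ hs
        (hcap _ (hwmem _) (hwn _ hk))).trans (Real.exp_le_exp.2 (neg_le_neg ?_))
      have := hKge (k + 1) hk
      gcongr)
  refine hgrid.trans ?_
  have h1 : C₁ * t * R * Q K ≤ 8 * C₁ * t * R * B := by
    calc C₁ * t * R * Q K ≤ C₁ * t * R * (8 * B) := by
          gcongr; linarith [hQ8 K]
      _ = _ := by ring
  have h2 : (K : ℝ) * Real.exp (-(c * B)) ≤ 2 * Real.log n * Real.exp (-(c * B)) := by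
    gcongr
  have h3 : ∑ k ∈ Finset.range K, min (C₁ * t * R * Q k) 1 / (c * Q (k + 1)) ≤
      J * (640 * C₁ * C₂ * R) + 2 * (80 * C₂ / t) / 2 ^ J := by
    refine le_trans ?_ (sum_min_geometric_le (by positivity) (by positivity) J K)
    -- Cells are counted back from the stopping index, since `Q` grows geometrically in that
    -- direction from a value of at least `B`.
    rw [← Finset.sum_range_reflect (fun j => min (640 * C₁ * C₂ * R) (80 * C₂ / t / 2 ^ j)) K]
    refine Finset.sum_le_sum fun k hk => ?_
    have hkK := Finset.mem_range.1 hk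
    have hT := hTpos (k + 1) hkK
    have hQk : 0 < Q (k + 1) := lt_of_lt_of_le (by linarith) (hKge (k + 1) hkK)
    refine le_min ?_ ?_
    · rw [div_le_iff₀ hT]
      refine (min_le_left _ _).trans ?_
      calc C₁ * t * R * Q k ≤ C₁ * t * R * (8 * Q (k + 1)) := by gcongr; exact hQ8 k
        _ = 640 * C₁ * C₂ * R * (c * Q (k + 1)) := by rw [hc]; field_simp; ring
    · have h4 := hQadd (k + 1) (K - 1 - k)
      rw [show k + 1 + (K - 1 - k) = K by omega] at h4
      have h5 := hKge K le_rfl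
      have h6 : (0 : ℝ) < 2 ^ (K - 1 - k) := by positivity
      have h7 : 2 ^ (K - 1 - k) ≤ Q (k + 1) := by nlinarith
      calc min (C₁ * t * R * Q k) 1 / (c * Q (k + 1)) ≤ 1 / (c * 2 ^ (K - 1 - k)) := by
            gcongr; exact min_le_right _ _
        _ = 80 * C₂ / t / 2 ^ (K - 1 - k) := by rw [hc]; field_simp
  linarith

end SpikeSlab

namespace SpikeSlab

variable {γ : ℝ → ℝ} {κ : ℝ} {n : ℕ}

/-! ### Sparse vectors and large samples -/

lemma card_signals_le {s : ℕ} {θ : Fin n → ℝ} (hθ : θ ∈ sparseVectors n s) :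
    (signals θ).card ≤ s := by
  have h1 : {i | θ i ≠ 0} = (signals θ : Set (Fin n)) := by ext i; simp [signals]
  have h2 : {i | θ i ≠ 0}.ncard ≤ s := hθ
  rwa [h1, Set.ncard_coe_finset] at h2

/-- The bound `W` brings `w₀ = n^(-(1-υ)/4)` into the range of the earlier estimates; `M₁`
quantifies sparsity, `M₂` makes the expected score exceed multiples of `log n`, and `M₃` lets `log
log n` dominate constants depending on `t`. -/
lemma eventually_large (υ : ℝ) (hυ : υ ∈ Ioo (0 : ℝ) 1) {W : ℝ} (hW : 0 < W) (M₁ M₂ M₃ : ℝ) :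
    ∀ᶠ n : ℕ in atTop, (n : ℝ) ^ (-((1 - υ) / 4)) ≤ W ∧ M₁ ≤ (n : ℝ) ^ ((1 - υ) / 2) ∧
      M₂ * Real.log n ≤ (n : ℝ) ^ ((1 + υ) / 2) ∧ M₃ ≤ Real.log (Real.log n) := by
  obtain ⟨h0, h1⟩ := hυ
  have hcast := tendsto_natCast_atTop_atTop (R := ℝ)
  have e1 := ((tendsto_rpow_neg_atTop (by linarith : 0 < (1 - υ) / 4)).comp
    hcast).eventually_le_const hW
  have e2 := ((tendsto_rpow_atTop (by linarith : 0 < (1 - υ) / 2)).comp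
    hcast).eventually_ge_atTop M₁
  have e3 : ∀ᶠ n : ℕ in atTop, M₂ * Real.log n ≤ (n : ℝ) ^ ((1 + υ) / 2) := by
    have h2 := (isLittleO_log_rpow_atTop (by linarith : 0 < (1 + υ) / 2)).bound
      (by positivity : 0 < (|M₂| + 1)⁻¹)
    filter_upwards [hcast.eventually h2, hcast.eventually (eventually_ge_atTop 1)] with n hn hn1
    have hl : 0 ≤ Real.log n := Real.log_nonneg hn1
    have hp : 0 ≤ (n : ℝ) ^ ((1 + υ) / 2) := by positivity
    rw [Real.norm_of_nonneg hl, Real.norm_of_nonneg hp, ← div_eq_inv_mul,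
      le_div_iff₀ (by positivity)] at hn
    nlinarith [le_abs_self M₂]
  have e4 := ((Real.tendsto_log_atTop.comp Real.tendsto_log_atTop).comp
    hcast).eventually_ge_atTop M₃
  filter_upwards [e1, e2, e3, e4] with n a1 a2 a3 a4 using ⟨a1, a2, a3, a4⟩

lemma SlabAssumptions.integral_cappedLR_le_one (h : SlabAssumptions γ κ) {w : ℝ} (hw : 0 ≤ w)
    (θ : ℝ) : ∫ x, cappedLR γ w x ∂(gaussianReal θ 1) ≤ 1 := by
  have := integral_mono_of_nonneg (μ := gaussianReal θ 1)
    (ae_of_all _ (h.cappedLR_nonneg hw)) (integrable_const 1)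
    (ae_of_all _ (cappedLR_le_one γ w))
  simpa using this

lemma rpow_half_add {υ x : ℝ} (hx : 0 < x) :
    x ^ ((1 + υ) / 2) = x ^ υ * x ^ ((1 - υ) / 2) := by
  rw [← Real.rpow_add hx]; congr 1; ring

/-- The sum of the error terms of `fdr_le_of_dyadic` is of the announced order. -/
lemma error_terms_le {t C₁ C₂ L κ : ℝ} (ht : 0 < t) (hC₁ : 0 < C₁) (hC₂ : 1 ≤ C₂)
    (hκ : κ ≤ 2) (hL0 : 0 < L) (hL1 : 1 ≤ Real.log L) (htL : Real.log (1 / t) ≤ Real.log L) :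
    1 / L + 8 * C₁ * t * (L ^ (κ / 2))⁻¹ * (240 * C₂ / t * Real.log L) +
      2 * L * Real.exp (-(t / (80 * C₂) * (240 * C₂ / t * Real.log L))) +
      1280 * C₁ * C₂ * (L ^ (κ / 2))⁻¹ +
      ((⌈4 * Real.log L⌉₊ : ℕ) * (640 * C₁ * C₂ * (L ^ (κ / 2))⁻¹) +
        2 * (80 * C₂ / t) / 2 ^ ⌈4 * Real.log L⌉₊) ≤
    (3 + 6400 * C₁ * C₂ + 160 * C₂) * (Real.log L / L ^ (κ / 2)) := by
  have hC₂0 : 0 < C₂ := by linarith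
  have hLe : Real.exp 1 ≤ L := (Real.le_log_iff_exp_le hL0).1 hL1
  have hLone : 1 ≤ L := by linarith [Real.add_one_le_exp 1]
  have htL' : 1 / t ≤ L := (Real.log_le_log_iff (by positivity) hL0).1 htL
  set ℓ := Real.log L with hℓ
  have hexpl : Real.exp ℓ = L := Real.exp_log hL0
  set R := (L ^ (κ / 2))⁻¹ with hR
  have hR0 : 0 < R := inv_pos.2 (Real.rpow_pos_of_pos hL0 _)
  -- This uses `κ ≤ 2`: errors of order `1/log n` are within the announced rate.
  have hLR : 1 / L ≤ R := by
    rw [one_div, hR]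
    gcongr
    calc L ^ (κ / 2) ≤ L ^ (1 : ℝ) := Real.rpow_le_rpow_of_exponent_le hLone (by linarith)
      _ = L := Real.rpow_one L
  have hRl : R ≤ R * ℓ := le_mul_of_one_le_right hR0.le hL1
  have h1 : 8 * C₁ * t * R * (240 * C₂ / t * ℓ) = 1920 * C₁ * C₂ * (R * ℓ) := by
    field_simp; ring
  -- The stopping level is chosen so that the exponent is exactly `3 log L`; the factor `L` counting
  -- the cells is then harmless.
  have h2 : 2 * L * Real.exp (-(t / (80 * C₂) * (240 * C₂ / t * ℓ))) ≤ 2 * (1 / L) := by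
    have e1 : t / (80 * C₂) * (240 * C₂ / t * ℓ) = 3 * ℓ := by field_simp; ring
    rw [e1, ← hexpl, mul_assoc, ← Real.exp_add, one_div, ← Real.exp_neg]
    gcongr
    linarith
  have h3 : ((⌈4 * ℓ⌉₊ : ℕ) : ℝ) ≤ 5 * ℓ := by
    have := (Nat.ceil_lt_add_one (by linarith : 0 ≤ 4 * ℓ)).le
    linarith
  -- One factor `L` absorbs `1/t`, the other supplies the decay.
  have h4 : L * L ≤ 2 ^ ⌈4 * ℓ⌉₊ := by
    rw [← Real.rpow_natCast, Real.rpow_def_of_pos (by norm_num), ← hexpl, ← Real.exp_add]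
    apply Real.exp_le_exp.2
    have e1 : (1 / 2 : ℝ) ≤ Real.log 2 := by linarith [Real.log_two_gt_d9]
    have e2 := Nat.le_ceil (4 * ℓ)
    nlinarith
  have h5 : 2 * (80 * C₂ / t) / 2 ^ ⌈4 * ℓ⌉₊ ≤ 160 * C₂ * (1 / L) := by
    calc 2 * (80 * C₂ / t) / 2 ^ ⌈4 * ℓ⌉₊ = 160 * C₂ * (1 / t) / 2 ^ ⌈4 * ℓ⌉₊ := by ring
      _ ≤ 160 * C₂ * L / (L * L) := by gcongr
      _ = 160 * C₂ * (1 / L) := by field_simp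
  have h6 : ((⌈4 * ℓ⌉₊ : ℕ) : ℝ) * (640 * C₁ * C₂ * R) ≤ 3200 * C₁ * C₂ * (R * ℓ) := by
    calc _ ≤ 5 * ℓ * (640 * C₁ * C₂ * R) := by gcongr
      _ = _ := by ring
  have h7 : 1 / L ≤ R * ℓ := hLR.trans hRl
  have h8 : 1280 * C₁ * C₂ * R ≤ 1280 * C₁ * C₂ * (R * ℓ) := by gcongr
  have h9 : 160 * C₂ * (1 / L) ≤ 160 * C₂ * (R * ℓ) := by gcongr
  have h10 : ℓ / L ^ (κ / 2) = R * ℓ := by rw [hR, div_eq_inv_mul]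
  rw [h10, h1]
  linarith

end SpikeSlab

/-! ### Choice of the parameters and conclusion -/

set_option maxHeartbeats 1000000 in
theorem theorem5 (γ : ℝ → ℝ) (κ υ : ℝ) (hγ : SpikeSlab.SlabAssumptions γ κ)
    (hυ : υ ∈ Set.Ioo (0 : ℝ) 1) :
    ∃ C : ℝ, 0 < C ∧ ∀ t ∈ Set.Ioo (0 : ℝ) (1 / 2), ∃ N₀ : ℕ, ∀ n : ℕ, N₀ ≤ n →
      ∀ what : (Fin n → ℝ) → ℝ,
        (∀ᵐ x ∂(MeasureTheory.volume : MeasureTheory.Measure (Fin n → ℝ)),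
          SpikeSlab.IsMMLE γ x (what x)) →
        ∀ s : ℕ, (s : ℝ) ≤ (n : ℝ) ^ υ → ∀ θ ∈ SpikeSlab.sparseVectors n s,
          MeasureTheory.Integrable
            (fun x => SpikeSlab.fdp θ (SpikeSlab.mci γ t what x)) (SpikeSlab.dataLaw θ) ∧
          SpikeSlab.fdr θ (SpikeSlab.mci γ t what) ≤
            C * (Real.log (Real.log n) / (Real.log n) ^ (κ / 2)) := by
  open SpikeSlab in
  have hυ0 := hυ.1
  have hυ1 := hυ.2
  -- With this choice `n^(1-2η) = n^((1+υ)/2)`, which exceeds the number of signals by the factor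
  -- `n^((1-υ)/2)`.
  set η := (1 - υ) / 4 with hη
  have hη0 : 0 < η := by rw [hη]; linarith
  have hη1 : η < 1 := by rw [hη]; linarith
  obtain ⟨c, wc, hc, hwc, hwc4, hq⟩ := hγ.exists_nullScore_ge hη0
  obtain ⟨Cn, wn, hCn, hwn, -, hnull⟩ := hγ.exists_null_rejection_le
  obtain ⟨Ca, hCa, hcap⟩ := hγ.exists_cappedLR_le ⟨hη0, hη1⟩
  set C₂ := max Ca 1 with hC₂
  have hC₂1 : 1 ≤ C₂ := le_max_right _ _
  have hC₂0 : 0 < C₂ := by linarith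
  -- On the grid `w ≤ n^(-η)`, so `log(1/w) ≥ η log n`; this turns the rate in `w` into a rate in
  -- `n`.
  set C₁ := Cn * (η ^ (κ / 2))⁻¹ with hC₁
  have hηκ : 0 < η ^ (κ / 2) := Real.rpow_pos_of_pos hη0 _
  have hC₁0 : 0 < C₁ := by positivity
  refine ⟨3 + 6400 * C₁ * C₂ + 160 * C₂, by positivity, fun t ht => ?_⟩
  have ht0 := ht.1
  obtain ⟨wa, hwa, hcap⟩ := hcap t ht
  obtain ⟨N₀, hN₀⟩ := eventually_atTop.1 ((eventually_large υ hυ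
    (W := min wc (min wn wa)) (by positivity) (max 2 (max (20 * C₂ / c) (10 / c)))
    (max (32 / c) (240 * C₂ / t / c)) (max 1 (Real.log (1 / t)))).and (eventually_ge_atTop 1))
  refine ⟨N₀, fun n hnN what hwhat s hs θ hθ => ?_⟩
  obtain ⟨⟨hw₀, hM₁, hM₂, hM₃⟩, hn1⟩ := hN₀ n hnN
  have hn0 : (0 : ℝ) < n := by positivity
  refine ⟨integrable_fdp_of_aemeasurable θ (hγ.aemeasurable_fdp hn1 ht hwhat θ), ?_⟩
  set L := Real.log n with hL
  set w₀ := (n : ℝ) ^ (-η) with hw₀def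
  have hw₀0 : 0 < w₀ := Real.rpow_pos_of_pos hn0 _
  have hw₀c : w₀ ≤ wc := hw₀.trans (min_le_left _ _)
  have hw₀n : w₀ ≤ wn := hw₀.trans ((min_le_right _ _).trans (min_le_left _ _))
  have hw₀a : w₀ ≤ wa := hw₀.trans ((min_le_right _ _).trans (min_le_right _ _))
  have hL1 : 1 ≤ Real.log L := (le_max_left _ _).trans hM₃
  have hLt : Real.log (1 / t) ≤ Real.log L := (le_max_right _ _).trans hM₃
  have hL0 : 0 < L := by
    have h0 : 0 ≤ L := Real.log_nonneg (by exact_mod_cast hn1)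
    rcases h0.eq_or_lt with h1 | h1
    · rw [← h1, Real.log_zero] at hL1; linarith
    · exact h1
  have hlogL : Real.log L ≤ L := (Real.log_le_sub_one_of_pos hL0).trans (by linarith)
  have hnυ : 0 < (n : ℝ) ^ υ := Real.rpow_pos_of_pos hn0 _
  have hcard : ((signals θ).card : ℝ) ≤ (n : ℝ) ^ υ :=
    le_trans (by exact_mod_cast card_signals_le hθ) hs
  have hsplit := rpow_half_add (υ := υ) hn0
  have hP20 : 20 * C₂ / c ≤ (n : ℝ) ^ ((1 - υ) / 2) :=
    ((le_max_left _ _).trans (le_max_right _ _)).trans hM₁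
  have hP10 : 10 / c ≤ (n : ℝ) ^ ((1 - υ) / 2) :=
    ((le_max_right _ _).trans (le_max_right _ _)).trans hM₁
  have hP2 : 2 ≤ (n : ℝ) ^ ((1 - υ) / 2) := (le_max_left _ _).trans hM₁
  have hP32 : 32 / c * L ≤ (n : ℝ) ^ ((1 + υ) / 2) :=
    (mul_le_mul_of_nonneg_right (le_max_left _ _) hL0.le).trans hM₂
  have hPt : 240 * C₂ / t / c * L ≤ (n : ℝ) ^ ((1 + υ) / 2) :=
    (mul_le_mul_of_nonneg_right (le_max_right _ _) hL0.le).trans hM₂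
  have hn_one : (1 : ℝ) ≤ n := by exact_mod_cast hn1
  have hsn : 2 * ((signals θ).card : ℝ) ≤ n := by
    calc 2 * ((signals θ).card : ℝ) ≤ (n : ℝ) ^ ((1 - υ) / 2) * (n : ℝ) ^ υ := by gcongr
      _ = (n : ℝ) ^ ((1 + υ) / 2) := by rw [hsplit, mul_comm]
      _ ≤ (n : ℝ) ^ (1 : ℝ) := Real.rpow_le_rpow_of_exponent_le hn_one (by linarith)
      _ = n := Real.rpow_one _
  have hQ₀ : c * (n : ℝ) ^ ((1 + υ) / 2) ≤ n * nullScore γ w₀ := by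
    have h1 := hq w₀ ⟨hw₀0, hw₀c⟩
    have h2 : (n : ℝ) ^ (-(2 * η)) ≤ w₀ ^ (1 + η) := by
      rw [hw₀def, ← Real.rpow_mul hn0.le]
      exact Real.rpow_le_rpow_of_exponent_le hn_one (by nlinarith)
    calc c * (n : ℝ) ^ ((1 + υ) / 2) = n * (c * (n : ℝ) ^ (-(2 * η))) := by
          have h3 : (n : ℝ) ^ ((1 + υ) / 2) = n * (n : ℝ) ^ (-(2 * η)) := by
            nth_rewrite 2 [← Real.rpow_one (n : ℝ)]
            rw [← Real.rpow_add hn0, hη]; congr 1; ring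
          rw [h3]; ring
      _ ≤ n * (c * w₀ ^ (1 + η)) := by gcongr
      _ ≤ _ := by gcongr
  have hmain := hγ.fdr_le_of_dyadic hn1 ht hwhat θ hsn (w₀ := w₀)
    (B := 240 * C₂ / t * Real.log L) (C₁ := C₁) (C₂ := C₂) (R := (L ^ (κ / 2))⁻¹) (τ := 1 / L)
    ⟨hw₀0, hw₀c.trans hwc4⟩ ?_ hC₁0 hC₂1 (inv_pos.2 (Real.rpow_pos_of_pos hL0 _)) ?_ ?_ ?_ ?_
    ⌈4 * Real.log L⌉₊
  · exact hmain.trans (error_terms_le ht0 hC₁0 hC₂1 hγ.kappa_mem.2 hL0 hL1 hLt)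
  · have h1 : 2 ≤ 240 * C₂ / t := by rw [le_div_iff₀ ht0]; linarith [ht.2]
    nlinarith
  · refine le_trans ?_ hQ₀
    calc 240 * C₂ / t * Real.log L ≤ 240 * C₂ / t * L := by gcongr
      _ = c * (240 * C₂ / t / c * L) := by field_simp
      _ ≤ _ := by gcongr
  · intro w hw
    have hq0 : 0 ≤ nullScore γ w :=
      hγ.nullScore_nonneg ⟨hw.1, by linarith [hw.2]⟩
    refine (hnull t ht w ⟨hw.1, hw.2.trans hw₀n⟩).trans ?_
    have h1 : η * L ≤ -Real.log w := by
      have h2 := Real.log_le_log hw.1 hw.2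
      rw [hw₀def, Real.log_rpow hn0] at h2
      linarith
    have h3 : η ^ (κ / 2) * L ^ (κ / 2) ≤ (-Real.log w) ^ (κ / 2) := by
      rw [← Real.mul_rpow hη0.le hL0.le]
      exact Real.rpow_le_rpow (by positivity) h1 (by linarith [hγ.kappa_mem.1])
    have h4 : 0 < L ^ (κ / 2) := Real.rpow_pos_of_pos hL0 _
    calc Cn * t * ((-Real.log w) ^ (κ / 2))⁻¹ * nullScore γ w
        ≤ Cn * t * (η ^ (κ / 2) * L ^ (κ / 2))⁻¹ * nullScore γ w := by gcongr
      _ = _ := by rw [hC₁, mul_inv]; ring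
  · intro w hw hwn'
    have hw0 := hw.1
    have hwη : 0 < w ^ (1 - η) := Real.rpow_pos_of_pos hw0 _
    have h1 : ∀ i ∈ signals θ, ∫ x, cappedLR γ w x ∂(ProbabilityTheory.gaussianReal (θ i) 1) ≤
        C₂ / t * (ProbabilityTheory.gaussianReal (θ i) 1).real {x | 2 / t ≤ w * lr γ x} +
          C₂ * w ^ (1 - η) := fun i _ => by
      refine (hcap w ⟨hw0, hw.2.trans hw₀a⟩ (θ i)).trans ?_
      have : Ca ≤ C₂ := le_max_left _ _
      gcongr
    refine (Finset.sum_le_sum h1).trans ?_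
    rw [Finset.sum_add_distrib, ← Finset.mul_sum, Finset.sum_const, nsmul_eq_mul]
    gcongr
    -- The remainder `n^υ w^(1-η)` is compared with `n w^(1+η)`: since `w ≥ 1/n`, the ratio `w^(2η)`
    -- is at least `n^(-2η)`.
    have h2 := hq w ⟨hw0, hw.2.trans hw₀c⟩
    have h3 : (n : ℝ) ^ (-(2 * η)) ≤ w ^ (2 * η) := by
      rw [Real.rpow_neg hn0.le, ← Real.inv_rpow hn0.le, ← one_div]
      exact Real.rpow_le_rpow (by positivity) hwn' (by positivity)
    have h5 : (n : ℝ) * (n : ℝ) ^ (-(2 * η)) = (n : ℝ) ^ υ * (n : ℝ) ^ ((1 - υ) / 2) := by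
      rw [← hsplit]
      nth_rewrite 1 [← Real.rpow_one (n : ℝ)]
      rw [← Real.rpow_add hn0, hη]; congr 1; ring
    rw [le_div_iff₀ (by norm_num)]
    calc ((signals θ).card : ℝ) * (C₂ * w ^ (1 - η)) * 20
        ≤ (n : ℝ) ^ υ * (C₂ * w ^ (1 - η)) * 20 := by gcongr
      _ = c * w ^ (1 - η) * ((n : ℝ) ^ υ * (20 * C₂ / c)) := by field_simp
      _ ≤ c * w ^ (1 - η) * ((n : ℝ) ^ υ * (n : ℝ) ^ ((1 - υ) / 2)) := by gcongr
      _ = n * (c * (w ^ (1 - η) * (n : ℝ) ^ (-(2 * η)))) := by rw [← h5]; ring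
      _ ≤ n * (c * (w ^ (1 - η) * w ^ (2 * η))) := by gcongr
      _ = n * (c * w ^ (1 + η)) := by rw [← Real.rpow_add hw0]; ring_nf
      _ ≤ _ := by gcongr
  · have hw2 : w₀ ∈ Set.Ioc (0 : ℝ) (1 / 2) := ⟨hw₀0, by linarith [hw₀c.trans hwc4]⟩
    refine (hγ.score_concentration hw2 θ hsn ?_).trans ?_
    -- At the top of the grid the trivial bound 1 per signal suffices, as `n^υ` is far below `n
    -- q(w₀)`.
    · calc ∑ i ∈ signals θ, ∫ x, cappedLR γ w₀ x ∂(ProbabilityTheory.gaussianReal (θ i) 1)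
          ≤ ∑ _i ∈ signals θ, (1 : ℝ) :=
            Finset.sum_le_sum fun i _ => hγ.integral_cappedLR_le_one hw₀0.le _
        _ ≤ (n : ℝ) ^ υ := by simpa using hcard
        _ = c * ((n : ℝ) ^ υ * (10 / c)) / 10 := by field_simp
        _ ≤ c * ((n : ℝ) ^ υ * (n : ℝ) ^ ((1 - υ) / 2)) / 10 := by gcongr
        _ ≤ _ := by rw [← hsplit]; gcongr
    · have h1 : L ≤ n * nullScore γ w₀ / 32 := by
        rw [le_div_iff₀ (by norm_num)]
        calc L * 32 = c * (32 / c * L) := by field_simp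
          _ ≤ c * (n : ℝ) ^ ((1 + υ) / 2) := by gcongr
          _ ≤ _ := hQ₀
      calc Real.exp (-(n * nullScore γ w₀ / 32)) ≤ Real.exp (-Real.log L) :=
            Real.exp_le_exp.2 (by linarith)
        _ = 1 / L := by rw [Real.exp_neg, Real.exp_log hL0, one_div]
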